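/- Let $p$ be a prime, $\mathcal H_p=\mathbb P_1(\mathbb C_p)\setminus\mathbb P_1(\mathbb Q_p)$, and $\Gamma=\mathbf{SL}_2(\mathbb Z[1/p])$. Let $\mathcal A$ be the ring of rigid analytic functions on $\mathcal H_p$, $\Omega^1_{\rm rig}(\mathcal H_p)=\mathcal A\,dz$, and let $K_p\subset\mathbb C_p$ be the quadratic unramified extension of $\mathbb Q_p$, so that $F\mapsto dF/F$ induces $\mathrm{dlog}:(\mathcal A^\times/K_p^\times)\otimes\Lambda\to\Omega^1_{\rm rig}(\mathcal H_p)\otimes\Lambda$ for every abelian group $\Lambda$. Let $f\in S_2(\Gamma_0(p))$, and let $\Lambda_f\subset\mathbb C$ be a finitely generated subgroup (for instance a lattice, if $f$ is an eigenform with rational Fourier coefficients) which contains all the periods $2\pi i\int_r^s f(z)\,dz$ with $r,s\in\mathbb P_1(\mathbb Q)$. Let $r,s\in\mathbb P_1(\mathbb Q)$. Then: (1) There is a unique $\Lambda_f$-valued measure (finitely additive function on compact open subsets) $\mu_f[r,s]$ on $\mathbb P_1(\mathbb Q_p)$ of total mass $0$ such that $$\mu_f[r,s](\gamma^{-1}U_\infty)=2\pi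 i\int_{\gamma r}^{\gamma s}f(z)\,dz\qquad\text{for all }\gamma\in\Gamma,\quad\text{where } U_\infty=\mathbb P_1(\mathbb Q_p)\setminus\mathbb Z_p .$$ (2) Its Poisson transform $$\omega_f[r,s]=\int_{\mathbb P_1(\mathbb Q_p)}\frac{dz}{z-t}\,d\mu_f[r,s](t)$$ is a well-defined element of $\Omega^1_{\rm rig}(\mathcal H_p)\otimes\Lambda_f$. (3) There is an element $F_f[r,s]\in(\mathcal A^\times/K_p^\times)\otimes\Lambda_f$ satisfying $\mathrm{dlog}\,F_f[r,s]=\omega_f[r,s]$. -/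

import Mathlib

namespace MockHilbert

open Polynomial Filter Topology

section Ultrametric

set_option linter.unusedSectionVars false

variable {K : Type*} [NontriviallyNormedField K] [IsUltrametricDist K] [IsAlgClosed K]

theorem norm_eval_eq_prod (P : K[X]) (z : K) :
    ‖P.eval z‖ = ‖P.leadingCoeff‖ * (P.roots.map fun a => ‖z - a‖).prod := by
  rw [(IsAlgClosed.splits P).eval_eq_prod_roots z, norm_mul]
  congr 1
  have h := map_multiset_prod (normHom : K →*₀ ℝ) (P.roots.map fun a => z - a)
  rw [Multiset.map_map] at h
  exact h

theorem ultra_sub_le {r : ℝ} {a b c : K} (h : ‖a - b‖ ≤ r) (h' : ‖b - c‖ ≤ r) :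
    ‖a - c‖ ≤ r := by
  have : a - c = (a - b) + (b - c) := by ring
  rw [this]
  exact (IsUltrametricDist.norm_add_le_max _ _).trans (max_le h h')

theorem ultra_sub_eq {a b c : K} (h : ‖a - b‖ < ‖b - c‖) : ‖a - c‖ = ‖b - c‖ := by
  have : a - c = (a - b) + (b - c) := by ring
  rw [this, IsUltrametricDist.norm_add_eq_max_of_norm_ne_norm h.ne, max_eq_right h.le]

/-- Finitely many residue classes of the closed unit ball can be avoided simultaneously. -/
theorem exists_unit_avoid (T : Multiset K) (hT : ∀ b ∈ T, ‖b‖ ≤ 1) :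
    ∃ u : K, ‖u‖ = 1 ∧ ∀ b ∈ T, ‖u - b‖ = 1 := by
  set R : K[X] := ((0 ::ₘ T).map fun b => X - C b).prod with hR
  have hmon : R.Monic := monic_multiset_prod_of_monic _ _ fun b _ => monic_X_sub_C b
  have hdeg : R.natDegree = T.card + 1 := by
    rw [hR, natDegree_multiset_prod_X_sub_C_eq_card]; simp
  have hdeg' : (R - 1).degree ≠ 0 := by
    have h1 : (1 : K[X]).degree < R.degree := by
      rw [degree_one, degree_eq_natDegree hmon.ne_zero, hdeg]
      exact_mod_cast Nat.succ_pos T.card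
    rw [degree_sub_eq_left_of_degree_lt h1, degree_eq_natDegree hmon.ne_zero, hdeg]
    exact_mod_cast Nat.succ_ne_zero T.card
  obtain ⟨u, hu⟩ := IsAlgClosed.exists_root (R - 1) hdeg'
  have hprod : ((0 ::ₘ T).map fun b => ‖u - b‖).prod = 1 := by
    have h1 : R.eval u = 1 := by
      have := hu
      rw [IsRoot, eval_sub, eval_one, sub_eq_zero] at this
      exact this
    have h2 : ‖R.eval u‖ = 1 := by rw [h1, norm_one]
    rw [norm_eval_eq_prod, hmon.leadingCoeff, norm_one, one_mul, hR,
      roots_multiset_prod_X_sub_C] at h2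
    exact h2
  have hT' : ∀ b ∈ (0 ::ₘ T), ‖b‖ ≤ 1 := by
    intro b hb
    rcases Multiset.mem_cons.1 hb with rfl | hb
    · simp
    · exact hT b hb
  have key : ∀ S : Multiset K, (S.map fun b => ‖u - b‖).prod = 1 → (∀ b ∈ S, ‖u - b‖ ≤ 1) →
      ∀ b ∈ S, ‖u - b‖ = 1 := by
    intro S hS hle b hb
    obtain ⟨S', rfl⟩ := Multiset.exists_cons_of_mem hb
    rw [Multiset.map_cons, Multiset.prod_cons] at hS
    have h3 : (S'.map fun b => ‖u - b‖).prod ≤ 1 := by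
      have := Multiset.prod_map_le_prod_map₀ (s := S') (fun b => ‖u - b‖) (fun _ => (1 : ℝ))
        (fun _ _ => norm_nonneg _) (fun c hc => hle c (Multiset.mem_cons_of_mem hc))
      simpa using this
    have h4 := hle b hb
    have h5 : 0 ≤ ‖u - b‖ := norm_nonneg _
    nlinarith
  have hu1 : ‖u‖ ≤ 1 := by
    by_contra hlt
    push Not at hlt
    have hall : ∀ b ∈ (0 ::ₘ T), ‖u - b‖ = ‖u‖ := by
      intro b hb
      have := ultra_sub_eq (a := -b) (b := 0) (c := -u) (by
        simpa using lt_of_le_of_lt (hT' b hb) hlt)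
      simpa [sub_eq_add_neg, add_comm] using this
    rw [Multiset.map_congr rfl hall] at hprod
    simp only [Multiset.map_const', Multiset.prod_replicate, Multiset.card_cons] at hprod
    exact absurd hprod (one_lt_pow₀ hlt (Nat.succ_ne_zero _)).ne'
  have hfin := key (0 ::ₘ T) hprod (fun b hb => by
    have := ultra_sub_le (a := u) (b := 0) (c := b) (r := 1) (by simpa) (by
      simpa using hT' b hb)
    exact this)
  refine ⟨u, by simpa using hfin 0 (Multiset.mem_cons_self _ _), fun b hb =>
    hfin b (Multiset.mem_cons_of_mem hb)⟩

/-- Maximum principle for rational functions without poles on a closed ball. -/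
theorem exists_norm_eval_div_le (P Q : K[X]) (z₀ c : K) (hc : c ≠ 0)
    (hQ : ∀ z, ‖z - z₀‖ ≤ ‖c‖ → Q.eval z ≠ 0) :
    ∃ z₁ : K, ‖z₁ - z₀‖ = ‖c‖ ∧ ∀ z, ‖z - z₀‖ ≤ ‖c‖ →
      ‖P.eval z / Q.eval z‖ ≤ ‖P.eval z₁ / Q.eval z₁‖ := by
  classical
  have hc' : 0 < ‖c‖ := norm_pos_iff.2 hc
  obtain ⟨u, hu, hub⟩ := exists_unit_avoid
    ((P.roots.filter fun a => ‖a - z₀‖ ≤ ‖c‖).map fun a => (a - z₀) / c) (by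
      intro b hb
      obtain ⟨a, ha, rfl⟩ := Multiset.mem_map.1 hb
      rw [norm_div]
      exact div_le_one_of_le₀ (Multiset.mem_filter.1 ha).2 hc'.le)
  have hz₁ : ‖(z₀ + c * u) - z₀‖ = ‖c‖ := by simp [hu]
  have hfar : ∀ a z : K, ‖c‖ < ‖a - z₀‖ → ‖z - z₀‖ ≤ ‖c‖ → ‖z - a‖ = ‖z₀ - a‖ := by
    intro a z ha hz
    exact ultra_sub_eq (lt_of_le_of_lt hz (by rwa [norm_sub_rev z₀ a]))
  refine ⟨z₀ + c * u, hz₁, fun z hz => ?_⟩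
  rw [norm_div, norm_div]
  have hQeq : ‖Q.eval z‖ = ‖Q.eval (z₀ + c * u)‖ := by
    rw [norm_eval_eq_prod, norm_eval_eq_prod]
    congr 2
    refine Multiset.map_congr rfl fun a ha => ?_
    have hfa : ‖c‖ < ‖a - z₀‖ := by
      by_contra hle
      exact hQ a (not_lt.1 hle) (isRoot_of_mem_roots ha)
    rw [hfar a z hfa hz, hfar a _ hfa hz₁.le]
  rw [hQeq]
  refine div_le_div_of_nonneg_right ?_ (norm_nonneg _)
  rw [norm_eval_eq_prod, norm_eval_eq_prod]
  refine mul_le_mul_of_nonneg_left ?_ (norm_nonneg _)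
  refine Multiset.prod_map_le_prod_map₀ _ _ (fun _ _ => norm_nonneg _) fun a ha => ?_
  by_cases hle : ‖a - z₀‖ ≤ ‖c‖
  · have h1 := hub ((a - z₀) / c) (Multiset.mem_map.2 ⟨a, Multiset.mem_filter.2 ⟨ha, hle⟩, rfl⟩)
    have h2 : z₀ + c * u - a = c * (u - (a - z₀) / c) := by field_simp; ring
    rw [h2, norm_mul, h1, mul_one]
    exact ultra_sub_le hz (by rwa [norm_sub_rev z₀ a])
  · push Not at hle
    rw [hfar a z hle hz, hfar a _ hle hz₁.le]

/-- Schwarz lemma for rational functions without poles on a closed ball. -/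
theorem norm_eval_div_sub_le (P Q : K[X]) (z₀ c : K) (hc : c ≠ 0) (M : ℝ)
    (hQ : ∀ z, ‖z - z₀‖ ≤ ‖c‖ → Q.eval z ≠ 0)
    (hM : ∀ z, ‖z - z₀‖ ≤ ‖c‖ → ‖P.eval z / Q.eval z‖ ≤ M) (z : K) (hz : ‖z - z₀‖ ≤ ‖c‖) :
    ‖P.eval z / Q.eval z - P.eval z₀ / Q.eval z₀‖ ≤ M / ‖c‖ * ‖z - z₀‖ := by
  have hc' : 0 < ‖c‖ := norm_pos_iff.2 hc
  have h₀ : ‖z₀ - z₀‖ ≤ ‖c‖ := by simp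
  have hQ₀ := hQ z₀ h₀
  set N : K[X] := P * C (Q.eval z₀) - C (P.eval z₀) * Q with hN
  have hroot : N.IsRoot z₀ := by simp [hN, IsRoot, mul_comm]
  obtain ⟨N₁, hN₁⟩ := dvd_iff_isRoot.2 hroot
  have hfac : ∀ w, ‖w - z₀‖ ≤ ‖c‖ →
      P.eval w / Q.eval w - P.eval z₀ / Q.eval z₀ =
        (w - z₀) * (N₁.eval w / (Q * C (Q.eval z₀)).eval w) := by
    intro w hw
    have h1 : N.eval w = (w - z₀) * N₁.eval w := by rw [hN₁]; simp
    have h2 : N.eval w = P.eval w * Q.eval z₀ - P.eval z₀ * Q.eval w := by simp [hN]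
    have := hQ w hw
    rw [eval_mul, eval_C, ← mul_div_assoc, ← h1, h2]
    field_simp
  obtain ⟨z₁, hz₁, hmax⟩ := exists_norm_eval_div_le N₁ (Q * C (Q.eval z₀)) z₀ c hc (by
    intro w hw
    simpa using ⟨hQ w hw, hQ₀⟩)
  have hM₁ : ‖P.eval z₁ / Q.eval z₁ - P.eval z₀ / Q.eval z₀‖ ≤ M :=
    by
    rw [sub_eq_add_neg]
    exact (IsUltrametricDist.norm_add_le_max _ _).trans
      (max_le (hM _ hz₁.le) (by rw [norm_neg]; exact hM _ h₀))
  rw [hfac z₁ hz₁.le, norm_mul, hz₁] at hM₁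
  rw [hfac z hz, norm_mul, mul_comm]
  refine mul_le_mul_of_nonneg_right ?_ (norm_nonneg _)
  rw [le_div_iff₀ hc', mul_comm]
  exact (mul_le_mul_of_nonneg_left (hmax z hz) hc'.le).trans hM₁

end Ultrametric

section UpperHalfPlane

variable (p : ℕ) [Fact p.Prime]

/-- The `p`-adic upper half plane `ℙ₁(ℂ_p) ∖ ℙ₁(ℚ_p) = ℂ_p ∖ ℚ_p`. -/
def Hp : Set ℂ_[p] := {z | ∀ a : ℚ_[p], z ≠ algebraMap ℚ_[p] ℂ_[p] a}

/-- The standard exhaustion of the `p`-adic upper half plane by affinoids: the complement in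
`ℙ₁(ℂ_p)` of the open disc `|z| > p ^ n` around `∞` and of the open discs `|z - a| < p ^ (-n)`
around the points `a` of `ℚ_p`. -/
def affinoid (n : ℕ) : Set ℂ_[p] :=
  {z | ‖z‖ ≤ (p : ℝ) ^ n ∧ ∀ a : ℚ_[p], ((p : ℝ) ^ n)⁻¹ ≤ ‖z - algebraMap ℚ_[p] ℂ_[p] a‖}

/-- A function is rigid analytic on the `p`-adic upper half plane if, on each affinoid of the
standard exhaustion, it is a uniform limit of rational functions without poles there. -/
def IsRigid (F : ℂ_[p] → ℂ_[p]) : Prop :=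
  ∀ n : ℕ, ∀ ε : ℝ, 0 < ε → ∃ P Q : ℂ_[p][X], ∀ z ∈ affinoid p n,
    Q.eval z ≠ 0 ∧ ‖F z - P.eval z / Q.eval z‖ ≤ ε

variable {p}

theorem mem_Hp_of_mem_affinoid {n : ℕ} {z : ℂ_[p]} (hz : z ∈ affinoid p n) : z ∈ Hp p := by
  intro a ha
  have h := hz.2 a
  have hp : (0 : ℝ) < p := by exact_mod_cast (Fact.out : p.Prime).pos
  rw [ha, sub_self, norm_zero] at h
  exact absurd h (not_le.2 (by positivity))

theorem norm_p_pow (n : ℕ) : ‖(p : ℂ_[p]) ^ n‖ = ((p : ℝ) ^ n)⁻¹ := by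
  have h : ‖(p : ℂ_[p])‖ = (p : ℝ)⁻¹ := by
    rw [← map_natCast (algebraMap ℚ_[p] ℂ_[p]) p, norm_algebraMap', Padic.norm_p]
  rw [norm_pow, h, inv_pow]

theorem p_pow_ne_zero (n : ℕ) : (p : ℂ_[p]) ^ n ≠ 0 :=
  pow_ne_zero _ (Nat.cast_ne_zero.2 (Fact.out : p.Prime).ne_zero)

theorem ball_subset_affinoid {n : ℕ} {z₀ z : ℂ_[p]} (hz₀ : z₀ ∈ affinoid p n)
    (hz : ‖z - z₀‖ ≤ ‖(p : ℂ_[p]) ^ (n + 1)‖) : z ∈ affinoid p n := by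
  have hp : (1 : ℝ) < p := by exact_mod_cast (Fact.out : p.Prime).one_lt
  have hlt : ‖(p : ℂ_[p]) ^ (n + 1)‖ < ((p : ℝ) ^ n)⁻¹ := by
    rw [norm_p_pow]
    exact inv_strictAnti₀ (by positivity) (pow_lt_pow_right₀ hp (Nat.lt_succ_self n))
  have hle : ((p : ℝ) ^ n)⁻¹ ≤ (p : ℝ) ^ n := by
    have := one_le_pow₀ hp.le (n := n)
    exact (inv_le_one_of_one_le₀ this).trans this
  refine ⟨?_, fun a => ?_⟩
  · have := ultra_sub_le (a := z) (b := z₀) (c := 0) (r := (p : ℝ) ^ n)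
      (hz.trans (hlt.le.trans hle)) (by simpa using hz₀.1)
    simpa using this
  · rw [ultra_sub_eq (a := z) (b := z₀) (lt_of_lt_of_le (lt_of_le_of_lt hz hlt) (hz₀.2 a))]
    exact hz₀.2 a

theorem exists_mem_affinoid {z : ℂ_[p]} (hz : z ∈ Hp p) : ∃ n, z ∈ affinoid p n := by
  have hp : (1 : ℝ) < p := by exact_mod_cast (Fact.out : p.Prime).one_lt
  have hcl : IsClosed (Set.range (algebraMap ℚ_[p] ℂ_[p])) :=
    (algebraMap_isometry ℚ_[p] ℂ_[p]).isClosedEmbedding.isClosed_range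
  have hmem : z ∈ (Set.range (algebraMap ℚ_[p] ℂ_[p]))ᶜ := by
    rintro ⟨a, ha⟩
    exact hz a ha.symm
  obtain ⟨ε, hε, hball⟩ := Metric.isOpen_iff.1 hcl.isOpen_compl z hmem
  obtain ⟨n₁, hn₁⟩ := pow_unbounded_of_one_lt ‖z‖ hp
  obtain ⟨n₂, hn₂⟩ := pow_unbounded_of_one_lt ε⁻¹ hp
  refine ⟨max n₁ n₂, hn₁.le.trans (pow_le_pow_right₀ hp.le (le_max_left _ _)), fun a => ?_⟩
  by_contra hlt
  push Not at hlt
  have h1 : ((p : ℝ) ^ (max n₁ n₂))⁻¹ ≤ ε := by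
    rw [inv_le_comm₀ (by positivity) hε]
    exact hn₂.le.trans (pow_le_pow_right₀ hp.le (le_max_right _ _))
  have h2 : algebraMap ℚ_[p] ℂ_[p] a ∈ Metric.ball z ε := by
    rw [Metric.mem_ball, dist_comm, dist_eq_norm]
    exact lt_of_lt_of_le hlt h1
  exact hball h2 ⟨a, rfl⟩

theorem affinoid_mem_nhds {n : ℕ} {z : ℂ_[p]} (hz : z ∈ affinoid p n) :
    affinoid p n ∈ 𝓝 z := by
  refine Filter.mem_of_superset (Metric.closedBall_mem_nhds z
    (norm_pos_iff.2 (p_pow_ne_zero (p := p) (n + 1)))) fun w hw => ?_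
  rw [Metric.mem_closedBall, dist_eq_norm] at hw
  exact ball_subset_affinoid hz hw

theorem isRigid_const (c : ℂ_[p]) : IsRigid p fun _ => c := fun n ε hε =>
  ⟨C c, 1, fun z _ => by simpa using hε.le⟩

theorem IsRigid.congr {F G : ℂ_[p] → ℂ_[p]} (hF : IsRigid p F) (h : ∀ z ∈ Hp p, F z = G z) :
    IsRigid p G := by
  intro n ε hε
  obtain ⟨P, Q, hPQ⟩ := hF n ε hε
  refine ⟨P, Q, fun z hz => ?_⟩
  rw [← h z (mem_Hp_of_mem_affinoid hz)]
  exact hPQ z hz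

theorem IsRigid.add {F G : ℂ_[p] → ℂ_[p]} (hF : IsRigid p F) (hG : IsRigid p G) :
    IsRigid p (F + G) := by
  intro n ε hε
  obtain ⟨P, Q, hPQ⟩ := hF n ε hε
  obtain ⟨R, S, hRS⟩ := hG n ε hε
  refine ⟨P * S + R * Q, Q * S, fun z hz => ?_⟩
  obtain ⟨hQ, h1⟩ := hPQ z hz
  obtain ⟨hS, h2⟩ := hRS z hz
  refine ⟨by simpa using ⟨hQ, hS⟩, ?_⟩
  have : (F + G) z - (P * S + R * Q).eval z / (Q * S).eval z =
      (F z - P.eval z / Q.eval z) + (G z - R.eval z / S.eval z) := by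
    simp only [Pi.add_apply, eval_add, eval_mul]
    field_simp
    ring
  rw [this]
  exact (IsUltrametricDist.norm_add_le_max _ _).trans (max_le h1 h2)

theorem exists_bound_eval (P : ℂ_[p][X]) (n : ℕ) :
    ∃ M : ℝ, 0 < M ∧ ∀ z ∈ affinoid p n, ‖P.eval z‖ ≤ M := by
  induction P using Polynomial.induction_on' with
  | add P Q hP hQ =>
    obtain ⟨M, hM0, hM⟩ := hP
    obtain ⟨N, hN0, hN⟩ := hQ
    refine ⟨M + N, by positivity, fun z hz => ?_⟩
    rw [eval_add]
    exact (norm_add_le _ _).trans (add_le_add (hM z hz) (hN z hz))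
  | monomial k a =>
    refine ⟨‖a‖ * ((p : ℝ) ^ n) ^ k + 1, by positivity, fun z hz => ?_⟩
    rw [eval_monomial, norm_mul, norm_pow]
    have := mul_le_mul_of_nonneg_left (pow_le_pow_left₀ (norm_nonneg z) hz.1 k) (norm_nonneg a)
    linarith

theorem exists_bound_eval_inv (Q : ℂ_[p][X]) (n : ℕ) (hQ : ∀ z ∈ affinoid p n, Q.eval z ≠ 0) :
    ∃ M : ℝ, 0 < M ∧ ∀ z ∈ affinoid p n, ‖(Q.eval z)⁻¹‖ ≤ M := by
  have hp : (0 : ℝ) < p := by exact_mod_cast (Fact.out : p.Prime).pos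
  by_cases hne : Q = 0
  · exact ⟨1, one_pos, fun z hz => absurd (by simp [hne]) (hQ z hz)⟩
  set r : ℝ := ((p : ℝ) ^ (n + 1))⁻¹ with hr
  have hr0 : 0 < r := by positivity
  have hl : 0 < ‖Q.leadingCoeff‖ := norm_pos_iff.2 (leadingCoeff_ne_zero.2 hne)
  refine ⟨(‖Q.leadingCoeff‖ * r ^ (Multiset.card Q.roots))⁻¹, by positivity, fun z hz => ?_⟩
  rw [norm_inv, norm_eval_eq_prod]
  refine inv_anti₀ (by positivity) (mul_le_mul_of_nonneg_left ?_ hl.le)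
  have h := Multiset.prod_map_le_prod_map₀ (s := Q.roots) (fun _ => r) (fun a => ‖z - a‖)
    (fun _ _ => hr0.le) (fun a ha => by
      by_contra hlt
      push Not at hlt
      refine hQ a (ball_subset_affinoid hz ?_) (isRoot_of_mem_roots ha)
      rw [norm_p_pow, norm_sub_rev]
      exact hlt.le)
  simpa using h

theorem IsRigid.exists_bound {F : ℂ_[p] → ℂ_[p]} (hF : IsRigid p F) (n : ℕ) :
    ∃ M : ℝ, 0 < M ∧ ∀ z ∈ affinoid p n, ‖F z‖ ≤ M := by
  obtain ⟨P, Q, hPQ⟩ := hF n 1 one_pos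
  obtain ⟨M, hM0, hM⟩ := exists_bound_eval P n
  obtain ⟨N, hN0, hN⟩ := exists_bound_eval_inv Q n fun z hz => (hPQ z hz).1
  refine ⟨1 + M * N, by positivity, fun z hz => ?_⟩
  have h1 : F z = (F z - P.eval z / Q.eval z) + P.eval z / Q.eval z := by ring
  rw [h1]
  refine (norm_add_le _ _).trans (add_le_add (hPQ z hz).2 ?_)
  rw [div_eq_mul_inv, norm_mul]
  exact mul_le_mul (hM z hz) (hN z hz) (norm_nonneg _) hM0.le

theorem IsRigid.mul {F G : ℂ_[p] → ℂ_[p]} (hF : IsRigid p F) (hG : IsRigid p G) :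
    IsRigid p (F * G) := by
  intro n ε hε
  obtain ⟨M, hM0, hM⟩ := hF.exists_bound n
  obtain ⟨N, hN0, hN⟩ := hG.exists_bound n
  obtain ⟨P, Q, hPQ⟩ := hF n (min (ε / N) M) (lt_min (by positivity) hM0)
  obtain ⟨R, S, hRS⟩ := hG n (ε / M) (by positivity)
  refine ⟨P * R, Q * S, fun z hz => ?_⟩
  obtain ⟨hQ, h1⟩ := hPQ z hz
  obtain ⟨hS, h2⟩ := hRS z hz
  refine ⟨by simpa using ⟨hQ, hS⟩, ?_⟩
  have h3 : ‖P.eval z / Q.eval z‖ ≤ M := by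
    have h4 : P.eval z / Q.eval z = F z + -(F z - P.eval z / Q.eval z) := by ring
    rw [h4]
    refine (IsUltrametricDist.norm_add_le_max _ _).trans (max_le (hM z hz) ?_)
    rw [norm_neg]
    exact h1.trans (min_le_right _ _)
  have : (F * G) z - (P * R).eval z / (Q * S).eval z =
      (F z - P.eval z / Q.eval z) * G z + P.eval z / Q.eval z * (G z - R.eval z / S.eval z) := by
    simp only [Pi.mul_apply, eval_mul]
    field_simp
    ring
  rw [this]
  refine (IsUltrametricDist.norm_add_le_max _ _).trans (max_le ?_ ?_)
  · rw [norm_mul]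
    refine (mul_le_mul (h1.trans (min_le_left _ _)) (hN z hz) (norm_nonneg _)
      (by positivity)).trans_eq ?_
    field_simp
  · rw [norm_mul]
    refine (mul_le_mul h3 h2 (norm_nonneg _) hM0.le).trans_eq ?_
    field_simp

/-- Rational approximations of a rigid function can be chosen with small Lipschitz defect. -/
theorem IsRigid.exists_lipschitz {F : ℂ_[p] → ℂ_[p]} (hF : IsRigid p F) (n : ℕ) (ε : ℝ)
    (hε : 0 < ε) : ∃ P Q : ℂ_[p][X], ∀ z₀ ∈ affinoid p n, Q.eval z₀ ≠ 0 ∧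
      ∀ z, ‖z - z₀‖ ≤ ‖(p : ℂ_[p]) ^ (n + 1)‖ →
        ‖(F z - P.eval z / Q.eval z) - (F z₀ - P.eval z₀ / Q.eval z₀)‖ ≤ ε * ‖z - z₀‖ := by
  set c : ℂ_[p] := (p : ℂ_[p]) ^ (n + 1) with hc
  have hc0 : c ≠ 0 := p_pow_ne_zero _
  have hc' : 0 < ‖c‖ := norm_pos_iff.2 hc0
  obtain ⟨P, Q, hPQ⟩ := hF n (ε * ‖c‖) (by positivity)
  refine ⟨P, Q, fun z₀ hz₀ => ⟨(hPQ z₀ hz₀).1, fun z hz => ?_⟩⟩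
  rcases eq_or_ne z z₀ with rfl | hne
  · simp
  have hd : 0 < ‖z - z₀‖ := norm_pos_iff.2 (sub_ne_zero.2 hne)
  obtain ⟨R, S, hRS⟩ := hF n (min (ε * ‖c‖) (ε * ‖z - z₀‖)) (lt_min (by positivity) (by positivity))
  have hball : ∀ w, ‖w - z₀‖ ≤ ‖c‖ → w ∈ affinoid p n := fun w hw => ball_subset_affinoid hz₀ hw
  have hrat : ∀ w, ‖w - z₀‖ ≤ ‖c‖ → (R * Q - P * S).eval w / (S * Q).eval w =
      R.eval w / S.eval w - P.eval w / Q.eval w := by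
    intro w hw
    have h1 := (hPQ w (hball w hw)).1
    have h2 := (hRS w (hball w hw)).1
    simp only [eval_sub, eval_mul]
    field_simp
  have hS := norm_eval_div_sub_le (R * Q - P * S) (S * Q) z₀ c hc0 (ε * ‖c‖)
    (fun w hw => by
      simpa using ⟨(hRS w (hball w hw)).1, (hPQ w (hball w hw)).1⟩)
    (fun w hw => by
      rw [hrat w hw]
      have : R.eval w / S.eval w - P.eval w / Q.eval w =
        (F w - P.eval w / Q.eval w) + -(F w - R.eval w / S.eval w) := by ring
      rw [this]
      refine (IsUltrametricDist.norm_add_le_max _ _).trans (max_le (hPQ w (hball w hw)).2 ?_)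
      rw [norm_neg]
      exact (hRS w (hball w hw)).2.trans (min_le_left _ _)) z hz
  have h₀ : ‖z₀ - z₀‖ ≤ ‖c‖ := by simp
  rw [hrat z hz, hrat z₀ h₀, mul_div_assoc, div_self hc'.ne', mul_one] at hS
  have hfin : (F z - P.eval z / Q.eval z) - (F z₀ - P.eval z₀ / Q.eval z₀) =
      ((F z - R.eval z / S.eval z) + -(F z₀ - R.eval z₀ / S.eval z₀)) +
      ((R.eval z / S.eval z - P.eval z / Q.eval z) -
        (R.eval z₀ / S.eval z₀ - P.eval z₀ / Q.eval z₀)) := by ring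
  rw [hfin]
  refine (IsUltrametricDist.norm_add_le_max _ _).trans (max_le ?_ hS)
  refine (IsUltrametricDist.norm_add_le_max _ _).trans (max_le ?_ ?_)
  · exact (hRS z (hball z hz)).2.trans (min_le_right _ _)
  · rw [norm_neg]
    exact (hRS z₀ hz₀).2.trans (min_le_right _ _)

theorem hasDerivAt_eval_div (P Q : ℂ_[p][X]) (z : ℂ_[p]) (hQ : Q.eval z ≠ 0) :
    HasDerivAt (fun w => P.eval w / Q.eval w)
      ((derivative P * Q - P * derivative Q).eval z / (Q ^ 2).eval z) z := by
  simpa using! (P.hasDerivAt z).div (Q.hasDerivAt z) hQ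

theorem IsRigid.differentiableAt {F : ℂ_[p] → ℂ_[p]} (hF : IsRigid p F) {z : ℂ_[p]}
    (hz : z ∈ Hp p) : DifferentiableAt ℂ_[p] F z := by
  obtain ⟨n, hn⟩ := exists_mem_affinoid hz
  have hc' : 0 < ‖(p : ℂ_[p]) ^ (n + 1)‖ := norm_pos_iff.2 (p_pow_ne_zero _)
  have hcau : Cauchy (Filter.map (slope F z) (𝓝[≠] z)) := by
    rw [Metric.cauchy_iff]
    refine ⟨inferInstance, fun ε hε => ?_⟩
    obtain ⟨P, Q, hPQ⟩ := hF.exists_lipschitz n (ε / 3) (by positivity)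
    obtain ⟨hQ, hlip⟩ := hPQ z hn
    have hs := hasDerivAt_iff_tendsto_slope.1 (hasDerivAt_eval_div P Q z hQ)
    set d := (derivative P * Q - P * derivative Q).eval z / (Q ^ 2).eval z
    have hball : ∀ᶠ w in 𝓝[≠] z, ‖w - z‖ ≤ ‖(p : ℂ_[p]) ^ (n + 1)‖ := by
      refine nhdsWithin_le_nhds (Filter.mem_of_superset (Metric.closedBall_mem_nhds z hc') ?_)
      intro w hw
      rwa [Metric.mem_closedBall, dist_eq_norm] at hw
    refine ⟨Metric.ball d (ε / 2), ?_, ?_⟩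
    · rw [Filter.mem_map]
      filter_upwards [hball, self_mem_nhdsWithin, hs (Metric.ball_mem_nhds d (half_pos hε))]
        with w hw hne hsw
      have hne' : w ≠ z := hne
      have hd : 0 < ‖w - z‖ := norm_pos_iff.2 (sub_ne_zero.2 hne')
      have hwz : w - z ≠ 0 := sub_ne_zero.2 hne'
      have hdiff : slope F z w = slope (fun w => P.eval w / Q.eval w) z w +
          ((F w - P.eval w / Q.eval w) - (F z - P.eval z / Q.eval z)) / (w - z) := by
        rw [slope_def_field, slope_def_field, ← add_div]
        congr 1
        ring
      have hsmall : ‖((F w - P.eval w / Q.eval w) - (F z - P.eval z / Q.eval z)) / (w - z)‖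
          ≤ ε / 3 := by
        rw [norm_div, div_le_iff₀ hd]
        exact hlip w hw
      rw [Set.mem_preimage, Metric.mem_ball, dist_eq_norm] at hsw ⊢
      have : slope F z w - d = (slope (fun w => P.eval w / Q.eval w) z w - d) +
          ((F w - P.eval w / Q.eval w) - (F z - P.eval z / Q.eval z)) / (w - z) := by
        rw [hdiff]; ring
      rw [this]
      exact lt_of_le_of_lt (IsUltrametricDist.norm_add_le_max _ _)
        (max_lt hsw (by linarith))
    · intro x hx y hy
      have := dist_triangle_right x y d
      rw [Metric.mem_ball] at hx hy
      linarith
  obtain ⟨d, hd⟩ := CompleteSpace.complete hcau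
  exact (hasDerivAt_iff_tendsto_slope.2 hd).differentiableAt

theorem IsRigid.deriv {F : ℂ_[p] → ℂ_[p]} (hF : IsRigid p F) : IsRigid p (deriv F) := by
  intro n ε hε
  obtain ⟨P, Q, hPQ⟩ := hF.exists_lipschitz n ε hε
  refine ⟨derivative P * Q - P * derivative Q, Q ^ 2, fun z hz => ?_⟩
  obtain ⟨hQ, hlip⟩ := hPQ z hz
  refine ⟨by simpa using hQ, ?_⟩
  have hc' : 0 < ‖(p : ℂ_[p]) ^ (n + 1)‖ := norm_pos_iff.2 (p_pow_ne_zero _)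
  have hd := (hF.differentiableAt (mem_Hp_of_mem_affinoid hz)).hasDerivAt.sub
    (hasDerivAt_eval_div P Q z hQ)
  rw [← hd.deriv]
  refine norm_deriv_le_of_lip' hε.le ?_
  filter_upwards [Metric.closedBall_mem_nhds z hc'] with w hw
  rw [Metric.mem_closedBall, dist_eq_norm] at hw
  exact hlip w hw

/-- Extension by zero of a function on the `p`-adic upper half plane. -/
noncomputable def extendZero (F : Hp p → ℂ_[p]) : ℂ_[p] → ℂ_[p] :=
  Function.extend Subtype.val F 0

theorem extendZero_coe (F : Hp p → ℂ_[p]) (z : Hp p) : extendZero F z = F z :=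
  Subtype.val_injective.extend_apply F 0 z

variable (p)

/-- The `ℂ_p`-algebra `𝒜` of rigid analytic functions on the `p`-adic upper half plane. -/
def RigidFun : Subalgebra ℂ_[p] (Hp p → ℂ_[p]) where
  carrier := {F | IsRigid p (extendZero F)}
  mul_mem' {F G} hF hG := (IsRigid.mul hF hG).congr fun z hz => by
    simp only [Pi.mul_apply]
    rw [extendZero_coe F ⟨z, hz⟩, extendZero_coe G ⟨z, hz⟩, extendZero_coe (F * G) ⟨z, hz⟩]
    rfl
  add_mem' {F G} hF hG := (IsRigid.add hF hG).congr fun z hz => by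
    simp only [Pi.add_apply]
    rw [extendZero_coe F ⟨z, hz⟩, extendZero_coe G ⟨z, hz⟩, extendZero_coe (F + G) ⟨z, hz⟩]
    rfl
  algebraMap_mem' c := (isRigid_const c).congr fun z hz => by
    rw [extendZero_coe _ ⟨z, hz⟩]
    rfl

/-- The space `Ω¹_rig` of rigid analytic differentials on the `p`-adic upper half plane. Since `dz`
is a global generator of the sheaf of differentials, the differential `h(z) dz` is represented by
the rigid analytic function `h`. -/
abbrev RigidDiff : Type := RigidFun p

variable {p}

theorem rigid_differentiableAt (F : RigidFun p) (z : Hp p) :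
    DifferentiableAt ℂ_[p] (extendZero F.1) z :=
  IsRigid.differentiableAt F.2 z.2

/-- The derivative `dF/dz` of a rigid analytic function. -/
noncomputable def rigidDeriv (F : RigidFun p) : RigidFun p :=
  ⟨fun z => deriv (extendZero F.1) z, (IsRigid.deriv F.2).congr fun z hz => by
    rw [extendZero_coe _ ⟨z, hz⟩]⟩

theorem Hp_mem_nhds (z : Hp p) : Hp p ∈ 𝓝 (z : ℂ_[p]) := by
  obtain ⟨n, hn⟩ := exists_mem_affinoid z.2
  exact Filter.mem_of_superset (affinoid_mem_nhds hn) fun _ => mem_Hp_of_mem_affinoid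

theorem rigidDeriv_mul (F G : RigidFun p) :
    rigidDeriv (F * G) = rigidDeriv F * G + F * rigidDeriv G := by
  ext z
  have h1 : extendZero (F * G).1 =ᶠ[𝓝 (z : ℂ_[p])] extendZero F.1 * extendZero G.1 := by
    filter_upwards [Hp_mem_nhds z] with w hw
    rw [Pi.mul_apply, extendZero_coe _ ⟨w, hw⟩, extendZero_coe _ ⟨w, hw⟩,
      extendZero_coe _ ⟨w, hw⟩]
    rfl
  have h2 := deriv_mul (rigid_differentiableAt F z) (rigid_differentiableAt G z)
  rw [← h1.deriv_eq, extendZero_coe, extendZero_coe] at h2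
  exact h2

theorem rigidDeriv_algebraMap (c : ℂ_[p]) : rigidDeriv (algebraMap ℂ_[p] (RigidFun p) c) = 0 := by
  ext z
  have h1 : extendZero (algebraMap ℂ_[p] (RigidFun p) c).1 =ᶠ[𝓝 (z : ℂ_[p])] fun _ => c := by
    filter_upwards [Hp_mem_nhds z] with w hw
    rw [extendZero_coe _ ⟨w, hw⟩]
    rfl
  have h2 := h1.deriv_eq
  rw [deriv_const] at h2
  exact h2

/-- The logarithmic derivative `F ↦ dF / F` on `𝒜ˣ`. -/
noncomputable def dlogUnits : (RigidFun p)ˣ →* Multiplicative (RigidDiff p) where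
  toFun F := Multiplicative.ofAdd (((F⁻¹ : (RigidFun p)ˣ) : RigidFun p) * rigidDeriv (F : RigidFun p))
  map_one' := by
    have h : rigidDeriv ((1 : (RigidFun p)ˣ) : RigidFun p) = 0 := by
      simpa using rigidDeriv_algebraMap (p := p) 1
    rw [h, mul_zero, ofAdd_zero]
  map_mul' F G := by
    rw [← ofAdd_add]
    congr 1
    rw [Units.val_mul, rigidDeriv_mul, mul_inv, Units.val_mul]
    have hF : ((F⁻¹ : (RigidFun p)ˣ) : RigidFun p) * (F : RigidFun p) = 1 := F.inv_mul
    have hG : ((G⁻¹ : (RigidFun p)ˣ) : RigidFun p) * (G : RigidFun p) = 1 := G.inv_mul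
    linear_combination
      ((F⁻¹ : (RigidFun p)ˣ) : RigidFun p) * rigidDeriv (F : RigidFun p) * hG +
      ((G⁻¹ : (RigidFun p)ˣ) : RigidFun p) * rigidDeriv (G : RigidFun p) * hF

variable (p)

/-- The quadratic unramified extension `K_p` of `ℚ_p` inside `ℂ_p`, obtained by adjoining the roots
of unity of order dividing `p ^ 2 - 1`. -/
noncomputable def Kp : IntermediateField ℚ_[p] ℂ_[p] :=
  IntermediateField.adjoin ℚ_[p] {ζ : ℂ_[p] | ζ ^ (p ^ 2 - 1) = 1}

/-- The subgroup `K_pˣ` of `𝒜ˣ` of constant `K_pˣ`-valued functions. -/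
noncomputable def constUnits : Subgroup (RigidFun p)ˣ :=
  (Units.map (((algebraMap ℂ_[p] (RigidFun p)).comp (algebraMap (Kp p) ℂ_[p]) :
    Kp p →+* RigidFun p) : Kp p →* RigidFun p)).range

/-- The group `𝒜ˣ / K_pˣ`. -/
def UnitsModConst : Type := (RigidFun p)ˣ ⧸ constUnits p

noncomputable instance : CommGroup (UnitsModConst p) :=
  inferInstanceAs (CommGroup ((RigidFun p)ˣ ⧸ constUnits p))

variable {p}

theorem constUnits_le_ker : constUnits p ≤ (dlogUnits (p := p)).ker := by
  rintro _ ⟨c, rfl⟩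
  rw [MonoidHom.mem_ker]
  change Multiplicative.ofAdd (_ * rigidDeriv (algebraMap ℂ_[p] (RigidFun p) _)) = 1
  rw [rigidDeriv_algebraMap, mul_zero, ofAdd_zero]

/-- The logarithmic derivative `𝒜ˣ / K_pˣ → Ω¹_rig`. -/
noncomputable def dlog : Additive (UnitsModConst p) →+ RigidDiff p :=
  MonoidHom.toAdditiveLeft (QuotientGroup.lift (constUnits p) dlogUnits constUnits_le_ker)

end UpperHalfPlane

section Measures

variable (p : ℕ) [Fact p.Prime]

/-- The space `ℙ₁(ℚ_p)`, as the one-point compactification of `ℚ_p`. -/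
abbrev P1Qp : Type := OnePoint ℚ_[p]

/-- An `M`-valued measure on `ℙ₁(ℚ_p)`: a finitely additive function on compact open subsets. -/
structure BoundaryMeasure (M : Type*) [AddCommGroup M] where
  /-- The value of the measure on a compact open subset. -/
  toFun : TopologicalSpace.Clopens (P1Qp p) → M
  additive : ∀ U V, Disjoint U V → toFun (U ⊔ V) = toFun U + toFun V

variable {p}

/-- The push-forward of a measure along a homomorphism of the groups of values. -/
def BoundaryMeasure.map {M N : Type*} [AddCommGroup M] [AddCommGroup N] (φ : M →+ N)
    (μ : BoundaryMeasure p M) : BoundaryMeasure p N where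
  toFun U := φ (μ.toFun U)
  additive U V h := by rw [μ.additive U V h, map_add]

/-- `I` is the integral of `g` against the `ℤ`-valued measure `ν`: the limit of the Riemann sums
`∑ ν(U) g(t_U)` over the partitionings of `ℙ₁(ℚ_p)` into compact open subsets `U` with a marked
point `t_U` in each of them, ordered by refinement. -/
def HasIntegral (ν : BoundaryMeasure p ℤ) (g : P1Qp p → ℂ_[p]) (I : ℂ_[p]) : Prop :=
  ∀ ε : ℝ, 0 < ε → ∃ C₀ : Finpartition (⊤ : TopologicalSpace.Clopens (P1Qp p)),
    ∀ C : Finpartition (⊤ : TopologicalSpace.Clopens (P1Qp p)), C ≤ C₀ →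
      ∀ t : TopologicalSpace.Clopens (P1Qp p) → P1Qp p, (∀ U ∈ C.parts, t U ∈ U) →
        ‖∑ U ∈ C.parts, (ν.toFun U : ℂ_[p]) * g (t U) - I‖ < ε

/-- The Poisson kernel `t ↦ 1 / (z - t)`, with value `0` at `t = ∞`. -/
noncomputable def poissonKernel (z : Hp p) : P1Qp p → ℂ_[p] :=
  fun t => t.elim 0 fun a => ((z : ℂ_[p]) - algebraMap ℚ_[p] ℂ_[p] a)⁻¹

/-- The map `id ⊗ φ : Ω¹_rig ⊗ Λ → Ω¹_rig` attached to a homomorphism `φ : Λ → ℤ`. -/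
noncomputable def coordinate {Λ : AddSubgroup ℂ} (φ : Λ →+ ℤ) :
    TensorProduct ℤ (RigidDiff p) Λ →ₗ[ℤ] RigidDiff p :=
  (TensorProduct.rid ℤ (RigidDiff p)).toLinearMap ∘ₗ
    LinearMap.lTensor (RigidDiff p) φ.toIntLinearMap

/-- `ω ∈ Ω¹_rig ⊗ Λ` is the Poisson transform `∫ dz / (z - t) dμ(t)` of the `Λ`-valued measure `μ`.
As `Λ` is a finitely generated free group, `ω` is determined by its images `h_φ(z) dz` under the
homomorphisms `φ : Λ → ℤ`, and these are required to be given by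
`h_φ(z) = ∫ 1 / (z - t) d(φ ∘ μ)(t)` for all `z`. -/
def IsPoissonTransform {Λ : AddSubgroup ℂ} (μ : BoundaryMeasure p Λ)
    (ω : TensorProduct ℤ (RigidDiff p) Λ) : Prop :=
  ∀ (φ : Λ →+ ℤ) (z : Hp p), HasIntegral (μ.map φ) (poissonKernel z) ((coordinate φ ω).1 z)

/-- The logarithmic derivative `(𝒜ˣ / K_pˣ) ⊗ Λ → Ω¹_rig ⊗ Λ`. -/
noncomputable def dlogTensor (Λ : AddSubgroup ℂ) :
    TensorProduct ℤ (Additive (UnitsModConst p)) Λ →ₗ[ℤ] TensorProduct ℤ (RigidDiff p) Λ :=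
  LinearMap.rTensor Λ dlog.toIntLinearMap

end Measures

section ModularSymbols

open scoped MatrixGroups

variable (p : ℕ) [Fact p.Prime]

/-- The ring `ℤ[1/p]`. -/
abbrev ZInv : Type := Algebra.adjoin ℤ {((p : ℚ)⁻¹)}

/-- The Ihara group `Γ = SL₂(ℤ[1/p])`. -/
abbrev Ihara : Type := Matrix.SpecialLinearGroup (Fin 2) (ZInv p)

/-- The inclusion `Γ → GL₂(ℚ)`. -/
noncomputable def iharaRat : Ihara p →* GL (Fin 2) ℚ :=
  Matrix.SpecialLinearGroup.toGL.comp
    (Matrix.SpecialLinearGroup.map (algebraMap (ZInv p) ℚ))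

/-- The inclusion `Γ → GL₂(ℚ_p)`. -/
noncomputable def iharaPadic : Ihara p →* GL (Fin 2) ℚ_[p] :=
  (Matrix.GeneralLinearGroup.map (algebraMap ℚ ℚ_[p])).comp (iharaRat p)

variable {p}

/-- The Möbius action of `Γ` on `ℙ₁(ℚ)`. -/
noncomputable def moebiusRat (γ : Ihara p) (r : OnePoint ℚ) : OnePoint ℚ := iharaRat p γ • r

open Classical in
/-- The Möbius action of `Γ` on `ℙ₁(ℚ_p)`. -/
noncomputable def moebiusPadic (γ : Ihara p) (x : P1Qp p) : P1Qp p := iharaPadic p γ • x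

variable (p)

/-- The space `S₂(Γ₀(p))` of cusp forms. -/
abbrev S2Gamma0 : Type :=
  CuspForm ((CongruenceSubgroup.Gamma0 p).map (Matrix.SpecialLinearGroup.mapGL ℝ)) 2

/-- The ball `U_∞ = ℙ₁(ℚ_p) ∖ ℤ_p` attached to the distinguished oriented edge of the tree. -/
def ballInfty : Set (P1Qp p) := {x | ∀ a : ℤ_[p], x ≠ ((a : ℚ_[p]) : OnePoint ℚ_[p])}

variable {p}

/-- The integral `∫_r^{i∞} f(z) dz` along the vertical half-line from the cusp `r`. -/
noncomputable def cuspIntegral (f : S2Gamma0 p) (r : OnePoint ℚ) : ℂ :=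
  r.elim 0 fun x => ∫ y in Set.Ioi (0 : ℝ),
    f (UpperHalfPlane.ofComplex ((x : ℂ) + (y : ℂ) * Complex.I)) * Complex.I

/-- The period `2πi ∫_r^s f(z) dz`, for `r, s ∈ ℙ₁(ℚ)` (the path from `r` to `s` is taken to pass
through `i∞`). -/
noncomputable def period (f : S2Gamma0 p) (r s : OnePoint ℚ) : ℂ :=
  2 * Real.pi * Complex.I * (cuspIntegral f r - cuspIntegral f s)

/-- `μ` is the measure `μ_f[r, s]`, i.e. the measure with `μ(U_e) = c_f[r, s](e)` for all oriented
edges `e` of the Bruhat-Tits tree. The compact open balls of `ℙ₁(ℚ_p)` are the sets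
`γ⁻¹ U_∞ = U_{γ⁻¹ e_∞}` for `γ ∈ Γ`, on which the value of `μ` is
`c_f[r, s](γ⁻¹ e_∞) = 2πi ∫_{γ r}^{γ s} f(z) dz`, and their complements. -/
structure IsModularSymbolMeasure (f : S2Gamma0 p) {Λ : AddSubgroup ℂ} (r s : OnePoint ℚ)
    (μ : BoundaryMeasure p Λ) : Prop where
  total : μ.toFun ⊤ = 0
  ball : ∀ (γ : Ihara p) (U : TopologicalSpace.Clopens (P1Qp p)),
    (∀ x, x ∈ U ↔ moebiusPadic γ x ∈ ballInfty p) →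
      (μ.toFun U : ℂ) = period f (moebiusRat γ r) (moebiusRat γ s)

end ModularSymbols

end MockHilbert

namespace MockHilbert

open Polynomial Filter Topology TopologicalSpace

/-! ### Compact open subsets of `ℙ₁(ℚ_p)` and their levels. -/

section BoundaryTopology

variable {p : ℕ} [hp : Fact p.Prime]

/-! There is an archimedean half, which produces the measure, and a `p`-adic half, which integrates
it.

Archimedean half. Let `P(r, s)` be the period of `f` from `r` to `s`. If `G` is a primitive of `f`
on the upper half plane, then `G` has a limit at every cusp because each slash `f|α` decays
exponentially, and `P` is `2πi` times a difference of such limits. For `γ ∈ Γ₀(p)` the function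
`G(γτ) - G(τ)` is constant, and the constant cancels in the difference; so `P` is a
`Γ₀(p)`-invariant modular symbol (`period_smul`). Since `Γ₀(p)` also stabilises `U_∞`, the value
prescribed on `γ⁻¹U_∞` depends on this set only. For `a ∈ ℤ[1/p]`, the ball `a + p^k ℤ_p` is a
translate `γ⁻¹U_∞` when `k` is odd, and its complement is one when `k` is even. This dictates the
value on every ball (`ballPeriod`).

Additivity under cutting a ball into `p` smaller ones says that the sum of a modular symbol over the
`p + 1` cosets of `Γ₀(p)` in `SL₂(ℤ)` vanishes, for the symbol `P` when `k` is even and for `P ∘ W`,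
with `W` the Atkin-Lehner matrix, when `k` is odd. It holds because that sum is a modular symbol for
the whole of `SL₂(ℤ)`, and there are none but zero (`modularSymbol_trace_eq_zero`). A function on
balls with these properties extends to a measure of total mass zero (`IsDistribution.measure`).
Uniqueness holds because every compact open set avoiding `∞` is a disjoint union of balls of one odd
level.

`p`-adic half. `Λ` is finitely generated and torsion-free, hence free, and a basis reduces
everything to a `ℤ`-valued measure `ν`. The products `∏ ((z - t_U) / (z₀ - t_U)) ^ ν(U)` over finer
and finer partitions converge uniformly on affinoids: raising to an integral power does not move an
element of a small ball around `1` out of it. The limit is an invertible rigid function whose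
logarithmic derivative is the limit of the Riemann sums of `1 / (z - t)`
(`exists_unit_hasIntegral`). This gives the Poisson transform and its primitive at once. -/

theorem one_lt_prime_cast (p : ℕ) [hp : Fact p.Prime] : (1 : ℝ) < p := by
  exact_mod_cast hp.out.one_lt

theorem prime_cast_pos (p : ℕ) [hp : Fact p.Prime] : (0 : ℝ) < p := by
  exact_mod_cast hp.out.pos

theorem padic_prime_ne_zero (p : ℕ) [hp : Fact p.Prime] : (p : ℚ_[p]) ≠ 0 :=
  Nat.cast_ne_zero.2 hp.out.ne_zero

/-- The points of `ℙ₁(ℚ_p)` at distance less than `p ^ (-m)` from `∞`. -/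
def IsFar (m : ℕ) (t : P1Qp p) : Prop := ∀ a : ℚ_[p], t = a → (p : ℝ) ^ m < ‖a‖

/-- A uniform structure on `ℙ₁(ℚ_p)`, at level `m`. -/
def IsNear (m : ℕ) (s t : P1Qp p) : Prop :=
  (IsFar m s ∧ IsFar m t) ∨ ∃ a b : ℚ_[p], s = a ∧ t = b ∧ ‖a - b‖ ≤ ((p : ℝ) ^ m)⁻¹

theorem isFar_infty (m : ℕ) : IsFar m (OnePoint.infty : P1Qp p) := fun a h =>
  absurd h (OnePoint.infty_ne_coe a)

theorem isFar_coe {m : ℕ} {a : ℚ_[p]} : IsFar m (a : P1Qp p) ↔ (p : ℝ) ^ m < ‖a‖ :=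
  ⟨fun h => h a rfl, fun h b hb => by rwa [← OnePoint.coe_injective hb]⟩

theorem IsFar.mono {m n : ℕ} (h : m ≤ n) {t : P1Qp p} (ht : IsFar n t) : IsFar m t := fun a ha =>
  (pow_le_pow_right₀ (one_lt_prime_cast p).le h).trans_lt (ht a ha)

theorem isNear_coe {m : ℕ} {a b : ℚ_[p]} (h : ‖a - b‖ ≤ ((p : ℝ) ^ m)⁻¹) :
    IsNear m (a : P1Qp p) b := Or.inr ⟨a, b, rfl, rfl, h⟩

theorem IsNear.mono {m n : ℕ} (h : m ≤ n) {s t : P1Qp p} (hst : IsNear n s t) : IsNear m s t := by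
  rcases hst with ⟨h1, h2⟩ | ⟨a, b, rfl, rfl, hab⟩
  · exact Or.inl ⟨h1.mono h, h2.mono h⟩
  · refine isNear_coe (hab.trans ?_)
    exact inv_anti₀ (pow_pos (prime_cast_pos p) _) (pow_le_pow_right₀ (one_lt_prime_cast p).le h)

theorem IsNear.symm {m : ℕ} {s t : P1Qp p} (h : IsNear m s t) : IsNear m t s := by
  rcases h with ⟨h1, h2⟩ | ⟨a, b, rfl, rfl, hab⟩
  · exact Or.inl ⟨h2, h1⟩
  · exact isNear_coe (by rwa [norm_sub_rev])

/-- Membership in `U` is invariant under the level `m` uniform structure. -/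
def IsLevel (m : ℕ) (U : Clopens (P1Qp p)) : Prop :=
  ∀ s t : P1Qp p, IsNear m s t → s ∈ U → t ∈ U

theorem IsLevel.mono {m n : ℕ} (h : m ≤ n) {U : Clopens (P1Qp p)} (hU : IsLevel m U) :
    IsLevel n U := fun s t hst => hU s t (hst.mono h)

theorem IsLevel.compl {m : ℕ} {U : Clopens (P1Qp p)} (hU : IsLevel m U) : IsLevel m Uᶜ :=
  fun s t hst hs ht => hs (hU t s hst.symm ht)

theorem IsLevel.sup {m : ℕ} {U V : Clopens (P1Qp p)} (hU : IsLevel m U) (hV : IsLevel m V) :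
    IsLevel m (U ⊔ V) := fun s t hst hs =>
  hs.elim (fun h => Or.inl (hU s t hst h)) (fun h => Or.inr (hV s t hst h))

/-- Such a `U` is a compact open subset of `ℚ_p`: it is bounded, and by compactness it contains a
thickening of itself of some radius `δ > 0`. The level only has to exceed both scales. -/
theorem exists_isLevel_of_infty_notMem {U : Clopens (P1Qp p)}
    (hU : (OnePoint.infty : P1Qp p) ∉ U) : ∃ m, IsLevel m U := by
  set K : Set ℚ_[p] := (fun a : ℚ_[p] => (a : P1Qp p)) ⁻¹' (U : Set (P1Qp p)) with hK
  have himg : (fun a : ℚ_[p] => (a : P1Qp p)) '' K = (U : Set (P1Qp p)) := by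
    refine Set.image_preimage_eq_of_subset fun x hx => ?_
    induction x using OnePoint.rec with
    | infty => exact absurd hx hU
    | coe a => exact ⟨a, rfl⟩
  have hopen : IsOpen K := U.isClopen.isOpen.preimage OnePoint.continuous_coe
  have hcomp : IsCompact K :=
    OnePoint.isOpenEmbedding_coe.isEmbedding.isCompact_iff.2
      (by rw [himg]; exact U.isClopen.isClosed.isCompact)
  obtain ⟨δ, hδ, hsub⟩ := hcomp.exists_cthickening_subset_open hopen subset_rfl
  obtain ⟨R, hR⟩ := hcomp.isBounded.exists_norm_le
  obtain ⟨n₁, hn₁⟩ := pow_unbounded_of_one_lt R (one_lt_prime_cast p)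
  obtain ⟨n₂, hn₂⟩ := pow_unbounded_of_one_lt δ⁻¹ (one_lt_prime_cast p)
  refine ⟨max n₁ n₂, fun s t hst hs => ?_⟩
  rcases hst with ⟨h1, -⟩ | ⟨a, b, rfl, rfl, hab⟩
  · induction s using OnePoint.rec with
    | infty => exact absurd hs hU
    | coe a =>
      have h2 := (isFar_coe.1 (h1.mono (le_max_left n₁ n₂)))
      exact absurd (hR a hs) (not_le.2 (hn₁.trans h2))
  · refine hsub (Metric.mem_cthickening_of_dist_le b a δ K hs ?_)
    rw [dist_comm, dist_eq_norm]
    refine hab.trans ?_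
    rw [inv_le_comm₀ (pow_pos (prime_cast_pos p) _) hδ]
    exact hn₂.le.trans (pow_le_pow_right₀ (one_lt_prime_cast p).le (le_max_right _ _))

theorem exists_isLevel (U : Clopens (P1Qp p)) : ∃ m, IsLevel m U := by
  by_cases hU : (OnePoint.infty : P1Qp p) ∈ U
  · obtain ⟨m, hm⟩ := exists_isLevel_of_infty_notMem (U := Uᶜ) fun h => h hU
    exact ⟨m, compl_compl U ▸ hm.compl⟩
  · exact exists_isLevel_of_infty_notMem hU

/-- The ball `a + p ^ k ℤ_p`. -/
noncomputable def padicBall (a : ℚ_[p]) (k : ℤ) : Clopens (P1Qp p) where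
  carrier := (fun x : ℚ_[p] => (x : P1Qp p)) '' Metric.closedBall a ((p : ℝ) ^ (-k))
  isClopen' := by
    have hpos : (0 : ℝ) < (p : ℝ) ^ (-k) := zpow_pos (prime_cast_pos p) _
    refine ⟨?_, ?_⟩
    · exact ((isCompact_closedBall a _).image OnePoint.continuous_coe).isClosed
    · exact OnePoint.isOpenEmbedding_coe.isOpenMap _
        (IsUltrametricDist.isOpen_closedBall a hpos.ne')

theorem coe_mem_padicBall {a x : ℚ_[p]} {k : ℤ} :
    (x : P1Qp p) ∈ padicBall a k ↔ ‖x - a‖ ≤ (p : ℝ) ^ (-k) := by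
  change (x : P1Qp p) ∈ (fun x : ℚ_[p] => (x : P1Qp p)) '' _ ↔ _
  rw [OnePoint.coe_injective.mem_set_image, Metric.mem_closedBall, dist_eq_norm]

theorem infty_notMem_padicBall {a : ℚ_[p]} {k : ℤ} :
    (OnePoint.infty : P1Qp p) ∉ padicBall a k := by
  rintro ⟨x, -, hx⟩
  exact OnePoint.coe_ne_infty x hx

theorem ultra_sub_le_padic {r : ℝ} {a b c : ℚ_[p]} (h : ‖a - b‖ ≤ r) (h' : ‖b - c‖ ≤ r) :
    ‖a - c‖ ≤ r := by
  have : a - c = (a - b) + (b - c) := by ring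
  rw [this]
  exact (IsUltrametricDist.norm_add_le_max _ _).trans (max_le h h')

theorem exists_nat_norm_sub_le {y : ℚ_[p]} (hy : ‖y‖ ≤ 1) (n : ℕ) :
    ∃ i < p ^ n, ‖y - (i : ℚ_[p])‖ ≤ ((p : ℝ) ^ n)⁻¹ := by
  refine ⟨PadicInt.appr ⟨y, hy⟩ n, PadicInt.appr_lt _ _, ?_⟩
  have h := PadicInt.appr_spec n ⟨y, hy⟩
  rw [← PadicInt.norm_le_pow_iff_mem_span_pow, PadicInt.norm_def, zpow_neg, zpow_natCast] at h
  exact_mod_cast h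

theorem norm_intCast_le_inv_pow_iff (z : ℤ) (n : ℕ) :
    ‖(z : ℚ_[p])‖ ≤ ((p : ℝ) ^ n)⁻¹ ↔ ((p ^ n : ℕ) : ℤ) ∣ z := by
  have := Padic.norm_int_le_pow_iff_dvd (p := p) z n
  rw [zpow_neg, zpow_natCast] at this
  exact_mod_cast this

theorem eq_of_norm_natCast_sub_le {i j n : ℕ} (hi : i < p ^ n) (hj : j < p ^ n)
    (h : ‖(i : ℚ_[p]) - j‖ ≤ ((p : ℝ) ^ n)⁻¹) : i = j := by
  have h1 := (norm_intCast_le_inv_pow_iff (p := p) ((i : ℤ) - j) n).1 (by simpa using h)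
  have h2 : (i : ℤ) ≡ j [ZMOD ((p ^ n : ℕ) : ℤ)] := ((Int.modEq_iff_dvd).2 (by
    rw [← neg_sub]; exact (dvd_neg.2 h1)))
  have h3 := (Int.natCast_modEq_iff).1 h2
  exact Nat.ModEq.eq_of_lt_of_lt h3 hi hj

theorem norm_div_prime_pow (x : ℚ_[p]) (n : ℕ) :
    ‖x / (p : ℚ_[p]) ^ n‖ = ‖x‖ * (p : ℝ) ^ n := by
  rw [norm_div, norm_pow, Padic.norm_p, inv_pow, div_inv_eq_mul]

theorem norm_mul_prime_pow (x : ℚ_[p]) (n : ℕ) :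
    ‖x * (p : ℚ_[p]) ^ n‖ = ‖x‖ * ((p : ℝ) ^ n)⁻¹ := by
  rw [norm_mul, norm_pow, Padic.norm_p, inv_pow]

/-- The `i`-th center of the balls of radius `p ^ (-n)` which cover `p ^ (-n) ℤ_p`. -/
noncomputable def center (p : ℕ) [Fact p.Prime] (n i : ℕ) : ℚ_[p] := (i : ℚ_[p]) / (p : ℚ_[p]) ^ n

/-- Scaling by `p ^ n` brings `x` into `ℤ_p`, where it is approximated modulo `p ^ (2n)`. The
centers thus represent `p⁻ⁿℤ_p / pⁿℤ_p`, which is why there are `p ^ (2n)` of them. -/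
theorem exists_center {x : ℚ_[p]} {n : ℕ} (hx : ‖x‖ ≤ (p : ℝ) ^ n) :
    ∃ i < p ^ (2 * n), ‖x - center p n i‖ ≤ ((p : ℝ) ^ n)⁻¹ := by
  have hpos : (0 : ℝ) < (p : ℝ) ^ n := pow_pos (prime_cast_pos p) n
  obtain ⟨i, hi, h⟩ := exists_nat_norm_sub_le (y := x * (p : ℚ_[p]) ^ n) (by
    rw [norm_mul_prime_pow, mul_inv_le_iff₀ hpos, one_mul]; exact hx) (2 * n)
  refine ⟨i, hi, ?_⟩
  have h0 : (p : ℚ_[p]) ^ n ≠ 0 := pow_ne_zero _ (padic_prime_ne_zero p)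
  have : x - center p n i = (x * (p : ℚ_[p]) ^ n - i) / (p : ℚ_[p]) ^ n := by
    rw [center]; field_simp
  rw [this, norm_div_prime_pow]
  refine (mul_le_mul_of_nonneg_right h hpos.le).trans_eq ?_
  rw [two_mul, pow_add]
  field_simp

theorem eq_of_norm_center_sub_le {n i j : ℕ} (hi : i < p ^ (2 * n)) (hj : j < p ^ (2 * n))
    (h : ‖center p n i - center p n j‖ ≤ ((p : ℝ) ^ n)⁻¹) : i = j := by
  have hpos : (0 : ℝ) < (p : ℝ) ^ n := pow_pos (prime_cast_pos p) n
  refine eq_of_norm_natCast_sub_le hi hj ?_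
  rw [center, center, ← sub_div, norm_div_prime_pow, ← le_div_iff₀ hpos] at h
  refine h.trans_eq ?_
  rw [two_mul, pow_add]
  field_simp

theorem disjoint_padicBall_center {n i j : ℕ} (hi : i < p ^ (2 * n)) (hj : j < p ^ (2 * n))
    (hij : i ≠ j) : Disjoint (padicBall (center p n i) n) (padicBall (center p n j) n) := by
  rw [disjoint_iff_inf_le]
  intro t ht
  obtain ⟨h1, h2⟩ : t ∈ padicBall (center p n i) n ∧ t ∈ padicBall (center p n j) n := ht
  induction t using OnePoint.rec with
  | infty => exact absurd h1 infty_notMem_padicBall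
  | coe x =>
    rw [coe_mem_padicBall, zpow_neg, zpow_natCast] at h1 h2
    exact absurd (eq_of_norm_center_sub_le hi hj
      (ultra_sub_le_padic (by rwa [norm_sub_rev]) h2)) hij

-- A set of level `n` that misses `∞` misses all far points, so it lies in `p⁻ⁿℤ_p`, and it contains
-- each of the listed balls that it meets.
open Classical in
theorem IsLevel.eq_sup_padicBall {n : ℕ} {U : Clopens (P1Qp p)} (hU : IsLevel n U)
    (hinf : (OnePoint.infty : P1Qp p) ∉ U) :
    U = ((Finset.range (p ^ (2 * n))).filter fun i => (center p n i : P1Qp p) ∈ U).sup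
      fun i => padicBall (center p n i) n := by
  refine le_antisymm (fun t ht => ?_) (Finset.sup_le fun i hi => ?_)
  · have hfar : ¬ IsFar n t := fun h => hinf (hU t _ (Or.inl ⟨h, isFar_infty n⟩) ht)
    induction t using OnePoint.rec with
    | infty => exact absurd ht hinf
    | coe x =>
      rw [isFar_coe, not_lt] at hfar
      obtain ⟨i, hi, h⟩ := exists_center hfar
      have hmem : (center p n i : P1Qp p) ∈ U := hU x _ (isNear_coe h) ht
      have hle := Finset.le_sup (f := fun i => padicBall (center p n i) n)
        (s := (Finset.range (p ^ (2 * n))).filter fun i => (center p n i : P1Qp p) ∈ U)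
        (Finset.mem_filter.2 ⟨Finset.mem_range.2 hi, hmem⟩)
      refine hle ?_
      change (x : P1Qp p) ∈ padicBall (center p n i) n
      rw [coe_mem_padicBall, zpow_neg, zpow_natCast]
      exact h
  · intro t ht
    have ht' : t ∈ padicBall (center p n i) n := ht
    induction t using OnePoint.rec with
    | infty => exact absurd ht' infty_notMem_padicBall
    | coe x =>
      rw [coe_mem_padicBall, zpow_neg, zpow_natCast] at ht'
      exact hU _ _ (isNear_coe (by rwa [norm_sub_rev])) (Finset.mem_filter.1 hi).2

end BoundaryTopology

/-! ### Finitely additive measures are determined by balls. -/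

section BoundaryMeasures

variable {p : ℕ} [hp : Fact p.Prime] {M : Type*} [AddCommGroup M]

theorem BoundaryMeasure.ext {μ ν : BoundaryMeasure p M} (h : ∀ U, μ.toFun U = ν.toFun U) :
    μ = ν := by
  cases μ
  cases ν
  congr
  exact funext h

theorem BoundaryMeasure.toFun_bot (μ : BoundaryMeasure p M) : μ.toFun ⊥ = 0 := by
  have h := μ.additive ⊥ ⊥ disjoint_bot_left
  rw [sup_bot_eq] at h
  exact left_eq_add.1 h

theorem BoundaryMeasure.toFun_finset_sup (μ : BoundaryMeasure p M) {ι : Type*} (s : Finset ι)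
    (V : ι → Clopens (P1Qp p)) (h : (s : Set ι).PairwiseDisjoint V) :
    μ.toFun (s.sup V) = ∑ i ∈ s, μ.toFun (V i) := by
  classical
  induction s using Finset.induction_on with
  | empty => simp [μ.toFun_bot]
  | insert i s hi ih =>
    rw [Finset.sup_insert, Finset.sum_insert hi, μ.additive, ih]
    · exact h.subset (by simp)
    · rw [Finset.disjoint_sup_right]
      intro j hj
      exact h (by simp) (by simp [hj]) (by rintro rfl; exact hi hj)

theorem BoundaryMeasure.toFun_compl (μ : BoundaryMeasure p M) (h : μ.toFun ⊤ = 0)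
    (U : Clopens (P1Qp p)) : μ.toFun Uᶜ = -μ.toFun U := by
  have := μ.additive U Uᶜ disjoint_compl_right
  rw [sup_compl_eq_top, h] at this
  exact (neg_eq_of_add_eq_zero_right this.symm).symm

open Classical in
theorem BoundaryMeasure.toFun_eq_sum (μ : BoundaryMeasure p M) {n : ℕ} {U : Clopens (P1Qp p)}
    (hU : IsLevel n U) (hinf : (OnePoint.infty : P1Qp p) ∉ U) :
    μ.toFun U = ∑ i ∈ Finset.range (p ^ (2 * n)),
      if (center p n i : P1Qp p) ∈ U then μ.toFun (padicBall (center p n i) n) else 0 := by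
  rw [← Finset.sum_filter]
  conv_lhs => rw [hU.eq_sup_padicBall hinf]
  refine μ.toFun_finset_sup _ _ fun i hi j hj hij => ?_
  rw [Finset.mem_coe, Finset.mem_filter, Finset.mem_range] at hi hj
  exact disjoint_padicBall_center hi.1 hj.1 hij

/-- Two measures of total mass zero which agree on the balls of odd level coincide. -/
theorem BoundaryMeasure.eq_of_odd {μ ν : BoundaryMeasure p M} (hμ : μ.toFun ⊤ = 0)
    (hν : ν.toFun ⊤ = 0) (h : ∀ n i : ℕ, Odd n →
      μ.toFun (padicBall (center p n i) n) = ν.toFun (padicBall (center p n i) n)) : μ = ν := by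
  classical
  have key : ∀ U : Clopens (P1Qp p), (OnePoint.infty : P1Qp p) ∉ U → μ.toFun U = ν.toFun U := by
    intro U hU
    obtain ⟨m, hm⟩ := exists_isLevel U
    -- A level may always be raised to an odd one. Only balls of odd level are translates of `U_∞`,
    -- where the modular symbol prescribes the value directly.
    have hm' : IsLevel (2 * m + 1) U := hm.mono (by omega)
    rw [μ.toFun_eq_sum hm' hU, ν.toFun_eq_sum hm' hU]
    refine Finset.sum_congr rfl fun i _ => ?_
    rw [h _ i (odd_two_mul_add_one m)]
  refine BoundaryMeasure.ext fun U => ?_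
  by_cases hU : (OnePoint.infty : P1Qp p) ∈ U
  · have h1 := key Uᶜ fun h => h hU
    rw [μ.toFun_compl hμ, ν.toFun_compl hν] at h1
    exact neg_injective h1
  · exact key U hU

end BoundaryMeasures

end MockHilbert


namespace MockHilbert

open Polynomial Filter Topology TopologicalSpace

/-! ### Extending a distribution on balls to a measure of total mass zero. -/

section Distribution

set_option linter.unusedSectionVars false

variable {p : ℕ} [hp : Fact p.Prime] {M : Type*} [AddCommGroup M]

theorem sum_range_mul_eq {A : Type*} [AddCommMonoid A] (f : ℕ → A) (m n : ℕ) :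
    ∑ i ∈ Finset.range (m * n), f i =
      ∑ i ∈ Finset.range m, ∑ j ∈ Finset.range n, f (j + n * i) := by
  induction m with
  | zero => simp
  | succ m ih =>
    rw [Nat.succ_mul, Finset.sum_range_add, ih, Finset.sum_range_succ]
    congr 1
    refine Finset.sum_congr rfl fun j _ => ?_
    rw [add_comm, mul_comm]

/-- A distribution on the balls of `ℚ_p` with center in `ℚ`: `φ a k` is the value on
`a + p ^ k ℤ_p`. -/
structure IsDistribution (p : ℕ) (φ : ℚ → ℤ → M) : Prop where
  periodic : ∀ a k, φ (a + (p : ℚ) ^ k) k = φ a k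
  additive : ∀ a k, φ a k = ∑ i ∈ Finset.range p, φ (a + i * (p : ℚ) ^ k) (k + 1)

theorem IsDistribution.add_int_mul {φ : ℚ → ℤ → M} (hφ : IsDistribution p φ) (a : ℚ) (k : ℤ)
    (z : ℤ) : φ (a + z * (p : ℚ) ^ k) k = φ a k := by
  induction z using Int.induction_on with
  | zero => simp
  | succ i ih =>
    rw [← ih, ← hφ.periodic (a + (i : ℤ) * (p : ℚ) ^ k)]
    congr 1
    push_cast
    ring
  | pred i ih =>
    rw [← ih, ← hφ.periodic (a + ((-(i : ℤ) - 1 : ℤ) : ℚ) * (p : ℚ) ^ k)]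
    congr 1
    push_cast
    ring

open Classical in
/-- The sum of the values of `φ` on the balls of radius `p ^ (-n)` with center in `U`. -/
noncomputable def levelSum (φ : ℚ → ℤ → M) (U : Clopens (P1Qp p)) (n : ℕ) : M :=
  ∑ i ∈ Finset.range (p ^ (2 * n)),
    if (center p n i : P1Qp p) ∈ U then φ ((i : ℚ) / (p : ℚ) ^ n) n else 0

theorem isFar_center_succ {n j : ℕ} (hj : ¬ p ∣ j) : IsFar n (center p (n + 1) j : P1Qp p) := by
  rw [isFar_coe, center, norm_div_prime_pow]
  have h1 : ‖(j : ℚ_[p])‖ = 1 := by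
    rw [Padic.norm_natCast_eq_one_iff]
    exact (hp.out.coprime_iff_not_dvd.2 hj)
  rw [h1, one_mul]
  exact pow_lt_pow_right₀ (one_lt_prime_cast p) (Nat.lt_succ_self n)

/-- A center of level `n + 1` with index prime to `p` has norm `p ^ (n + 1)`, so it is near `∞` and
outside `U`. The remaining indices `p * i` give centers of `p⁻ⁿℤ_p` modulo `p ^ (n + 1)`, and these
group into the subballs of the balls of level `n`. -/
theorem IsDistribution.levelSum_succ {φ : ℚ → ℤ → M} (hφ : IsDistribution p φ)
    {U : Clopens (P1Qp p)} (hinf : (OnePoint.infty : P1Qp p) ∉ U) {n : ℕ} (hU : IsLevel n U) :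
    levelSum φ U (n + 1) = levelSum φ U n := by
  classical
  have hp0 : (p : ℚ) ≠ 0 := Nat.cast_ne_zero.2 hp.out.ne_zero
  have hp1 := padic_prime_ne_zero p
  have e1 : p ^ (2 * (n + 1)) = p ^ (2 * n + 1) * p := by ring
  have e2 : p ^ (2 * n + 1) = p * p ^ (2 * n) := by ring
  rw [levelSum, e1, sum_range_mul_eq]
  have h1 : ∀ i ∈ Finset.range (p ^ (2 * n + 1)), (∑ j ∈ Finset.range p,
      if (center p (n + 1) (j + p * i) : P1Qp p) ∈ U then
        φ (((j + p * i : ℕ) : ℚ) / (p : ℚ) ^ (n + 1)) ((n + 1 : ℕ) : ℤ) else 0) =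
      if (center p n i : P1Qp p) ∈ U then φ ((i : ℚ) / (p : ℚ) ^ n) ((n + 1 : ℕ) : ℤ) else 0 := by
    intro i _
    rw [Finset.sum_eq_single 0]
    · have h2 : center p (n + 1) (0 + p * i) = center p n i := by
        rw [center, center, pow_succ]
        push_cast
        field_simp
        ring
      have h3 : ((0 + p * i : ℕ) : ℚ) / (p : ℚ) ^ (n + 1) = (i : ℚ) / (p : ℚ) ^ n := by
        rw [pow_succ]
        push_cast
        field_simp
        ring
      rw [h2, h3]
    · intro j hj hj0
      rw [if_neg]
      intro hmem
      refine hinf (hU _ _ (Or.inl ⟨isFar_center_succ ?_, isFar_infty n⟩) hmem)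
      rw [Nat.dvd_add_left (dvd_mul_right p i)]
      exact fun hdvd => hj0 (Nat.eq_zero_of_dvd_of_lt hdvd (Finset.mem_range.1 hj))
    · intro h0
      exact absurd (Finset.mem_range.2 hp.out.pos) h0
  -- The index is now written as `i + p ^ (2n) * j`. Its center is the `i`-th center plus `j * p ^
  -- n`, so membership in `U` depends on `i` alone and the sum over `j` is the one in `additive`.
  rw [Finset.sum_congr rfl h1, e2, sum_range_mul_eq, Finset.sum_comm, levelSum]
  refine Finset.sum_congr rfl fun i _ => ?_
  have h4 : ∀ j : ℕ, (center p n (i + p ^ (2 * n) * j) : P1Qp p) ∈ U ↔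
      (center p n i : P1Qp p) ∈ U := by
    intro j
    have h5 : ‖center p n (i + p ^ (2 * n) * j) - center p n i‖ ≤ ((p : ℝ) ^ n)⁻¹ := by
      have h6 : center p n (i + p ^ (2 * n) * j) - center p n i =
          (j : ℚ_[p]) * (p : ℚ_[p]) ^ n := by
        rw [center, center, two_mul, pow_add]
        push_cast
        field_simp
        ring
      rw [h6, norm_mul_prime_pow]
      have h7 : ‖(j : ℚ_[p])‖ ≤ 1 := by simpa using Padic.norm_int_le_one (p := p) j
      exact mul_le_of_le_one_left (inv_nonneg.2 (pow_pos (prime_cast_pos p) _).le) h7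
    exact ⟨hU _ _ (isNear_coe h5), hU _ _ (isNear_coe h5).symm⟩
  simp only [h4]
  split_ifs with h
  · rw [hφ.additive]
    refine Finset.sum_congr rfl fun j _ => ?_
    rw [Nat.cast_succ, zpow_natCast]
    congr 1
    rw [two_mul, pow_add]
    push_cast
    field_simp
  · simp

theorem IsDistribution.levelSum_eq {φ : ℚ → ℤ → M} (hφ : IsDistribution p φ)
    {U : Clopens (P1Qp p)} (hinf : (OnePoint.infty : P1Qp p) ∉ U) {m n : ℕ} (hU : IsLevel m U)
    (h : m ≤ n) : levelSum φ U n = levelSum φ U m := by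
  induction n, h using Nat.le_induction with
  | base => rfl
  | succ n hmn ih => rw [hφ.levelSum_succ hinf (hU.mono hmn), ih]

/-- The value on `U` of the finitely additive function attached to a distribution, for `U` not
containing `∞`. -/
noncomputable def distributionValue (φ : ℚ → ℤ → M) (U : Clopens (P1Qp p)) : M :=
  levelSum φ U (exists_isLevel U).choose

theorem IsDistribution.value_eq {φ : ℚ → ℤ → M} (hφ : IsDistribution p φ)
    {U : Clopens (P1Qp p)} (hinf : (OnePoint.infty : P1Qp p) ∉ U) {m : ℕ} (hU : IsLevel m U) :
    distributionValue φ U = levelSum φ U m := by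
  have hU' := (exists_isLevel U).choose_spec
  rw [distributionValue, ← hφ.levelSum_eq hinf hU' (le_max_left _ m),
    hφ.levelSum_eq hinf hU (le_max_right _ _)]

theorem IsDistribution.value_sup {φ : ℚ → ℤ → M} (hφ : IsDistribution p φ)
    {U V : Clopens (P1Qp p)} (hU : (OnePoint.infty : P1Qp p) ∉ U)
    (hV : (OnePoint.infty : P1Qp p) ∉ V) (hd : Disjoint U V) :
    distributionValue φ (U ⊔ V) = distributionValue φ U + distributionValue φ V := by
  classical
  obtain ⟨m, hm⟩ := exists_isLevel U
  obtain ⟨n, hn⟩ := exists_isLevel V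
  have hm' := hm.mono (le_max_left m n)
  have hn' := hn.mono (le_max_right m n)
  rw [hφ.value_eq hU hm', hφ.value_eq hV hn',
    hφ.value_eq (U := U ⊔ V) (fun h => Or.elim h hU hV) (hm'.sup hn'), levelSum, levelSum, levelSum,
    ← Finset.sum_add_distrib]
  refine Finset.sum_congr rfl fun i _ => ?_
  by_cases h1 : (center p (max m n) i : P1Qp p) ∈ U
  · have h2 : (center p (max m n) i : P1Qp p) ∉ V := fun h2 => by
      exact (disjoint_iff_inf_le.1 hd) (show _ ∈ U ⊓ V from ⟨h1, h2⟩)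
    rw [if_pos h1, if_neg h2, if_pos (show _ ∈ U ⊔ V from Or.inl h1), add_zero]
  · by_cases h2 : (center p (max m n) i : P1Qp p) ∈ V
    · rw [if_neg h1, if_pos h2, if_pos (show _ ∈ U ⊔ V from Or.inr h2), zero_add]
    · rw [if_neg h1, if_neg h2, if_neg (show ¬ _ ∈ U ⊔ V from fun h => Or.elim h h1 h2), zero_add]

open Classical in
/-- The measure of total mass zero attached to a distribution. -/
noncomputable def IsDistribution.measure {φ : ℚ → ℤ → M} (hφ : IsDistribution p φ) :
    BoundaryMeasure p M where
  toFun U := if (OnePoint.infty : P1Qp p) ∈ U then -distributionValue φ Uᶜ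
    else distributionValue φ U
  additive := by
    -- If `∞ ∈ V`, the value on `V` is defined through `Vᶜ`, which is the disjoint union of `U` and
    -- `(U ⊔ V)ᶜ`. Both miss `∞`, so additivity is already known for them.
    have key : ∀ U V : Clopens (P1Qp p), Disjoint U V → (OnePoint.infty : P1Qp p) ∉ U →
        (OnePoint.infty : P1Qp p) ∈ V →
        distributionValue φ Vᶜ = distributionValue φ U + distributionValue φ (U ⊔ V)ᶜ := by
      intro U V hd hU hV
      rw [← hφ.value_sup (V := (U ⊔ V)ᶜ) hU (fun h => h (Or.inr hV)) (disjoint_compl_right.mono_right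
        (compl_le_compl le_sup_left))]
      congr 1
      rw [compl_sup, sup_inf_left, sup_compl_eq_top, top_inf_eq,
        sup_eq_right.2 hd.le_compl_right]
    intro U V hd
    have hsup : (OnePoint.infty : P1Qp p) ∈ U ⊔ V ↔
      (OnePoint.infty : P1Qp p) ∈ U ∨ (OnePoint.infty : P1Qp p) ∈ V := Iff.rfl
    by_cases hU : (OnePoint.infty : P1Qp p) ∈ U
    · have hV : (OnePoint.infty : P1Qp p) ∉ V := fun hV =>
        (disjoint_iff_inf_le.1 hd) (show _ ∈ U ⊓ V from ⟨hU, hV⟩)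
      rw [if_pos hU, if_neg hV, if_pos (hsup.2 (Or.inl hU)), key V U hd.symm hV hU, sup_comm]
      abel
    · by_cases hV : (OnePoint.infty : P1Qp p) ∈ V
      · rw [if_neg hU, if_pos hV, if_pos (hsup.2 (Or.inr hV)), key U V hd hU hV]
        abel
      · rw [if_neg hU, if_neg hV, if_neg (fun h => (hsup.1 h).elim hU hV), hφ.value_sup hU hV hd]

theorem isLevel_bot (m : ℕ) : IsLevel m (⊥ : Clopens (P1Qp p)) := fun _ _ _ h => h

theorem IsDistribution.measure_top {φ : ℚ → ℤ → M} (hφ : IsDistribution p φ) :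
    hφ.measure.toFun ⊤ = 0 := by
  classical
  have h : hφ.measure.toFun ⊤ = -distributionValue φ (⊤ : Clopens (P1Qp p))ᶜ := if_pos trivial
  rw [h, compl_top, hφ.value_eq (U := ⊥) (fun h => h) (isLevel_bot 0), levelSum]
  refine neg_eq_zero.2 (Finset.sum_eq_zero fun i _ => if_neg fun h => h)

theorem IsDistribution.measure_of_infty_notMem {φ : ℚ → ℤ → M} (hφ : IsDistribution p φ)
    {U : Clopens (P1Qp p)} (hU : (OnePoint.infty : P1Qp p) ∉ U) :
    hφ.measure.toFun U = distributionValue φ U := if_neg hU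

theorem padicBall_succ_le (a : ℚ_[p]) (i : ℕ) (k : ℤ) :
    padicBall (a + (i : ℚ_[p]) * (p : ℚ_[p]) ^ k) (k + 1) ≤ padicBall a k := by
  intro t ht
  have ht' : t ∈ padicBall (a + (i : ℚ_[p]) * (p : ℚ_[p]) ^ k) (k + 1) := ht
  induction t using OnePoint.rec with
  | infty => exact absurd ht' infty_notMem_padicBall
  | coe x =>
    rw [coe_mem_padicBall] at ht'
    change (x : P1Qp p) ∈ padicBall a k
    rw [coe_mem_padicBall]
    refine ultra_sub_le_padic (b := a + (i : ℚ_[p]) * (p : ℚ_[p]) ^ k) (ht'.trans ?_) ?_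
    · exact zpow_le_zpow_right₀ (one_lt_prime_cast p).le (by omega)
    · have h7 : ‖(i : ℚ_[p])‖ ≤ 1 := by simpa using Padic.norm_int_le_one (p := p) i
      rw [add_sub_cancel_left, norm_mul, norm_zpow, Padic.norm_p, inv_zpow, zpow_neg]
      exact mul_le_of_le_one_left (inv_nonneg.2 (zpow_pos (prime_cast_pos p) _).le) h7

theorem padicBall_eq_sup (a : ℚ_[p]) (k : ℤ) : padicBall a k =
    (Finset.range p).sup fun i : ℕ => padicBall (a + (i : ℚ_[p]) * (p : ℚ_[p]) ^ k) (k + 1) := by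
  have hp1 := padic_prime_ne_zero p
  have hpk : (p : ℚ_[p]) ^ k ≠ 0 := zpow_ne_zero _ hp1
  refine le_antisymm (fun t ht => ?_) (Finset.sup_le fun i _ => padicBall_succ_le a i k)
  have ht' : t ∈ padicBall a k := ht
  induction t using OnePoint.rec with
  | infty => exact absurd ht' infty_notMem_padicBall
  | coe x =>
    rw [coe_mem_padicBall] at ht'
    have hpos : (0 : ℝ) < (p : ℝ) ^ (-k) := zpow_pos (prime_cast_pos p) _
    have hn : ‖(p : ℚ_[p]) ^ k‖ = (p : ℝ) ^ (-k) := by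
      rw [norm_zpow, Padic.norm_p, inv_zpow, zpow_neg]
    obtain ⟨i, hi, h⟩ := exists_nat_norm_sub_le (y := (x - a) / (p : ℚ_[p]) ^ k) (by
      rw [norm_div, hn]
      exact div_le_one_of_le₀ ht' hpos.le) 1
    rw [pow_one] at hi
    have hle := Finset.le_sup (f := fun i : ℕ => padicBall (a + (i : ℚ_[p]) * (p : ℚ_[p]) ^ k) (k + 1))
        (Finset.mem_range.2 hi)
    refine hle ?_
    change (x : P1Qp p) ∈ padicBall (a + (i : ℚ_[p]) * (p : ℚ_[p]) ^ k) (k + 1)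
    rw [coe_mem_padicBall]
    have : x - (a + (i : ℚ_[p]) * (p : ℚ_[p]) ^ k) = ((x - a) / (p : ℚ_[p]) ^ k - i) * (p : ℚ_[p]) ^ k := by
      field_simp
      ring
    rw [this, norm_mul, hn, neg_add, zpow_add₀ (prime_cast_pos p).ne', mul_comm]
    refine mul_le_mul_of_nonneg_left ?_ hpos.le
    simpa using h

theorem disjoint_padicBall_succ (a : ℚ_[p]) (k : ℤ) {i j : ℕ} (hi : i < p) (hj : j < p)
    (hij : i ≠ j) : Disjoint (padicBall (a + (i : ℚ_[p]) * (p : ℚ_[p]) ^ k) (k + 1))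
      (padicBall (a + (j : ℚ_[p]) * (p : ℚ_[p]) ^ k) (k + 1)) := by
  rw [disjoint_iff_inf_le]
  intro t ht
  obtain ⟨h1, h2⟩ : t ∈ padicBall (a + (i : ℚ_[p]) * (p : ℚ_[p]) ^ k) (k + 1) ∧
    t ∈ padicBall (a + (j : ℚ_[p]) * (p : ℚ_[p]) ^ k) (k + 1) := ht
  induction t using OnePoint.rec with
  | infty => exact absurd h1 infty_notMem_padicBall
  | coe x =>
    rw [coe_mem_padicBall] at h1 h2
    have hpos : (0 : ℝ) < (p : ℝ) ^ (-k) := zpow_pos (prime_cast_pos p) _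
    have h := ultra_sub_le_padic (a := a + (i : ℚ_[p]) * (p : ℚ_[p]) ^ k) (by rwa [norm_sub_rev]) h2
    have h3 : (a + (i : ℚ_[p]) * (p : ℚ_[p]) ^ k) - (a + (j : ℚ_[p]) * (p : ℚ_[p]) ^ k) =
      (i - j) * (p : ℚ_[p]) ^ k := by ring
    rw [h3, norm_mul, norm_zpow, Padic.norm_p, inv_zpow, ← zpow_neg, neg_add,
      zpow_add₀ (prime_cast_pos p).ne', mul_comm] at h
    have h4 := le_of_mul_le_mul_left h hpos
    refine hij (eq_of_norm_natCast_sub_le (p := p) (n := 1) (by simpa using hi)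
      (by simpa using hj) (by simpa using h4))

theorem isLevel_padicBall {a : ℚ_[p]} {N : ℕ} (ha : ‖a‖ ≤ (p : ℝ) ^ N) :
    IsLevel N (padicBall a N) := by
  rintro s t (⟨h1, -⟩ | ⟨x, y, rfl, rfl, hxy⟩) hs
  · induction s using OnePoint.rec with
    | infty => exact absurd hs infty_notMem_padicBall
    | coe x =>
      rw [isFar_coe] at h1
      rw [coe_mem_padicBall, zpow_neg, zpow_natCast] at hs
      have h2 := ultra_sub_le_padic (a := x) (b := a) (c := 0) (r := (p : ℝ) ^ N) (hs.trans
        ((inv_le_one_of_one_le₀ (one_le_pow₀ (one_lt_prime_cast p).le)).trans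
          (one_le_pow₀ (one_lt_prime_cast p).le))) (by simpa using ha)
      rw [sub_zero] at h2
      exact absurd h1 (not_lt.2 h2)
  · rw [coe_mem_padicBall, zpow_neg, zpow_natCast] at hs ⊢
    exact ultra_sub_le_padic (by rwa [norm_sub_rev]) hs

/-- Exactly one listed center lies in the ball, the one whose index `i₀` is `z` modulo `p ^ (2N)`.
The two centers differ by `w * p ^ N` with `w` an integer, which periodicity absorbs. -/
theorem IsDistribution.measure_padicBall_level {φ : ℚ → ℤ → M} (hφ : IsDistribution p φ)
    (z : ℤ) (N : ℕ) :
    hφ.measure.toFun (padicBall (((z : ℚ) / (p : ℚ) ^ N : ℚ) : ℚ_[p]) N) =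
      φ ((z : ℚ) / (p : ℚ) ^ N) N := by
  classical
  have hp0 : (p : ℚ) ≠ 0 := Nat.cast_ne_zero.2 hp.out.ne_zero
  have hp1 := padic_prime_ne_zero p
  set a : ℚ_[p] := (((z : ℚ) / (p : ℚ) ^ N : ℚ) : ℚ_[p]) with ha
  have ha' : a = (z : ℚ_[p]) / (p : ℚ_[p]) ^ N := by rw [ha]; push_cast; rfl
  have hnorm : ‖a‖ ≤ (p : ℝ) ^ N := by
    rw [ha', norm_div_prime_pow]
    exact mul_le_of_le_one_left (pow_pos (prime_cast_pos p) _).le (Padic.norm_int_le_one z)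
  rw [hφ.measure_of_infty_notMem infty_notMem_padicBall,
    hφ.value_eq infty_notMem_padicBall (isLevel_padicBall hnorm), levelSum]
  have hq : (0 : ℤ) < (p ^ (2 * N) : ℕ) := by exact_mod_cast pow_pos hp.out.pos _
  set i₀ : ℕ := (z % (p ^ (2 * N) : ℕ)).toNat with hi₀
  have hi₀' : (i₀ : ℤ) = z % (p ^ (2 * N) : ℕ) := Int.toNat_of_nonneg (Int.emod_nonneg _ hq.ne')
  have hz : z = i₀ + (p ^ (2 * N) : ℕ) * (z / (p ^ (2 * N) : ℕ)) := by
    rw [hi₀']; exact (Int.emod_add_mul_ediv _ _).symm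
  have hlt : i₀ < p ^ (2 * N) := by
    have := Int.emod_lt_of_pos z hq
    rw [← hi₀'] at this
    exact_mod_cast this
  set w : ℤ := z / (p ^ (2 * N) : ℕ) with hw
  have hdist : ‖center p N i₀ - a‖ ≤ ((p : ℝ) ^ N)⁻¹ := by
    have h6 : center p N i₀ - a = ((-w : ℤ) : ℚ_[p]) * (p : ℚ_[p]) ^ N := by
      rw [center, ha', hz, two_mul, pow_add]
      push_cast
      field_simp
      ring
    rw [h6, norm_mul_prime_pow]
    exact mul_le_of_le_one_left (inv_nonneg.2 (pow_pos (prime_cast_pos p) _).le)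
      (Padic.norm_int_le_one _)
  rw [Finset.sum_eq_single_of_mem i₀ (Finset.mem_range.2 hlt)]
  · rw [if_pos]
    · rw [← hφ.add_int_mul _ _ w]
      congr 1
      conv_rhs => rw [hz]
      rw [zpow_natCast, two_mul, pow_add]
      push_cast
      field_simp
    · rw [coe_mem_padicBall, zpow_neg, zpow_natCast]
      exact hdist
  · intro i hi hne
    rw [if_neg]
    intro hmem
    rw [coe_mem_padicBall, zpow_neg, zpow_natCast] at hmem
    exact hne (eq_of_norm_center_sub_le (Finset.mem_range.1 hi) hlt
      (ultra_sub_le_padic hmem (by rwa [norm_sub_rev])))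

theorem IsDistribution.measure_padicBall {φ : ℚ → ℤ → M} (hφ : IsDistribution p φ)
    (a : ℚ) (ha : ∃ (z : ℤ) (N : ℕ), a = (z : ℚ) / (p : ℚ) ^ N) (k : ℤ) :
    hφ.measure.toFun (padicBall (a : ℚ_[p]) k) = φ a k := by
  have hp0 : (p : ℚ) ≠ 0 := Nat.cast_ne_zero.2 hp.out.ne_zero
  -- Induction on `d = N - k`, cutting a large ball into `p` smaller ones until level `N` is
  -- reached. The condition `0 ≤ N + k` makes `i * p ^ k` a multiple of `p ^ (-N)`, so that the new
  -- centers still have denominator `p ^ N`.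
  have key : ∀ (d N : ℕ) (z : ℤ) (k : ℤ), k + d = N → 0 ≤ N + k →
      hφ.measure.toFun (padicBall (((z : ℚ) / (p : ℚ) ^ N : ℚ) : ℚ_[p]) k) =
        φ ((z : ℚ) / (p : ℚ) ^ N) k := by
    intro d
    induction d with
    | zero =>
      intro N z k hk _
      obtain rfl : k = N := by simpa using hk
      exact hφ.measure_padicBall_level z N
    | succ d ih =>
      intro N z k hk hNk
      rw [padicBall_eq_sup, BoundaryMeasure.toFun_finset_sup, hφ.additive]
      · refine Finset.sum_congr rfl fun i _ => ?_
        obtain ⟨l, hl⟩ := Int.eq_ofNat_of_zero_le hNk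
        have hk' : k = l - N := by omega
        have h1 : (z : ℚ) / (p : ℚ) ^ N + i * (p : ℚ) ^ k =
            ((z + i * (p : ℤ) ^ l : ℤ) : ℚ) / (p : ℚ) ^ N := by
          rw [hk', zpow_sub₀ hp0, zpow_natCast, zpow_natCast]
          push_cast
          field_simp
        have h2 := ih N (z + i * (p : ℤ) ^ l) (k + 1) (by push_cast at hk; omega) (by omega)
        rw [← h1] at h2
        rw [← h2]
        congr 2
        push_cast
        rfl
      · intro i hi j hj hij
        exact disjoint_padicBall_succ _ _ (Finset.mem_range.1 hi) (Finset.mem_range.1 hj) hij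
  obtain ⟨z, N, rfl⟩ := ha
  -- Enlarging the denominator to `p ^ (N + |k|)` secures both `k ≤ N + |k|` and `0 ≤ N + |k| + k`.
  have h1 : (z : ℚ) / (p : ℚ) ^ N =
      ((z * (p : ℤ) ^ k.natAbs : ℤ) : ℚ) / (p : ℚ) ^ (N + k.natAbs) := by
    rw [pow_add]
    push_cast
    field_simp
  rw [h1]
  exact key (N + k.natAbs - k).toNat _ _ k (by omega) (by omega)

end Distribution

end MockHilbert


namespace MockHilbert

open Polynomial Filter Topology TopologicalSpace

/-! ### Partitions of `ℙ₁(ℚ_p)` and their refinements. -/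

section Partitions

variable {p : ℕ} [hp : Fact p.Prime]

/-- The partitions of `ℙ₁(ℚ_p)` into compact open subsets. -/
abbrev BoundaryPartition (p : ℕ) [Fact p.Prime] : Type :=
  Finpartition (⊤ : Clopens (P1Qp p))

theorem mem_clopens_finset_sup {ι : Type*} {s : Finset ι} {V : ι → Clopens (P1Qp p)} {t : P1Qp p} :
    t ∈ s.sup V ↔ ∃ i ∈ s, t ∈ V i := by
  classical
  induction s using Finset.induction_on with
  | empty =>
    have h : t ∉ (⊥ : Clopens (P1Qp p)) := fun h => h
    simpa using h
  | insert i s hi ih =>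
    rw [Finset.sup_insert]
    change t ∈ V i ∨ t ∈ s.sup V ↔ _
    rw [ih]
    simp

theorem clopens_le_iff {U V : Clopens (P1Qp p)} : U ≤ V ↔ ∀ t ∈ U, t ∈ V := Iff.rfl

theorem clopens_nonempty {U : Clopens (P1Qp p)} (hU : U ≠ ⊥) : ∃ t, t ∈ U := by
  by_contra! h
  exact hU (le_bot_iff.1 (clopens_le_iff.2 fun t ht => absurd ht (h t)))

theorem exists_mem_part (C : BoundaryPartition p) (t : P1Qp p) : ∃ U ∈ C.parts, t ∈ U := by
  have h : t ∈ C.parts.sup id := by rw [C.sup_parts]; trivial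
  exact mem_clopens_finset_sup.1 h

theorem part_eq_of_mem (C : BoundaryPartition p) {U V : Clopens (P1Qp p)} (hU : U ∈ C.parts)
    (hV : V ∈ C.parts) {t : P1Qp p} (h1 : t ∈ U) (h2 : t ∈ V) : U = V := by
  by_contra hne
  exact (disjoint_iff_inf_le.1 (C.disjoint hU hV hne)) (show t ∈ U ⊓ V from ⟨h1, h2⟩)

theorem exists_partition_le_or_le_compl (V : Clopens (P1Qp p)) :
    ∃ C : BoundaryPartition p, ∀ U ∈ C.parts, U ≤ V ∨ U ≤ Vᶜ := by
  classical
  -- Parts of a `Finpartition` are nonempty, so `⊥` is erased in case `V` is empty or everything.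
  refine ⟨Finpartition.ofErase {V, Vᶜ} ?_ (by simp), fun U hU => ?_⟩
  · rw [Finset.supIndep_iff_pairwiseDisjoint]
    intro A hA B hB hAB
    simp only [Finset.coe_insert, Finset.coe_singleton, Set.mem_insert_iff,
      Set.mem_singleton_iff] at hA hB
    rcases hA with rfl | rfl <;> rcases hB with rfl | rfl
    · exact absurd rfl hAB
    · exact disjoint_compl_right
    · exact disjoint_compl_left
    · exact absurd rfl hAB
  · have h := (Finset.mem_erase.1 hU).2
    simp only [Finset.mem_insert, Finset.mem_singleton] at h
    exact h.imp le_of_eq le_of_eq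

theorem exists_partition_forall (s : Finset (Clopens (P1Qp p))) :
    ∃ C : BoundaryPartition p, ∀ V ∈ s, ∀ U ∈ C.parts, U ≤ V ∨ U ≤ Vᶜ := by
  classical
  induction s using Finset.induction_on with
  | empty =>
    obtain ⟨C, -⟩ := exists_partition_le_or_le_compl (p := p) ⊥
    exact ⟨C, by simp⟩
  | insert V s hV ih =>
    obtain ⟨C, hC⟩ := ih
    obtain ⟨D, hD⟩ := exists_partition_le_or_le_compl V
    refine ⟨C ⊓ D, fun W hW U hU => ?_⟩
    rcases Finset.mem_insert.1 hW with rfl | hW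
    · obtain ⟨U', hU', hle⟩ := (inf_le_right : C ⊓ D ≤ D) hU
      exact (hD U' hU').imp hle.trans hle.trans
    · obtain ⟨U', hU', hle⟩ := (inf_le_left : C ⊓ D ≤ C) hU
      exact (hC W hW U' hU').imp hle.trans hle.trans

/-- The partition `C` is finer than the uniform structure of level `m`. -/
def IsFine (m : ℕ) (C : BoundaryPartition p) : Prop :=
  ∀ U ∈ C.parts, ∀ s ∈ U, ∀ t ∈ U, IsNear m s t

theorem IsFine.of_le {m : ℕ} {C D : BoundaryPartition p} (hC : IsFine m C) (h : D ≤ C) :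
    IsFine m D := by
  intro U hU s hs t ht
  obtain ⟨V, hV, hle⟩ := h hU
  exact hC V hV s (hle hs) t (hle ht)

theorem exists_isFine (m : ℕ) : ∃ C : BoundaryPartition p, IsFine m C := by
  classical
  obtain ⟨C, hC⟩ := exists_partition_forall
    ((Finset.range (p ^ (2 * m))).image fun i => padicBall (center p m i) m)
  refine ⟨C, fun U hU s hs t ht => ?_⟩
  by_cases h : ∃ i ∈ Finset.range (p ^ (2 * m)), U ≤ padicBall (center p m i) m
  · obtain ⟨i, -, hle⟩ := h
    have h1 : s ∈ padicBall (center p m i) m := hle hs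
    have h2 : t ∈ padicBall (center p m i) m := hle ht
    induction s using OnePoint.rec with
    | infty => exact absurd h1 infty_notMem_padicBall
    | coe x =>
      induction t using OnePoint.rec with
      | infty => exact absurd h2 infty_notMem_padicBall
      | coe y =>
        rw [coe_mem_padicBall, zpow_neg, zpow_natCast] at h1 h2
        exact isNear_coe (ultra_sub_le_padic h1 (by rwa [norm_sub_rev]))
  -- A part inside none of the balls avoids all of them. They cover the points of norm at most `p ^
  -- m`, so only far points remain.
  · have hfar : ∀ s ∈ U, IsFar m s := by
      intro s hs a ha
      subst ha
      by_contra hle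
      obtain ⟨i, hi, hai⟩ := exists_center (not_lt.1 hle)
      rcases hC _ (Finset.mem_image_of_mem _ (Finset.mem_range.2 hi)) U hU with h1 | h1
      · exact h ⟨i, Finset.mem_range.2 hi, h1⟩
      · refine h1 hs ?_
        change (a : P1Qp p) ∈ padicBall (center p m i) m
        rw [coe_mem_padicBall, zpow_neg, zpow_natCast]
        exact hai
    exact Or.inl ⟨hfar s hs, hfar t ht⟩

theorem exists_fine_sequence (p : ℕ) [Fact p.Prime] :
    ∃ C : ℕ → BoundaryPartition p, Antitone C ∧ ∀ m, IsFine m (C m) := by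
  classical
  choose D hD using exists_isFine (p := p)
  let C : ℕ → BoundaryPartition p := fun m => Nat.rec (D 0) (fun m P => P ⊓ D (m + 1)) m
  refine ⟨C, antitone_nat_of_succ_le fun m => inf_le_left, fun m => ?_⟩
  cases m with
  | zero => exact hD 0
  | succ m => exact (hD (m + 1)).of_le inf_le_right

/-- Sums against a measure of functions on the parts of a partition can be computed on a
refinement. -/
theorem BoundaryMeasure.exists_refinement {M : Type*} [AddCommGroup M] {A : Type*}
    [AddCommMonoid A] (ν : BoundaryMeasure p M) {C D : BoundaryPartition p} (h : D ≤ C) :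
    ∃ r : Clopens (P1Qp p) → Clopens (P1Qp p), (∀ U ∈ D.parts, r U ∈ C.parts ∧ U ≤ r U) ∧
      ∀ G : Clopens (P1Qp p) → M →+ A, ∑ V ∈ C.parts, G V (ν.toFun V) =
        ∑ U ∈ D.parts, G (r U) (ν.toFun U) := by
  classical
  have h' : ∀ U : Clopens (P1Qp p), ∃ V, U ∈ D.parts → V ∈ C.parts ∧ U ≤ V := by
    intro U
    by_cases hU : U ∈ D.parts
    · obtain ⟨V, hV, hle⟩ := h hU
      exact ⟨V, fun _ => ⟨hV, hle⟩⟩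
    · exact ⟨⊥, fun h => absurd h hU⟩
  choose r hr using h'
  refine ⟨r, hr, fun G => ?_⟩
  rw [← Finset.sum_fiberwise_of_maps_to (t := C.parts) (g := r) fun U hU => (hr U hU).1]
  refine Finset.sum_congr rfl fun V hV => ?_
  have hsup : (D.parts.filter fun U => r U = V).sup id = V := by
    refine le_antisymm (Finset.sup_le fun U hU => ?_) fun t ht => ?_
    · obtain ⟨hU', hrU⟩ := Finset.mem_filter.1 hU
      exact hrU ▸ (hr U hU').2
    · obtain ⟨U, hU, htU⟩ := exists_mem_part D t
      exact mem_clopens_finset_sup.2 ⟨U, Finset.mem_filter.2 ⟨hU,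
        part_eq_of_mem C (hr U hU).1 hV ((hr U hU).2 htU) ht⟩, htU⟩
  have hsum := ν.toFun_finset_sup (D.parts.filter fun U => r U = V) id
    (D.disjoint.subset fun U hU => (Finset.mem_filter.1 (Finset.mem_coe.1 hU)).1)
  rw [hsup] at hsum
  rw [hsum, map_sum]
  refine Finset.sum_congr rfl fun U hU => ?_
  rw [(Finset.mem_filter.1 hU).2, id]

end Partitions

end MockHilbert


namespace MockHilbert

open Polynomial Filter Topology TopologicalSpace

/-! ### Uniform limits of rigid functions, of their derivatives and of units. -/

section RigidLimits

variable {p : ℕ} [hp : Fact p.Prime]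

/-- Uniform convergence on the affinoids of the standard exhaustion. -/
def RigidTendsto (F : ℕ → RigidFun p) (G : RigidFun p) : Prop :=
  ∀ n : ℕ, ∀ ε : ℝ, 0 < ε → ∃ M, ∀ m ≥ M, ∀ z : Hp p, (z : ℂ_[p]) ∈ affinoid p n →
    ‖(F m).1 z - G.1 z‖ ≤ ε

theorem rigidFun_ext {F G : RigidFun p} (h : ∀ z, F.1 z = G.1 z) : F = G :=
  Subtype.ext (funext h)

theorem isRigid_extendZero (F : RigidFun p) : IsRigid p (extendZero F.1) := F.2

theorem exists_bound_rigidFun (F : RigidFun p) (n : ℕ) :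
    ∃ M : ℝ, 0 < M ∧ ∀ z : Hp p, (z : ℂ_[p]) ∈ affinoid p n → ‖F.1 z‖ ≤ M := by
  obtain ⟨M, h0, hM⟩ := (isRigid_extendZero F).exists_bound n
  exact ⟨M, h0, fun z hz => by simpa [extendZero_coe] using hM z hz⟩

theorem RigidTendsto.tendsto {F : ℕ → RigidFun p} {G : RigidFun p} (h : RigidTendsto F G)
    (z : Hp p) : Tendsto (fun m => (F m).1 z) atTop (𝓝 (G.1 z)) := by
  obtain ⟨n, hn⟩ := exists_mem_affinoid z.2
  rw [Metric.tendsto_atTop]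
  intro ε hε
  obtain ⟨M, hM⟩ := h n (ε / 2) (half_pos hε)
  refine ⟨M, fun m hm => ?_⟩
  rw [dist_eq_norm]
  exact (hM m hm z hn).trans_lt (half_lt_self hε)

theorem RigidTendsto.unique {F : ℕ → RigidFun p} {G H : RigidFun p} (hG : RigidTendsto F G)
    (hH : RigidTendsto F H) : G = H :=
  rigidFun_ext fun z => tendsto_nhds_unique (hG.tendsto z) (hH.tendsto z)

theorem RigidTendsto.mul {F G : ℕ → RigidFun p} {A B : RigidFun p} (hF : RigidTendsto F A)
    (hG : RigidTendsto G B) : RigidTendsto (fun m => F m * G m) (A * B) := by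
  intro n ε hε
  obtain ⟨a, ha0, ha⟩ := exists_bound_rigidFun A n
  obtain ⟨b, hb0, hb⟩ := exists_bound_rigidFun B n
  obtain ⟨M, hM⟩ := hF n (min (ε / b) a) (lt_min (by positivity) ha0)
  obtain ⟨N, hN⟩ := hG n (ε / a) (by positivity)
  refine ⟨max M N, fun m hm z hz => ?_⟩
  have h1 := hM m ((le_max_left _ _).trans hm) z hz
  have h2 := hN m ((le_max_right _ _).trans hm) z hz
  have h3 : ‖(F m).1 z‖ ≤ a := by
    have : (F m).1 z = ((F m).1 z - A.1 z) + A.1 z := by ring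
    rw [this]
    exact (IsUltrametricDist.norm_add_le_max _ _).trans
      (max_le (h1.trans (min_le_right _ _)) (ha z hz))
  have h4 : (F m * G m).1 z - (A * B).1 z =
      ((F m).1 z - A.1 z) * B.1 z + (F m).1 z * ((G m).1 z - B.1 z) := by
    change (F m).1 z * (G m).1 z - A.1 z * B.1 z = _
    ring
  rw [h4]
  refine (IsUltrametricDist.norm_add_le_max _ _).trans (max_le ?_ ?_)
  · rw [norm_mul]
    refine (mul_le_mul (h1.trans (min_le_left _ _)) (hb z hz) (norm_nonneg _)
      (by positivity)).trans_eq (by field_simp)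
  · rw [norm_mul]
    refine (mul_le_mul h3 h2 (norm_nonneg _) ha0.le).trans_eq (by field_simp)

/-- The pointwise limit inherits the uniform estimate. By the ultrametric inequality, a rational
function within `ε` of a late term is also within `ε` of the limit, so the limit is rigid. -/
theorem exists_rigidTendsto {F : ℕ → RigidFun p}
    (h : ∀ n : ℕ, ∀ ε : ℝ, 0 < ε → ∃ M, ∀ m ≥ M, ∀ z : Hp p, (z : ℂ_[p]) ∈ affinoid p n →
      ‖(F m).1 z - (F M).1 z‖ ≤ ε) : ∃ G, RigidTendsto F G := by
  have hc : ∀ z : Hp p, ∃ w, Tendsto (fun m => (F m).1 z) atTop (𝓝 w) := by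
    intro z
    obtain ⟨n, hn⟩ := exists_mem_affinoid z.2
    refine cauchySeq_tendsto_of_complete (Metric.cauchySeq_iff'.2 fun ε hε => ?_)
    obtain ⟨M, hM⟩ := h n (ε / 2) (half_pos hε)
    refine ⟨M, fun m hm => ?_⟩
    rw [dist_eq_norm]
    exact (hM m hm z hn).trans_lt (half_lt_self hε)
  choose g hg using hc
  have key : ∀ n : ℕ, ∀ ε : ℝ, 0 < ε → ∃ M, ∀ m ≥ M, ∀ z : Hp p, (z : ℂ_[p]) ∈ affinoid p n →
      ‖(F m).1 z - g z‖ ≤ ε := by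
    intro n ε hε
    obtain ⟨M, hM⟩ := h n ε hε
    refine ⟨M, fun m hm z hz => ?_⟩
    have h1 : ‖(F M).1 z - g z‖ ≤ ε := by
      refine le_of_tendsto (tendsto_const_nhds.sub (hg z)).norm ?_
      filter_upwards [eventually_ge_atTop M] with k hk
      rw [norm_sub_rev]
      exact hM k hk z hz
    exact ultra_sub_le (hM m hm z hz) h1
  refine ⟨⟨g, ?_⟩, key⟩
  intro n ε hε
  obtain ⟨M, hM⟩ := key n ε hε
  obtain ⟨P, Q, hPQ⟩ := isRigid_extendZero (F M) n ε hε
  refine ⟨P, Q, fun z hz => ⟨(hPQ z hz).1, ?_⟩⟩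
  have h1 := (hPQ z hz).2
  have hz' := mem_Hp_of_mem_affinoid hz
  have h2 := hM M le_rfl ⟨z, hz'⟩ hz
  have e1 := extendZero_coe (F M).1 ⟨z, hz'⟩
  have e2 := extendZero_coe g ⟨z, hz'⟩
  simp only at e1 e2
  rw [e1] at h1
  rw [e2]
  refine ultra_sub_le ?_ h1
  rwa [norm_sub_rev]

/-- A Cauchy estimate. The ball of radius `‖p ^ (n + 1)‖` around `z₀` stays in the affinoid, and the
Schwarz lemma for rational functions on it gives the Lipschitz constant at `z₀`. -/
theorem IsRigid.norm_deriv_le {F : ℂ_[p] → ℂ_[p]} (hF : IsRigid p F) {n : ℕ} {ε : ℝ} (hε : 0 < ε)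
    (hb : ∀ z ∈ affinoid p n, ‖F z‖ ≤ ε) {z₀ : ℂ_[p]} (hz₀ : z₀ ∈ affinoid p n) :
    ‖_root_.deriv F z₀‖ ≤ ε / ‖(p : ℂ_[p]) ^ (n + 1)‖ := by
  set c : ℂ_[p] := (p : ℂ_[p]) ^ (n + 1) with hc
  have hc0 : c ≠ 0 := p_pow_ne_zero _
  have hc' : 0 < ‖c‖ := norm_pos_iff.2 hc0
  refine norm_deriv_le_of_lip' (by positivity) ?_
  filter_upwards [Metric.closedBall_mem_nhds z₀ hc'] with z hz
  rw [Metric.mem_closedBall, dist_eq_norm] at hz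
  rcases eq_or_ne z z₀ with rfl | hne
  · simp
  have hd : 0 < ‖z - z₀‖ := norm_pos_iff.2 (sub_ne_zero.2 hne)
  -- The tolerance depends on `z`: being proportional to `‖z - z₀‖`, the approximation error does
  -- not spoil the difference quotient.
  obtain ⟨R, S, hRS⟩ := hF n (min ε (ε / ‖c‖ * ‖z - z₀‖)) (lt_min hε (by positivity))
  have hball : ∀ w, ‖w - z₀‖ ≤ ‖c‖ → w ∈ affinoid p n := fun w hw => ball_subset_affinoid hz₀ hw
  have hS := norm_eval_div_sub_le R S z₀ c hc0 ε (fun w hw => (hRS w (hball w hw)).1)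
    (fun w hw => by
      have : R.eval w / S.eval w = F w + -(F w - R.eval w / S.eval w) := by ring
      rw [this]
      refine (IsUltrametricDist.norm_add_le_max _ _).trans (max_le (hb w (hball w hw)) ?_)
      rw [norm_neg]
      exact (hRS w (hball w hw)).2.trans (min_le_left _ _)) z hz
  have hfin : F z - F z₀ = ((F z - R.eval z / S.eval z) + -(F z₀ - R.eval z₀ / S.eval z₀)) +
      (R.eval z / S.eval z - R.eval z₀ / S.eval z₀) := by ring
  rw [hfin]
  refine (IsUltrametricDist.norm_add_le_max _ _).trans (max_le ?_ hS)
  refine (IsUltrametricDist.norm_add_le_max _ _).trans (max_le ?_ ?_)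
  · exact (hRS z (hball z hz)).2.trans (min_le_right _ _)
  · rw [norm_neg]
    exact (hRS z₀ hz₀).2.trans (min_le_right _ _)

theorem rigidDeriv_sub (F G : RigidFun p) :
    rigidDeriv (F - G) = rigidDeriv F - rigidDeriv G := by
  ext z
  have h1 : extendZero (F - G).1 =ᶠ[𝓝 (z : ℂ_[p])] extendZero F.1 - extendZero G.1 := by
    filter_upwards [Hp_mem_nhds z] with w hw
    rw [Pi.sub_apply, extendZero_coe _ ⟨w, hw⟩, extendZero_coe _ ⟨w, hw⟩,
      extendZero_coe _ ⟨w, hw⟩]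
    rfl
  have h2 := deriv_sub (rigid_differentiableAt F z) (rigid_differentiableAt G z)
  rw [← h1.deriv_eq] at h2
  exact h2

theorem RigidTendsto.deriv {F : ℕ → RigidFun p} {G : RigidFun p} (h : RigidTendsto F G) :
    RigidTendsto (fun m => rigidDeriv (F m)) (rigidDeriv G) := by
  intro n ε hε
  have hc' : 0 < ‖(p : ℂ_[p]) ^ (n + 1)‖ := norm_pos_iff.2 (p_pow_ne_zero _)
  obtain ⟨M, hM⟩ := h n (ε * ‖(p : ℂ_[p]) ^ (n + 1)‖) (by positivity)
  refine ⟨M, fun m hm z hz => ?_⟩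
  have h1 : (rigidDeriv (F m)).1 z - (rigidDeriv G).1 z = (rigidDeriv (F m - G)).1 z := by
    rw [rigidDeriv_sub]; rfl
  rw [h1]
  refine ((isRigid_extendZero (F m - G)).norm_deriv_le (by positivity) (fun w hw => ?_) hz).trans_eq
    (mul_div_cancel_right₀ ε hc'.ne')
  have hw' := mem_Hp_of_mem_affinoid hw
  have e1 := extendZero_coe (F m - G).1 ⟨w, hw'⟩
  simp only at e1
  rw [e1]
  exact hM m hm ⟨w, hw'⟩ hw


/-- The value at `z` of an invertible rigid analytic function. -/
noncomputable def unitEval (z : Hp p) : (RigidFun p)ˣ →* ℂ_[p]ˣ :=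
  Units.map ((Pi.evalMonoidHom (fun _ : Hp p => ℂ_[p]) z).comp
    ((RigidFun p).val : RigidFun p →* (Hp p → ℂ_[p])))

theorem coe_unitEval (z : Hp p) (F : (RigidFun p)ˣ) :
    (unitEval z F : ℂ_[p]) = (F : RigidFun p).1 z := rfl

/-- The sequence of units `F` is a Cauchy sequence, uniformly on affinoids. -/
def IsUnitCauchy (F : ℕ → (RigidFun p)ˣ) : Prop :=
  ∀ n : ℕ, ∀ ε : ℝ, 0 < ε → ∃ M, ∀ m ≥ M, ∀ k ≥ M, ∀ z : Hp p, (z : ℂ_[p]) ∈ affinoid p n →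
    ‖((unitEval z (F m / F k) : ℂ_[p]ˣ) : ℂ_[p]) - 1‖ ≤ ε

theorem IsUnitCauchy.inv {F : ℕ → (RigidFun p)ˣ} (h : IsUnitCauchy F) :
    IsUnitCauchy fun m => (F m)⁻¹ := by
  intro n ε hε
  obtain ⟨M, hM⟩ := h n ε hε
  refine ⟨M, fun m hm k hk z hz => ?_⟩
  rw [inv_div_inv]
  exact hM k hk m hm z hz

/-- Writing `F m = (F m / F M) * F M` turns multiplicative closeness into additive closeness once
the `F M` are bounded. The bound of one fixed term serves for all later ones, since the quotients
have norm at most `1`. -/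
theorem IsUnitCauchy.exists_rigidTendsto {F : ℕ → (RigidFun p)ˣ} (h : IsUnitCauchy F) :
    ∃ G, RigidTendsto (fun m => (F m : RigidFun p)) G := by
  refine MockHilbert.exists_rigidTendsto fun n ε hε => ?_
  obtain ⟨M₀, hM₀⟩ := h n 1 one_pos
  obtain ⟨b, hb0, hb⟩ := exists_bound_rigidFun (F M₀ : RigidFun p) n
  have hfac : ∀ m M z, (F m : RigidFun p).1 z =
      (unitEval z (F m / F M) : ℂ_[p]) * (F M : RigidFun p).1 z := by
    intro m M z
    rw [← coe_unitEval, ← coe_unitEval, ← Units.val_mul, ← map_mul, div_mul_cancel]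
  obtain ⟨M₁, hM₁⟩ := h n (ε / b) (by positivity)
  refine ⟨max M₀ M₁, fun m hm z hz => ?_⟩
  have hbound : ‖(F (max M₀ M₁) : RigidFun p).1 z‖ ≤ b := by
    rw [hfac _ M₀, norm_mul]
    refine (mul_le_of_le_one_left (norm_nonneg _) ?_).trans (hb z hz)
    have := ultra_sub_le (c := 0) (hM₀ _ (le_max_left M₀ M₁) M₀ le_rfl z hz) (by simp)
    simpa using this
  rw [hfac m (max M₀ M₁), ← sub_one_mul, norm_mul]
  refine (mul_le_mul (hM₁ m ((le_max_right _ _).trans hm) _ (le_max_right _ _) z hz) hbound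
    (norm_nonneg _) (by positivity)).trans_eq (by field_simp)

theorem rigidTendsto_const (G : RigidFun p) : RigidTendsto (fun _ => G) G := fun n ε hε =>
  ⟨0, fun m _ z _ => by simpa using hε.le⟩

/-- A Cauchy sequence of units converges to a unit, with logarithmic derivative the limit of the
logarithmic derivatives. -/
theorem IsUnitCauchy.exists_dlogUnits_eq {F : ℕ → (RigidFun p)ˣ} (h : IsUnitCauchy F)
    {H : RigidFun p} (hH : RigidTendsto (fun m => (dlogUnits (F m)).toAdd) H) :
    ∃ E : (RigidFun p)ˣ, (dlogUnits E).toAdd = H := by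
  obtain ⟨G, hG⟩ := h.exists_rigidTendsto
  obtain ⟨G', hG'⟩ := h.inv.exists_rigidTendsto
  -- The inverses also form a Cauchy sequence, and their limit inverts `G`.
  have h1 : G * G' = 1 := by
    refine (hG.mul hG').unique ?_
    simpa using rigidTendsto_const (1 : RigidFun p)
  refine ⟨⟨G, G', h1, by rw [mul_comm, h1]⟩, ?_⟩
  -- The identity `F' = F * dlog F` holds for every term and passes to the limit, so no division of
  -- limits is needed.
  have h2 : rigidDeriv G = G * H := by
    refine hG.deriv.unique ?_
    have h3 := hG.mul hH
    convert h3 using 2 with m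
    change _ = (F m : RigidFun p) * (((F m)⁻¹ : (RigidFun p)ˣ) * rigidDeriv (F m : RigidFun p))
    rw [← mul_assoc, Units.mul_inv, one_mul]
  change G' * rigidDeriv G = H
  rw [h2, ← mul_assoc, mul_comm G', h1, one_mul]

end RigidLimits

end MockHilbert


namespace MockHilbert

open Filter Topology TopologicalSpace

/-! ### Additive and multiplicative Riemann sums of the Poisson kernel. -/

section RiemannSums

variable {p : ℕ} [hp : Fact p.Prime]

/-- Integers have norm at most `1` and the norm is ultrametric, so the oscillation of `g` on the
parts of `C` bounds the error, whatever the size of `ν` and the number of parts. -/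
theorem norm_riemannSum_sub_le (ν : BoundaryMeasure p ℤ) {C D : BoundaryPartition p} (h : D ≤ C)
    (g : P1Qp p → ℂ_[p]) {δ : ℝ} (hδ : 0 ≤ δ)
    (hg : ∀ V ∈ C.parts, ∀ x ∈ V, ∀ y ∈ V, ‖g x - g y‖ ≤ δ)
    (s t : Clopens (P1Qp p) → P1Qp p) (hs : ∀ V ∈ C.parts, s V ∈ V) (ht : ∀ U ∈ D.parts, t U ∈ U) :
    ‖∑ U ∈ D.parts, (ν.toFun U : ℂ_[p]) * g (t U) -
      ∑ V ∈ C.parts, (ν.toFun V : ℂ_[p]) * g (s V)‖ ≤ δ := by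
  obtain ⟨r, hr, hsum⟩ := ν.exists_refinement (A := ℂ_[p]) h
  have h1 := hsum fun V => (AddMonoidHom.mulRight (g (s V))).comp (Int.castAddHom ℂ_[p])
  simp only [AddMonoidHom.comp_apply, Int.coe_castAddHom, AddMonoidHom.mulRight_apply] at h1
  rw [h1, ← Finset.sum_sub_distrib]
  refine IsUltrametricDist.norm_sum_le_of_forall_le_of_nonneg hδ fun U hU => ?_
  rw [← mul_sub, norm_mul]
  refine (mul_le_of_le_one_left (norm_nonneg _) (IsUltrametricDist.norm_intCast_le_one _ _)).trans ?_
  exact hg _ (hr U hU).1 _ ((hr U hU).2 (ht U hU)) _ (hs _ (hr U hU).1)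

/-- The subgroup of units at distance at most `δ` from `1`. -/
def unitBall (p : ℕ) [Fact p.Prime] (δ : ℝ) (h0 : 0 ≤ δ) (h1 : δ < 1) : Subgroup ℂ_[p]ˣ where
  carrier := {u | ‖(u : ℂ_[p]) - 1‖ ≤ δ}
  one_mem' := by simpa using h0
  mul_mem' {a b} ha hb := by
    have ha' : ‖(a : ℂ_[p]) - 1‖ ≤ δ := ha
    have hb' : ‖(b : ℂ_[p]) - 1‖ ≤ δ := hb
    change ‖((a * b : ℂ_[p]ˣ) : ℂ_[p]) - 1‖ ≤ δ
    have h2 : ‖(a : ℂ_[p])‖ ≤ 1 := by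
      have := ultra_sub_le (c := 0) (ha'.trans h1.le) (by simp)
      simpa using this
    have : ((a * b : ℂ_[p]ˣ) : ℂ_[p]) - 1 = a * (b - 1) + (a - 1) := by push_cast; ring
    rw [this]
    refine (IsUltrametricDist.norm_add_le_max _ _).trans (max_le ?_ ha')
    rw [norm_mul]
    exact (mul_le_of_le_one_left (norm_nonneg _) h2).trans hb'
  inv_mem' {a} ha := by
    have ha' : ‖(a : ℂ_[p]) - 1‖ ≤ δ := ha
    change ‖((a⁻¹ : ℂ_[p]ˣ) : ℂ_[p]) - 1‖ ≤ δ
    have h2 : ‖(a : ℂ_[p])‖ = 1 := by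
      have := ultra_sub_eq (a := (a : ℂ_[p])) (b := 1) (c := 0) (by simpa using ha'.trans_lt h1)
      simpa using this
    have : ((a⁻¹ : ℂ_[p]ˣ) : ℂ_[p]) - 1 = -((a : ℂ_[p])⁻¹ * (a - 1)) := by
      rw [Units.val_inv_eq_inv_val, mul_sub, inv_mul_cancel₀ a.ne_zero]
      ring
    rw [this, norm_neg, norm_mul, norm_inv, h2, inv_one, one_mul]
    exact ha'

theorem mem_unitBall {δ : ℝ} {h0 : 0 ≤ δ} {h1 : δ < 1} {u : ℂ_[p]ˣ} :
    u ∈ unitBall p δ h0 h1 ↔ ‖(u : ℂ_[p]) - 1‖ ≤ δ := Iff.rfl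

/-- The Riemann products of a function with values in a commutative group. -/
noncomputable def riemannProd {A : Type*} [CommGroup A] (ν : BoundaryMeasure p ℤ)
    (C : BoundaryPartition p) (G : P1Qp p → A) (t : Clopens (P1Qp p) → P1Qp p) : A :=
  ∏ U ∈ C.parts, G (t U) ^ ν.toFun U

/-- The multiplicative counterpart of `norm_riemannSum_sub_le`: closure of a subgroup under products
and integral powers replaces the ultrametric bound. It is applied to `unitBall`. -/
theorem riemannProd_div_mem {A : Type*} [CommGroup A] (S : Subgroup A) (ν : BoundaryMeasure p ℤ)
    {C D : BoundaryPartition p} (h : D ≤ C) (G : P1Qp p → A)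
    (hG : ∀ V ∈ C.parts, ∀ x ∈ V, ∀ y ∈ V, G x / G y ∈ S)
    (s t : Clopens (P1Qp p) → P1Qp p) (hs : ∀ V ∈ C.parts, s V ∈ V) (ht : ∀ U ∈ D.parts, t U ∈ U) :
    riemannProd ν D G t / riemannProd ν C G s ∈ S := by
  obtain ⟨r, hr, hsum⟩ := ν.exists_refinement (A := Additive A) h
  have h1 : riemannProd ν C G s = ∏ U ∈ D.parts, G (s (r U)) ^ ν.toFun U :=
    hsum fun V => zmultiplesHom (Additive A) (Additive.ofMul (G (s V)))
  rw [h1, riemannProd, ← Finset.prod_div_distrib]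
  refine S.prod_mem fun U hU => ?_
  rw [← div_zpow]
  exact S.zpow_mem (hG _ (hr U hU).1 _ ((hr U hU).2 (ht U hU)) _ (hs _ (hr U hU).1)) _

theorem norm_sub_padic_pos {n : ℕ} {z : ℂ_[p]} (hz : z ∈ affinoid p n) (a : ℚ_[p]) :
    0 < ‖z - algebraMap ℚ_[p] ℂ_[p] a‖ :=
  (inv_pos.2 (pow_pos (prime_cast_pos p) n)).trans_le (hz.2 a)

theorem Hp_sub_ne_zero (z : Hp p) (a : ℚ_[p]) : (z : ℂ_[p]) - algebraMap ℚ_[p] ℂ_[p] a ≠ 0 :=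
  sub_ne_zero.2 (z.2 a)

theorem norm_inv_sub_le {n : ℕ} {z : ℂ_[p]} (hz : z ∈ affinoid p n) (a : ℚ_[p]) :
    ‖(z - algebraMap ℚ_[p] ℂ_[p] a)⁻¹‖ ≤ (p : ℝ) ^ n := by
  rw [norm_inv, inv_le_comm₀ (norm_sub_padic_pos hz a) (pow_pos (prime_cast_pos p) n)]
  exact hz.2 a

theorem norm_inv_sub_le_of_isFar {n m : ℕ} (hnm : n ≤ m) {z : ℂ_[p]} (hz : z ∈ affinoid p n)
    {a : ℚ_[p]} (ha : IsFar m (a : P1Qp p)) :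
    ‖(z - algebraMap ℚ_[p] ℂ_[p] a)⁻¹‖ ≤ ((p : ℝ) ^ m)⁻¹ := by
  rw [isFar_coe] at ha
  have h1 : ‖z‖ < ‖algebraMap ℚ_[p] ℂ_[p] a‖ := by
    rw [norm_algebraMap']
    exact (hz.1.trans (pow_le_pow_right₀ (one_lt_prime_cast p).le hnm)).trans_lt ha
  have h2 : ‖z - algebraMap ℚ_[p] ℂ_[p] a‖ = ‖a‖ := by
    have := ultra_sub_eq (a := z) (b := 0) (c := algebraMap ℚ_[p] ℂ_[p] a) (by simpa using h1)
    rw [this, zero_sub, norm_neg, norm_algebraMap']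
  rw [norm_inv, h2]
  exact inv_anti₀ (pow_pos (prime_cast_pos p) m) ha.le

/-- Near `∞` both values are small. Elsewhere the difference is `(a - b) / ((z - a) (z - b))`, and
on the affinoid each denominator costs a factor `p ^ n`. -/
theorem norm_poissonKernel_sub_le {n m : ℕ} (hnm : n ≤ m) (z : Hp p)
    (hz : (z : ℂ_[p]) ∈ affinoid p n) {s t : P1Qp p} (hst : IsNear m s t) :
    ‖poissonKernel z s - poissonKernel z t‖ ≤ ((p : ℝ) ^ n) ^ 2 * ((p : ℝ) ^ m)⁻¹ := by
  have hpos : (0 : ℝ) < (p : ℝ) ^ m := pow_pos (prime_cast_pos p) m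
  have hone : (1 : ℝ) ≤ (p : ℝ) ^ n := one_le_pow₀ (one_lt_prime_cast p).le
  rcases hst with ⟨h1, h2⟩ | ⟨a, b, rfl, rfl, hab⟩
  · have key : ∀ s : P1Qp p, IsFar m s → ‖poissonKernel z s‖ ≤ ((p : ℝ) ^ m)⁻¹ := by
      intro s hs
      induction s using OnePoint.rec with
      | infty => simp [poissonKernel]
      | coe a => exact norm_inv_sub_le_of_isFar hnm hz hs
    rw [sub_eq_add_neg]
    refine (IsUltrametricDist.norm_add_le_max _ _).trans ((max_le (key s h1) ?_).trans ?_)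
    · rw [norm_neg]
      exact key t h2
    · exact le_mul_of_one_le_left (inv_pos.2 hpos).le (one_le_pow₀ hone)
  · have ha := Hp_sub_ne_zero z a
    have hb := Hp_sub_ne_zero z b
    have : poissonKernel z (a : P1Qp p) - poissonKernel z (b : P1Qp p) =
        ((z : ℂ_[p]) - algebraMap ℚ_[p] ℂ_[p] a)⁻¹ * ((z : ℂ_[p]) - algebraMap ℚ_[p] ℂ_[p] b)⁻¹ *
          algebraMap ℚ_[p] ℂ_[p] (a - b) := by
      change ((z : ℂ_[p]) - algebraMap ℚ_[p] ℂ_[p] a)⁻¹ -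
        ((z : ℂ_[p]) - algebraMap ℚ_[p] ℂ_[p] b)⁻¹ = _
      rw [map_sub]
      field_simp
      ring
    rw [this, norm_mul, norm_mul, norm_algebraMap', sq]
    exact mul_le_mul (mul_le_mul (norm_inv_sub_le hz a) (norm_inv_sub_le hz b) (norm_nonneg _)
      (by positivity)) hab (norm_nonneg _) (by positivity)

/-- The invertible rigid analytic function `z - a`, for `a ∈ ℚ_p`. -/
noncomputable def linearUnit (a : ℚ_[p]) : (RigidFun p)ˣ where
  val := ⟨fun z => (z : ℂ_[p]) - algebraMap ℚ_[p] ℂ_[p] a, fun n ε hε =>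
    ⟨Polynomial.X - Polynomial.C (algebraMap ℚ_[p] ℂ_[p] a), 1, fun z hz => by
      have h := extendZero_coe (fun z : Hp p => (z : ℂ_[p]) - algebraMap ℚ_[p] ℂ_[p] a)
        ⟨z, mem_Hp_of_mem_affinoid hz⟩
      simp only at h
      rw [h]
      simpa using hε.le⟩⟩
  inv := ⟨fun z => ((z : ℂ_[p]) - algebraMap ℚ_[p] ℂ_[p] a)⁻¹, fun n ε hε =>
    ⟨1, Polynomial.X - Polynomial.C (algebraMap ℚ_[p] ℂ_[p] a), fun z hz => by
      have h := extendZero_coe (fun z : Hp p => ((z : ℂ_[p]) - algebraMap ℚ_[p] ℂ_[p] a)⁻¹)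
        ⟨z, mem_Hp_of_mem_affinoid hz⟩
      have h0 := Hp_sub_ne_zero ⟨z, mem_Hp_of_mem_affinoid hz⟩ a
      simp only at h h0
      rw [h]
      simpa [h0] using hε.le⟩⟩
  val_inv := rigidFun_ext fun z => mul_inv_cancel₀ (Hp_sub_ne_zero z a)
  inv_val := rigidFun_ext fun z => inv_mul_cancel₀ (Hp_sub_ne_zero z a)

theorem unitEval_linearUnit (z : Hp p) (a : ℚ_[p]) :
    (unitEval z (linearUnit a) : ℂ_[p]) = z - algebraMap ℚ_[p] ℂ_[p] a := rfl

/-- The constant invertible rigid analytic functions. -/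
noncomputable def constUnit : ℂ_[p]ˣ →* (RigidFun p)ˣ :=
  Units.map (algebraMap ℂ_[p] (RigidFun p) : ℂ_[p] →* RigidFun p)

theorem unitEval_constUnit (z : Hp p) (c : ℂ_[p]ˣ) : unitEval z (constUnit c) = c := rfl

theorem dlogUnits_constUnit (c : ℂ_[p]ˣ) : dlogUnits (constUnit c) = 1 := by
  change Multiplicative.ofAdd (_ * rigidDeriv (algebraMap ℂ_[p] (RigidFun p) _)) = 1
  rw [rigidDeriv_algebraMap, mul_zero, ofAdd_zero]

theorem dlogUnits_linearUnit (a : ℚ_[p]) (z : Hp p) :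
    (dlogUnits (linearUnit a)).toAdd.1 z = ((z : ℂ_[p]) - algebraMap ℚ_[p] ℂ_[p] a)⁻¹ := by
  change ((z : ℂ_[p]) - algebraMap ℚ_[p] ℂ_[p] a)⁻¹ *
    deriv (extendZero (linearUnit a : RigidFun p).1) z = _
  have h : extendZero (linearUnit a : RigidFun p).1 =ᶠ[𝓝 (z : ℂ_[p])]
      fun w => w - algebraMap ℚ_[p] ℂ_[p] a := by
    filter_upwards [Hp_mem_nhds z] with w hw
    exact extendZero_coe _ ⟨w, hw⟩
  rw [h.deriv_eq, deriv_sub_const, deriv_id'', mul_one]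

/-- The multiplicative kernel `t ↦ (z - t) / (z₀ - t)`, with value `1` at `t = ∞`. -/
noncomputable def unitKernel (z₀ : Hp p) : P1Qp p → (RigidFun p)ˣ := fun t =>
  t.elim 1 fun a => linearUnit a / constUnit (unitEval z₀ (linearUnit a))

theorem dlogUnits_unitKernel (z₀ z : Hp p) (t : P1Qp p) :
    (dlogUnits (unitKernel z₀ t)).toAdd.1 z = poissonKernel z t := by
  induction t using OnePoint.rec with
  | infty =>
    change (dlogUnits (1 : (RigidFun p)ˣ)).toAdd.1 z = 0
    rw [map_one]
    rfl
  | coe a =>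
    change (dlogUnits (linearUnit a / constUnit (unitEval z₀ (linearUnit a)))).toAdd.1 z = _
    rw [map_div, dlogUnits_constUnit, div_one]
    exact dlogUnits_linearUnit a z

theorem unitEval_unitKernel (z₀ z : Hp p) (a : ℚ_[p]) :
    (unitEval z (unitKernel z₀ a) : ℂ_[p]) = ((z : ℂ_[p]) - algebraMap ℚ_[p] ℂ_[p] a) /
      ((z₀ : ℂ_[p]) - algebraMap ℚ_[p] ℂ_[p] a) := by
  change (unitEval z (linearUnit a / constUnit (unitEval z₀ (linearUnit a))) : ℂ_[p]) = _
  rw [map_div, unitEval_constUnit, Units.val_div_eq_div_val, unitEval_linearUnit,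
    unitEval_linearUnit]

theorem norm_sub_le_of_mem_affinoid {n : ℕ} {z w : ℂ_[p]} (hz : z ∈ affinoid p n)
    (hw : w ∈ affinoid p n) : ‖z - w‖ ≤ (p : ℝ) ^ n :=
  ultra_sub_le (b := 0) (by simpa using hz.1) (by simpa using hw.1)

/-- The quotient is a cross-ratio, and it differs from `1` by `(z - z₀) (a - b) / ((z₀ - a) (z -
b))`. The three factors other than `a - b` are each bounded by `p ^ n`, whence the cube. -/
theorem unitKernel_div_mem {n m : ℕ} (hnm : n ≤ m) (z₀ z : Hp p)
    (hz₀ : (z₀ : ℂ_[p]) ∈ affinoid p n) (hz : (z : ℂ_[p]) ∈ affinoid p n) {δ : ℝ} (h0 : 0 ≤ δ)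
    (h1 : δ < 1) (hδ : ((p : ℝ) ^ n) ^ 3 * ((p : ℝ) ^ m)⁻¹ ≤ δ) {s t : P1Qp p}
    (hst : IsNear m s t) :
    unitEval z (unitKernel z₀ s) / unitEval z (unitKernel z₀ t) ∈ unitBall p δ h0 h1 := by
  have hpos : (0 : ℝ) < (p : ℝ) ^ m := pow_pos (prime_cast_pos p) m
  have hone : (1 : ℝ) ≤ (p : ℝ) ^ n := one_le_pow₀ (one_lt_prime_cast p).le
  rcases hst with ⟨hs, ht⟩ | ⟨a, b, rfl, rfl, hab⟩
  · have key : ∀ s : P1Qp p, IsFar m s → unitEval z (unitKernel z₀ s) ∈ unitBall p δ h0 h1 := by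
      intro s hs
      induction s using OnePoint.rec with
      | infty =>
        change unitEval z 1 ∈ _
        rw [map_one]
        exact one_mem _
      | coe a =>
        have ha := Hp_sub_ne_zero z₀ a
        rw [mem_unitBall, unitEval_unitKernel]
        have : ((z : ℂ_[p]) - algebraMap ℚ_[p] ℂ_[p] a) /
            ((z₀ : ℂ_[p]) - algebraMap ℚ_[p] ℂ_[p] a) - 1 =
            (z - z₀) * ((z₀ : ℂ_[p]) - algebraMap ℚ_[p] ℂ_[p] a)⁻¹ := by
          field_simp
          ring
        rw [this, norm_mul]
        refine (mul_le_mul (norm_sub_le_of_mem_affinoid hz hz₀)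
          (norm_inv_sub_le_of_isFar hnm hz₀ hs) (norm_nonneg _) (by positivity)).trans
          (le_trans ?_ hδ)
        exact mul_le_mul_of_nonneg_right (le_self_pow₀ hone (by norm_num)) (inv_pos.2 hpos).le
    exact div_mem (key s hs) (key t ht)
  · have ha := Hp_sub_ne_zero z₀ a
    have hb := Hp_sub_ne_zero z₀ b
    have ha' := Hp_sub_ne_zero z a
    have hb' := Hp_sub_ne_zero z b
    rw [mem_unitBall, Units.val_div_eq_div_val, unitEval_unitKernel, unitEval_unitKernel]
    have : ((z : ℂ_[p]) - algebraMap ℚ_[p] ℂ_[p] a) / ((z₀ : ℂ_[p]) - algebraMap ℚ_[p] ℂ_[p] a) /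
        (((z : ℂ_[p]) - algebraMap ℚ_[p] ℂ_[p] b) / ((z₀ : ℂ_[p]) - algebraMap ℚ_[p] ℂ_[p] b)) - 1 =
        (z - z₀) * ((z₀ : ℂ_[p]) - algebraMap ℚ_[p] ℂ_[p] a)⁻¹ *
          ((z : ℂ_[p]) - algebraMap ℚ_[p] ℂ_[p] b)⁻¹ * algebraMap ℚ_[p] ℂ_[p] (a - b) := by
      rw [map_sub]
      field_simp
      ring
    rw [this, norm_mul, norm_mul, norm_mul, norm_algebraMap']
    refine le_trans ?_ hδ
    rw [pow_succ, sq]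
    exact mul_le_mul (mul_le_mul (mul_le_mul (norm_sub_le_of_mem_affinoid hz hz₀)
      (norm_inv_sub_le hz₀ a) (norm_nonneg _) (by positivity)) (norm_inv_sub_le hz b)
      (norm_nonneg _) (by positivity)) hab (norm_nonneg _) (by positivity)

theorem affinoid_mono {m n : ℕ} (h : m ≤ n) : affinoid p m ⊆ affinoid p n := fun _ hz =>
  have hle := pow_le_pow_right₀ (one_lt_prime_cast p).le h
  ⟨hz.1.trans hle, fun a => (inv_anti₀ (pow_pos (prime_cast_pos p) m) hle).trans (hz.2 a)⟩

theorem exists_level_le (c : ℝ) {ε : ℝ} (hε : 0 < ε) (n : ℕ) :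
    ∃ m, n ≤ m ∧ c * ((p : ℝ) ^ m)⁻¹ ≤ ε := by
  obtain ⟨m, hm⟩ := pow_unbounded_of_one_lt (c / ε) (one_lt_prime_cast p)
  refine ⟨max n m, le_max_left _ _, ?_⟩
  have hpos : (0 : ℝ) < (p : ℝ) ^ (max n m) := pow_pos (prime_cast_pos p) _
  rw [mul_inv_le_iff₀ hpos, mul_comm, ← div_le_iff₀ hε]
  exact hm.le.trans (pow_le_pow_right₀ (one_lt_prime_cast p).le (le_max_right _ _))

/-- The Poisson transform of an integral valued measure is the logarithmic derivative of an
invertible rigid analytic function. -/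
theorem exists_unit_hasIntegral (ν : BoundaryMeasure p ℤ) :
    ∃ E : (RigidFun p)ˣ, ∀ z : Hp p,
      HasIntegral ν (poissonKernel z) ((dlogUnits E).toAdd.1 z) := by
  -- A base point `z₀` is needed to normalise the kernel; without one the claim is vacuous.
  by_cases hne : Nonempty (Hp p)
  swap
  · exact ⟨1, fun z => absurd ⟨z⟩ hne⟩
  obtain ⟨z₀⟩ := hne
  obtain ⟨n₀, hn₀⟩ := exists_mem_affinoid z₀.2
  obtain ⟨C, hanti, hC⟩ := exists_fine_sequence p
  obtain ⟨pt, hpt⟩ : ∃ pt : Clopens (P1Qp p) → P1Qp p, ∀ U, U ≠ ⊥ → pt U ∈ U := by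
    have : ∀ U : Clopens (P1Qp p), ∃ t, U ≠ ⊥ → t ∈ U := fun U => by
      by_cases hU : U = ⊥
      · exact ⟨OnePoint.infty, fun h => absurd hU h⟩
      · obtain ⟨t, ht⟩ := clopens_nonempty hU
        exact ⟨t, fun _ => ht⟩
    choose pt hpt using this
    exact ⟨pt, hpt⟩
  have hpt' : ∀ m, ∀ U ∈ (C m).parts, pt U ∈ U := fun m U hU => hpt U ((C m).ne_bot hU)
  -- The Riemann products along a refining sequence; their logarithmic derivatives are the Riemann
  -- sums of the Poisson kernel, because `z₀` enters only through constants.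
  set F : ℕ → (RigidFun p)ˣ := fun m => riemannProd ν (C m) (unitKernel z₀) pt with hF
  have hdlog : ∀ m z, (dlogUnits (F m)).toAdd.1 z =
      ∑ U ∈ (C m).parts, (ν.toFun U : ℂ_[p]) * poissonKernel z (pt U) := by
    intro m z
    have h1 : (dlogUnits (F m)).toAdd =
        ∑ U ∈ (C m).parts, ν.toFun U • (dlogUnits (unitKernel z₀ (pt U))).toAdd := by
      simp only [hF, riemannProd, map_prod, toAdd_prod]
      refine Finset.sum_congr rfl fun U _ => ?_
      rw [map_zpow, toAdd_zpow]
    have h2 : ∀ (s : Finset (Clopens (P1Qp p))) (f : Clopens (P1Qp p) → RigidFun p),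
        (∑ U ∈ s, f U).1 z = ∑ U ∈ s, (f U).1 z := by
      intro s f
      exact map_sum ((Pi.evalAddMonoidHom (fun _ : Hp p => ℂ_[p]) z).comp
        ((RigidFun p).val : RigidFun p →+ (Hp p → ℂ_[p]))) f s
    rw [h1, h2]
    refine Finset.sum_congr rfl fun U _ => ?_
    rw [← dlogUnits_unitKernel z₀, ← zsmul_eq_mul]
    rfl
  have hcauchy : IsUnitCauchy F := by
    intro n ε hε
    -- The units within `δ` of `1` are used as a subgroup, which `unitBall` provides for `δ < 1`;
    -- hence the cap.
    set δ : ℝ := min ε (1 / 2) with hδ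
    have hδ0 : 0 < δ := lt_min hε (by norm_num)
    have hδ1 : δ < 1 := (min_le_right _ _).trans_lt (by norm_num)
    obtain ⟨M, hnM, hM⟩ := exists_level_le (p := p) (((p : ℝ) ^ (max n₀ n)) ^ 3) hδ0 (max n₀ n)
    refine ⟨M, fun m hm k hk z hz => ?_⟩
    have key : ∀ m ≥ M, unitEval z (F m) / unitEval z (F M) ∈ unitBall p δ hδ0.le hδ1 := by
      intro m hm
      have h1 : ∀ k, unitEval z (F k) =
          riemannProd ν (C k) (fun t => unitEval z (unitKernel z₀ t)) pt := by
        intro k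
        simp only [hF, riemannProd, map_prod]
        exact Finset.prod_congr rfl fun U _ => map_zpow _ _ _
      rw [h1, h1]
      refine riemannProd_div_mem _ ν (hanti hm) _ (fun V hV x hx y hy => ?_) pt pt (hpt' M) (hpt' m)
      exact unitKernel_div_mem hnM z₀ z (affinoid_mono (le_max_left _ _) hn₀)
        (affinoid_mono (le_max_right _ _) hz) hδ0.le hδ1 hM (hC M V hV x hx y hy)
    have h2 := div_mem (key m hm) (key k hk)
    rw [div_div_div_cancel_right, ← map_div, mem_unitBall] at h2
    exact h2.trans (min_le_left _ _)
  -- Every refinement of `C M`, with any marked points, is covered. This serves twice: for the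
  -- Cauchy property of the sequence and for `HasIntegral`, which quantifies over all fine
  -- partitions.
  have hclose : ∀ n M : ℕ, n ≤ M → ∀ z : Hp p, (z : ℂ_[p]) ∈ affinoid p n →
      ∀ D : BoundaryPartition p, D ≤ C M →
      ∀ t : Clopens (P1Qp p) → P1Qp p, (∀ U ∈ D.parts, t U ∈ U) →
      ‖∑ U ∈ D.parts, (ν.toFun U : ℂ_[p]) * poissonKernel z (t U) -
        (dlogUnits (F M)).toAdd.1 z‖ ≤ ((p : ℝ) ^ n) ^ 2 * ((p : ℝ) ^ M)⁻¹ := by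
    intro n M hnM z hz D hD t ht
    have hpos : (0 : ℝ) < (p : ℝ) ^ M := pow_pos (prime_cast_pos p) M
    rw [hdlog]
    exact norm_riemannSum_sub_le ν hD _ (by positivity) (fun V hV x hx y hy =>
      norm_poissonKernel_sub_le hnM z hz (hC M V hV x hx y hy)) pt t (hpt' M) ht
  obtain ⟨H, hH⟩ := exists_rigidTendsto (F := fun m => (dlogUnits (F m)).toAdd) (by
    intro n ε hε
    obtain ⟨M, hnM, hM⟩ := exists_level_le (p := p) (((p : ℝ) ^ n) ^ 2) hε n
    refine ⟨M, fun m hm z hz => ?_⟩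
    rw [hdlog m]
    exact (hclose n M hnM z hz (C m) (hanti hm) pt (hpt' m)).trans hM)
  obtain ⟨E, rfl⟩ := hcauchy.exists_dlogUnits_eq hH
  refine ⟨E, fun z ε hε => ?_⟩
  obtain ⟨n, hn⟩ := exists_mem_affinoid z.2
  obtain ⟨N, hN⟩ := hH n (ε / 2) (half_pos hε)
  obtain ⟨M, hnM, hM⟩ := exists_level_le (p := p) (((p : ℝ) ^ n) ^ 2) (half_pos hε) (max n N)
  refine ⟨C M, fun D hD t ht => lt_of_le_of_lt (ultra_sub_le (r := ε / 2)
    (b := (dlogUnits (F M)).toAdd.1 z) ?_ ?_) (half_lt_self hε)⟩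
  · exact (hclose n M ((le_max_left _ _).trans hnM) z hn D hD t ht).trans hM
  · exact hN M ((le_max_right _ _).trans hnM) z hn

end RiemannSums

end MockHilbert


namespace MockHilbert

open Filter Topology TopologicalSpace

/-! ### From integral measures to measures with values in `Λ`. -/

section PoissonTransform

variable {p : ℕ} [hp : Fact p.Prime]

theorem HasIntegral.unique {ν : BoundaryMeasure p ℤ} {g : P1Qp p → ℂ_[p]} {I J : ℂ_[p]}
    (hI : HasIntegral ν g I) (hJ : HasIntegral ν g J) : I = J := by
  classical
  by_contra hne
  -- The tolerance is `‖J - I‖` itself: in an ultrametric space two errors smaller than it cannot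
  -- account for the difference.
  have hpos : 0 < ‖J - I‖ := norm_pos_iff.2 (sub_ne_zero.2 (Ne.symm hne))
  obtain ⟨C, hC⟩ := hI _ hpos
  obtain ⟨D, hD⟩ := hJ _ hpos
  have h : ∀ U : Clopens (P1Qp p), ∃ t, U ∈ (C ⊓ D).parts → t ∈ U := fun U => by
    by_cases hU : U ∈ (C ⊓ D).parts
    · obtain ⟨t, ht⟩ := clopens_nonempty ((C ⊓ D).ne_bot hU)
      exact ⟨t, fun _ => ht⟩
    · exact ⟨OnePoint.infty, fun h => absurd h hU⟩
  choose t ht using h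
  have h1 := hC _ inf_le_left t ht
  have h2 := hD _ inf_le_right t ht
  have h3 := IsUltrametricDist.norm_add_le_max
    (∑ U ∈ (C ⊓ D).parts, (ν.toFun U : ℂ_[p]) * g (t U) - I)
    (-(∑ U ∈ (C ⊓ D).parts, (ν.toFun U : ℂ_[p]) * g (t U) - J))
  rw [norm_neg, ← sub_eq_add_neg, sub_sub_sub_cancel_left] at h3
  exact absurd (max_lt h1 h2) (not_lt.2 h3)

theorem HasIntegral.add {ν ν₁ ν₂ : BoundaryMeasure p ℤ} {g : P1Qp p → ℂ_[p]} {I J : ℂ_[p]}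
    (h1 : HasIntegral ν₁ g I) (h2 : HasIntegral ν₂ g J)
    (h : ∀ U, ν.toFun U = ν₁.toFun U + ν₂.toFun U) : HasIntegral ν g (I + J) := by
  classical
  intro ε hε
  obtain ⟨C, hC⟩ := h1 ε hε
  obtain ⟨D, hD⟩ := h2 ε hε
  refine ⟨C ⊓ D, fun E hE t ht => ?_⟩
  have h3 := hC E (hE.trans inf_le_left) t ht
  have h4 := hD E (hE.trans inf_le_right) t ht
  have h5 : ∑ U ∈ E.parts, (ν.toFun U : ℂ_[p]) * g (t U) - (I + J) =
      (∑ U ∈ E.parts, (ν₁.toFun U : ℂ_[p]) * g (t U) - I) +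
      (∑ U ∈ E.parts, (ν₂.toFun U : ℂ_[p]) * g (t U) - J) := by
    rw [sub_add_sub_comm, ← Finset.sum_add_distrib]
    congr 1
    refine Finset.sum_congr rfl fun U _ => ?_
    rw [h, Int.cast_add, add_mul]
  rw [h5]
  exact (IsUltrametricDist.norm_add_le_max _ _).trans_lt (max_lt h3 h4)

theorem HasIntegral.zsmul {ν ν₁ : BoundaryMeasure p ℤ} {g : P1Qp p → ℂ_[p]} {I : ℂ_[p]}
    (h1 : HasIntegral ν₁ g I) (c : ℤ) (h : ∀ U, ν.toFun U = c * ν₁.toFun U) :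
    HasIntegral ν g (c • I) := by
  intro ε hε
  obtain ⟨C, hC⟩ := h1 ε hε
  refine ⟨C, fun E hE t ht => lt_of_le_of_lt ?_ (hC E hE t ht)⟩
  have h5 : ∑ U ∈ E.parts, (ν.toFun U : ℂ_[p]) * g (t U) - c • I =
      (c : ℂ_[p]) * (∑ U ∈ E.parts, (ν₁.toFun U : ℂ_[p]) * g (t U) - I) := by
    rw [mul_sub, Finset.mul_sum, zsmul_eq_mul]
    congr 1
    refine Finset.sum_congr rfl fun U _ => ?_
    rw [h, Int.cast_mul, mul_assoc]
  rw [h5, norm_mul]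
  exact mul_le_of_le_one_left (norm_nonneg _) (IsUltrametricDist.norm_intCast_le_one _ _)

theorem hasIntegral_zero {ν : BoundaryMeasure p ℤ} (h : ∀ U, ν.toFun U = 0)
    (g : P1Qp p → ℂ_[p]) : HasIntegral ν g 0 := by
  intro ε hε
  obtain ⟨C, -⟩ := exists_isFine (p := p) 0
  exact ⟨C, fun E _ t _ => by simpa [h] using hε⟩

theorem hasIntegral_map_sum {M ι : Type*} [AddCommGroup M] (μ : BoundaryMeasure p M)
    {g : P1Qp p → ℂ_[p]} {φ : ι → M →+ ℤ} {I : ι → ℂ_[p]}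
    (h : ∀ i, HasIntegral (μ.map (φ i)) g (I i)) (c : ι → ℤ) (s : Finset ι) :
    HasIntegral (μ.map (∑ i ∈ s, c i • φ i)) g (∑ i ∈ s, c i • I i) := by
  classical
  induction s using Finset.induction_on with
  | empty => exact hasIntegral_zero (fun U => rfl) g
  | insert i s hi ih =>
    rw [Finset.sum_insert hi, Finset.sum_insert hi]
    have h1 : HasIntegral (μ.map (c i • φ i)) g (c i • I i) := (h i).zsmul (c i) fun U => rfl
    exact h1.add ih fun U => rfl

theorem coordinate_tmul {Λ : AddSubgroup ℂ} (φ : Λ →+ ℤ) (h : RigidDiff p) (x : Λ) :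
    coordinate φ (h ⊗ₜ[ℤ] x) = φ x • h := by
  change TensorProduct.rid ℤ (RigidDiff p) (h ⊗ₜ[ℤ] φ x) = _
  exact TensorProduct.rid_tmul _ _

theorem eq_sum_coordinate {Λ : AddSubgroup ℂ} {ι : Type*} [Fintype ι] (b : Module.Basis ι ℤ Λ)
    (ω : TensorProduct ℤ (RigidDiff p) Λ) :
    ω = ∑ i, coordinate (b.coord i).toAddMonoidHom ω ⊗ₜ[ℤ] b i := by
  induction ω using TensorProduct.induction_on with
  | zero => simp
  | tmul h x =>
    conv_lhs => rw [← b.sum_repr x, TensorProduct.tmul_sum]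
    refine Finset.sum_congr rfl fun i _ => ?_
    rw [coordinate_tmul, TensorProduct.smul_tmul]
    rfl
  | add x y hx hy =>
    conv_lhs => rw [hx, hy, ← Finset.sum_add_distrib]
    refine Finset.sum_congr rfl fun i _ => ?_
    rw [map_add, TensorProduct.add_tmul]

/-- The Poisson transform of a measure with values in a finitely generated subgroup of `ℂ` exists,
is unique, and is a logarithmic derivative. -/
theorem poissonTransform_existsUnique {Λ : AddSubgroup ℂ} (hfg : Λ.FG) (μ : BoundaryMeasure p Λ) :
    (∃! ω : TensorProduct ℤ (RigidDiff p) Λ, IsPoissonTransform μ ω) ∧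
      ∀ ω : TensorProduct ℤ (RigidDiff p) Λ, IsPoissonTransform μ ω →
        ∃ F : TensorProduct ℤ (Additive (UnitsModConst p)) Λ, dlogTensor Λ F = ω := by
  have hfin : Module.Finite ℤ Λ :=
    Module.Finite.iff_addGroup_fg.2 ((AddGroup.fg_iff_addSubgroup_fg Λ).2 hfg)
  -- A subgroup of `ℂ` is torsion-free, so finite generation over `ℤ` gives freeness.
  have hfree : Module.Free ℤ Λ := inferInstance
  set b := Module.Free.chooseBasis ℤ Λ
  choose E hE using fun i => exists_unit_hasIntegral (μ.map (b.coord i).toAddMonoidHom)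
  set F : TensorProduct ℤ (Additive (UnitsModConst p)) Λ :=
    ∑ i, Additive.ofMul (QuotientGroup.mk (E i) : UnitsModConst p) ⊗ₜ[ℤ] b i with hF
  have hdlog : dlogTensor Λ F = ∑ i, (dlogUnits (E i)).toAdd ⊗ₜ[ℤ] b i := by
    rw [hF, map_sum]
    rfl
  have hω : IsPoissonTransform μ (dlogTensor Λ F) := by
    intro φ z
    have h1 := hasIntegral_map_sum μ (fun i => hE i z) (fun i => φ (b i)) Finset.univ
    -- Every `φ` is an integral combination of the coordinates of the basis, for which the integrals
    -- are known.
    have h2 : ∑ i, φ (b i) • (b.coord i).toAddMonoidHom = φ := by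
      ext x
      conv_rhs => rw [← b.sum_repr x, map_sum]
      rw [AddMonoidHom.finsetSum_apply]
      refine Finset.sum_congr rfl fun i _ => ?_
      rw [map_zsmul, smul_eq_mul, mul_comm]
      rfl
    have h3 : (coordinate φ (dlogTensor Λ F)).1 z = ∑ i, φ (b i) • (dlogUnits (E i)).toAdd.1 z := by
      rw [hdlog, map_sum]
      simp only [coordinate_tmul]
      exact map_sum ((Pi.evalAddMonoidHom (fun _ : Hp p => ℂ_[p]) z).comp
        ((RigidFun p).val : RigidFun p →+ (Hp p → ℂ_[p]))) _ _
    rw [h2] at h1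
    rw [h3]
    exact h1
  have huniq : ∀ ω, IsPoissonTransform μ ω → ω = dlogTensor Λ F := by
    intro ω h
    rw [eq_sum_coordinate b ω, eq_sum_coordinate b (dlogTensor Λ F)]
    refine Finset.sum_congr rfl fun i _ => ?_
    congr 1
    exact rigidFun_ext fun z => (h _ z).unique (hω _ z)
  exact ⟨⟨_, hω, huniq⟩, fun ω h => ⟨F, (huniq ω h).symm⟩⟩

end PoissonTransform

end MockHilbert


namespace MockHilbert

open Filter Topology UpperHalfPlane MatrixGroups

/-! ### Primitives on the upper half plane and their limits at `i∞`. -/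

section Primitives

/-- A holomorphic function on the upper half plane has a primitive. -/
theorem exists_primitive_upperHalfPlane {h : ℂ → ℂ}
    (hh : DifferentiableOn ℂ h {z | 0 < z.im}) :
    ∃ G : ℂ → ℂ, ∀ z : ℂ, 0 < z.im → HasDerivAt G (h z) z := by
  -- The Cayley transform `w ↦ i (1 + w) / (1 - w)` carries the unit disc to the upper half plane.
  -- On the disc holomorphic functions have primitives, so the form `h dz` is pulled back and
  -- integrated there.
  have hφ : ∀ w ∈ Metric.ball (0 : ℂ) 1, (1 - w) ≠ 0 ∧
      0 < (Complex.I * (1 + w) / (1 - w)).im := by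
    intro w hw
    rw [mem_ball_zero_iff] at hw
    have h1 : (1 - w) ≠ 0 := by
      intro h0
      rw [sub_eq_zero] at h0
      rw [← h0, norm_one] at hw
      exact lt_irrefl _ hw
    refine ⟨h1, ?_⟩
    have h2 : 0 < Complex.normSq (1 - w) := Complex.normSq_pos.2 h1
    have h3 : Complex.normSq w < 1 := by
      rw [Complex.normSq_eq_norm_sq]
      exact pow_lt_one₀ (norm_nonneg _) hw (by norm_num)
    have h4 : (Complex.I * (1 + w) / (1 - w)).im = (1 - Complex.normSq w) /
        Complex.normSq (1 - w) := by
      rw [Complex.div_im, Complex.normSq_apply w]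
      simp
      field_simp
      ring
    rw [h4]
    exact div_pos (by linarith) h2
  have hdφ : ∀ w ∈ Metric.ball (0 : ℂ) 1,
      HasDerivAt (fun w : ℂ => Complex.I * (1 + w) / (1 - w)) (2 * Complex.I / (1 - w) ^ 2) w := by
    intro w hw
    have h1 := (hφ w hw).1
    have h2 := (((hasDerivAt_id w).const_add 1).const_mul Complex.I).div
      ((hasDerivAt_id w).const_sub 1) h1
    refine h2.congr_deriv ?_
    simp only [id]
    congr 1
    ring
  obtain ⟨H, hH⟩ := DifferentiableOn.isExactOn_ball (c := (0 : ℂ)) (r := 1)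
    (f := fun w => h (Complex.I * (1 + w) / (1 - w)) * (2 * Complex.I / (1 - w) ^ 2)) (by
      intro w hw
      refine DifferentiableAt.differentiableWithinAt (DifferentiableAt.mul ?_ ?_)
      · have hopen : IsOpen {z : ℂ | 0 < z.im} := isOpen_lt continuous_const Complex.continuous_im
        exact (hh.differentiableAt (hopen.mem_nhds (hφ w hw).2)).comp w
          (hdφ w hw).differentiableAt
      · have h1 := (hφ w hw).1
        fun_prop (disch := positivity))
  refine ⟨fun z => H ((z - Complex.I) / (z + Complex.I)), fun z hz => ?_⟩
  have h1 : z + Complex.I ≠ 0 := by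
    intro h0
    have := congrArg Complex.im h0
    simp at this
    linarith
  have hw : (z - Complex.I) / (z + Complex.I) ∈ Metric.ball (0 : ℂ) 1 := by
    rw [mem_ball_zero_iff, norm_div, div_lt_one (norm_pos_iff.2 h1),
      ← sq_lt_sq₀ (norm_nonneg _) (norm_nonneg _), ← Complex.normSq_eq_norm_sq,
      ← Complex.normSq_eq_norm_sq, Complex.normSq_apply, Complex.normSq_apply]
    simp
    nlinarith
  have h2 : HasDerivAt (fun z : ℂ => (z - Complex.I) / (z + Complex.I))
      (2 * Complex.I / (z + Complex.I) ^ 2) z := by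
    have := ((hasDerivAt_id z).sub_const Complex.I).div ((hasDerivAt_id z).add_const Complex.I) h1
    refine this.congr_deriv ?_
    simp only [id]
    congr 1
    ring
  refine ((hH _ hw).comp z h2).congr_deriv ?_
  have h3 : 1 - (z - Complex.I) / (z + Complex.I) = 2 * Complex.I / (z + Complex.I) := by
    field_simp
    ring
  have h4 : Complex.I * (1 + (z - Complex.I) / (z + Complex.I)) /
      (1 - (z - Complex.I) / (z + Complex.I)) = z := by
    rw [h3]
    field_simp
    ring
  have hI := Complex.I_ne_zero
  simp only [h4]
  rw [h3]
  field_simp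

/-- A primitive of an exponentially decreasing function has a limit at `i∞`. -/
theorem exists_tendsto_atImInfty {g h : ℂ → ℂ}
    (hg : ∀ z : ℂ, 0 < z.im → HasDerivAt g (h z) z) {c : ℝ} (hc : 0 < c)
    (hh : (fun τ : ℍ => h τ) =O[atImInfty] fun τ : ℍ => Real.exp (-c * τ.im)) :
    ∃ L, Tendsto (fun τ : ℍ => g τ) atImInfty (𝓝 L) := by
  obtain ⟨K, hK0, hK⟩ := hh.exists_pos
  obtain ⟨A, hA⟩ := (atImInfty_mem _).1 hK.bound
  set A' : ℝ := max A 1 with hA'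
  have hA1 : ∀ z : ℂ, A' ≤ z.im → 0 < z.im := fun z hz =>
    zero_lt_one.trans_le ((le_max_right _ _).trans hz)
  have hbound : ∀ z : ℂ, A' ≤ z.im → ‖h z‖ ≤ K * Real.exp (-c * z.im) := by
    intro z hz
    have := hA ⟨z, hA1 z hz⟩ ((le_max_left _ _).trans hz)
    simpa [Real.norm_eq_abs, abs_of_pos (Real.exp_pos _)] using this
  have hvert : ∀ x y t : ℝ, A' ≤ y → y ≤ t →
      ‖g (x + t * Complex.I) - g (x + y * Complex.I)‖ ≤ K / c * Real.exp (-c * y) := by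
    intro x y t hy hyt
    have hd : ∀ s : ℝ, A' ≤ s → HasDerivAt (fun s : ℝ => g (x + s * Complex.I))
        (h (x + s * Complex.I) * Complex.I) s := by
      intro s hs
      have h1 : HasDerivAt (fun s : ℝ => (x : ℂ) + s * Complex.I) Complex.I s := by
        have := ((Complex.ofRealCLM.hasDerivAt (x := s)).mul_const Complex.I).const_add (x : ℂ)
        simpa using this
      exact (hg _ (hA1 _ (by simpa using hs))).comp s h1
    -- The comparison function is the integral of `K exp (-c s)` starting from `y`.
    have key := image_norm_le_of_norm_deriv_right_le_deriv_boundary (a := y) (b := t)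
      (f := fun s : ℝ => g (x + s * Complex.I) - g (x + y * Complex.I))
      (f' := fun s : ℝ => h (x + s * Complex.I) * Complex.I)
      (B := fun s : ℝ => K / c * (Real.exp (-c * y) - Real.exp (-c * s)))
      (B' := fun s : ℝ => K * Real.exp (-c * s))
      (fun s hs => ((hd s (hy.trans hs.1)).sub_const _).continuousAt.continuousWithinAt)
      (fun s hs => ((hd s (hy.trans hs.1)).sub_const _).hasDerivWithinAt)
      (by simp)
      (fun s => by
        have h1 : HasDerivAt (fun s : ℝ => -c * s) (-c) s := by
          simpa using (hasDerivAt_id s).const_mul (-c)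
        refine ((h1.exp.const_sub (Real.exp (-c * y))).const_mul (K / c)).congr_deriv ?_
        field_simp)
      (fun s hs => by
        rw [norm_mul, Complex.norm_I, mul_one]
        have := hbound (x + s * Complex.I) (by simpa using hy.trans hs.1)
        simpa using this)
      (Set.right_mem_Icc.2 hyt)
    refine key.trans (mul_le_mul_of_nonneg_left ?_ (by positivity))
    linarith [Real.exp_pos (-c * t)]
  -- Comparing horizontally shows that all vertical lines have the same limit.
  have hhor : ∀ x y : ℝ, A' ≤ y →
      ‖g (x + y * Complex.I) - g ((0 : ℝ) + y * Complex.I)‖ ≤ K * Real.exp (-c * y) * |x| := by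
    intro x y hy
    have hconv : Convex ℝ {z : ℂ | y ≤ z.im} := convex_halfSpace_im_ge y
    have := Convex.norm_image_sub_le_of_norm_hasDerivWithin_le (s := {z : ℂ | y ≤ z.im}) (f := g) (f' := h)
      (C := K * Real.exp (-c * y)) (x := (0 : ℝ) + y * Complex.I) (y := x + y * Complex.I)
      (fun z hz => (hg z (hA1 z (hy.trans hz))).hasDerivWithinAt)
      (fun z hz => (hbound z (hy.trans hz)).trans (mul_le_mul_of_nonneg_left
        (Real.exp_le_exp.2 (by have : y ≤ z.im := hz; nlinarith)) hK0.le))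
      hconv (show y ≤ ((0 : ℝ) + y * Complex.I : ℂ).im by simp)
      (show y ≤ ((x : ℂ) + y * Complex.I).im by simp)
    simpa using this
  have hexp : Tendsto (fun y : ℝ => Real.exp (-c * y)) atTop (𝓝 0) := by
    refine Real.tendsto_exp_atBot.comp ?_
    exact tendsto_id.const_mul_atTop_of_neg (neg_neg_of_pos hc)
  have hcauchy : ∃ L, Tendsto (fun t : ℝ => g ((0 : ℝ) + t * Complex.I)) atTop (𝓝 L) := by
    refine CompleteSpace.complete (Metric.cauchy_iff.2 ⟨inferInstance, fun ε hε => ?_⟩)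
    have h1 : Tendsto (fun y : ℝ => K / c * Real.exp (-c * y)) atTop (𝓝 0) := by
      simpa using hexp.const_mul (K / c)
    obtain ⟨y, hy, hyA⟩ := ((h1.eventually (gt_mem_nhds (half_pos hε))).and
      (eventually_ge_atTop A')).exists
    refine ⟨_, image_mem_map (Ici_mem_atTop y), ?_⟩
    rintro _ ⟨s, hs, rfl⟩ _ ⟨t, ht, rfl⟩
    have h2 := hvert 0 y s hyA hs
    have h3 := hvert 0 y t hyA ht
    have h4 := dist_triangle_right (g ((0 : ℝ) + s * Complex.I)) (g ((0 : ℝ) + t * Complex.I))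
      (g ((0 : ℝ) + y * Complex.I))
    rw [dist_eq_norm, dist_eq_norm, dist_eq_norm] at h4
    rw [dist_eq_norm]
    linarith
  obtain ⟨L, hL⟩ := hcauchy
  have hLx : ∀ x : ℝ, Tendsto (fun t : ℝ => g (x + t * Complex.I)) atTop (𝓝 L) := by
    intro x
    refine tendsto_of_tendsto_of_dist hL ?_
    refine squeeze_zero' (Eventually.of_forall fun _ => dist_nonneg) ?_
      (by simpa using (hexp.const_mul K).mul_const |x|)
    filter_upwards [eventually_ge_atTop A'] with t ht
    rw [dist_comm, dist_eq_norm]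
    simpa using hhor x t ht
  refine ⟨L, ?_⟩
  -- Letting `t → ∞` in `hvert` gives a bound that does not involve the real part, which is what
  -- convergence along `atImInfty` requires.
  have hfin : ∀ τ : ℍ, A' ≤ τ.im → ‖g τ - L‖ ≤ K / c * Real.exp (-c * τ.im) := by
    intro τ hτ
    have hτ' : (τ : ℂ) = (τ.re : ℂ) + (τ.im : ℂ) * Complex.I := (Complex.re_add_im τ).symm
    rw [hτ', norm_sub_rev]
    refine le_of_tendsto ((hLx τ.re).sub tendsto_const_nhds).norm ?_
    filter_upwards [eventually_ge_atTop τ.im] with t ht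
    exact hvert _ _ _ hτ ht
  rw [tendsto_iff_norm_sub_tendsto_zero]
  have him : Tendsto (fun τ : ℍ => τ.im) atImInfty atTop := tendsto_comap
  refine squeeze_zero' (Eventually.of_forall fun _ => norm_nonneg _) ?_
    (by simpa using (hexp.comp him).const_mul (K / c))
  filter_upwards [him.eventually (eventually_ge_atTop A')] with τ hτ
  simpa using hfin τ hτ

end Primitives

end MockHilbert


namespace MockHilbert

open Filter Topology UpperHalfPlane MatrixGroups ModularForm

/-! ### Primitives of cusp forms and their limits at the cusps. -/

section CuspForms

set_option linter.unusedSectionVars false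

variable {p : ℕ} [hp : Fact p.Prime]

/-- `α T^p α⁻¹` has lower left entry `-c² p`, so it lies in `Γ₀(p)`. Hence `f|α` is a cusp form of
period `p`, and its `q`-expansion gives the decay. -/
theorem slash_exp_decay (f : S2Gamma0 p) (α : SL(2, ℤ)) :
    ∃ c : ℝ, 0 < c ∧ (⇑f ∣[(2 : ℤ)] α) =O[atImInfty] fun τ : ℍ => Real.exp (-c * τ.im) := by
  have hpos : (0 : ℝ) < p := by exact_mod_cast hp.out.pos
  have hT : α * ModularGroup.T ^ p * α⁻¹ ∈ CongruenceSubgroup.Gamma0 p := by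
    rw [CongruenceSubgroup.Gamma0_mem]
    have h1 : (α * ModularGroup.T ^ p * α⁻¹) 1 0 = -(α 1 0) * (α 1 0) * p := by
      have h2 := ModularGroup.coe_T_zpow p
      rw [zpow_natCast] at h2
      simp [Matrix.SpecialLinearGroup.coe_mul, h2, Matrix.mul_apply, Fin.sum_univ_two,
        Matrix.SpecialLinearGroup.coe_inv, Matrix.adjugate_fin_two]
      ring
    rw [h1]
    push_cast
    rw [ZMod.natCast_self, mul_zero]
  have hper := CuspFormClass.exp_decay_atImInfty (h := (p : ℝ))
    (CuspForm.translate f (Matrix.SpecialLinearGroup.mapGL ℝ α)) hpos (by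
      rw [Subgroup.mem_strictPeriods_iff]
      rw [Subgroup.mem_pointwise_smul_iff_inv_smul_mem, ← map_inv, inv_inv,
        ConjAct.toConjAct_smul]
      refine Subgroup.mem_map.2 ⟨_, hT, ?_⟩
      rw [map_mul, map_mul, map_inv]
      congr 2
      ext i j
      have h2 := ModularGroup.coe_T_zpow p
      rw [zpow_natCast] at h2
      generalize ModularGroup.T ^ p = t at h2
      fin_cases i <;> fin_cases j <;>
        simp [h2, Matrix.GeneralLinearGroup.upperRightHom])
  refine ⟨2 * Real.pi / p, by positivity, ?_⟩
  change (⇑f ∣[(2 : ℤ)] α) =O[atImInfty] _ at hper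
  refine hper.congr_right fun τ => ?_
  congr 1
  ring

/-- Weight two: the derivative of `α` is `(cz + d)⁻²`, exactly the automorphy factor, so `G ∘ α` is
a primitive of `f|α`. -/
theorem hasDerivAt_comp_smul {G : ℂ → ℂ} {f : ℍ → ℂ}
    (hG : ∀ z : ℂ, 0 < z.im → HasDerivAt G (f (ofComplex z)) z) (α : SL(2, ℤ)) (z : ℂ)
    (hz : 0 < z.im) :
    HasDerivAt (fun w : ℂ => G (α • ofComplex w : ℍ)) ((f ∣[(2 : ℤ)] α) (ofComplex z)) z := by
  set τ : ℍ := ⟨z, hz⟩ with hτ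
  have hden : ((α 1 0 : ℤ) : ℂ) * z + ((α 1 1 : ℤ) : ℂ) ≠ 0 := by
    have := denom_ne_zero (α : GL (Fin 2) ℝ) τ
    simpa [denom] using this
  have hdet : ((α 0 0 : ℤ) : ℂ) * α 1 1 - (α 0 1 : ℤ) * (α 1 0 : ℤ) = 1 := by
    have := α.det_coe
    rw [Matrix.det_fin_two] at this
    exact_mod_cast this
  have hloc : (fun w : ℂ => G (α • ofComplex w : ℍ)) =ᶠ[𝓝 z] fun w =>
      G ((((α 0 0 : ℤ) : ℂ) * w + (α 0 1 : ℤ)) / (((α 1 0 : ℤ) : ℂ) * w + (α 1 1 : ℤ))) := by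
    filter_upwards [(isOpen_lt continuous_const Complex.continuous_im).mem_nhds hz] with w hw
    rw [coe_specialLinearGroup_apply, ofComplex_apply_of_im_pos hw]
    simp
  have hcoe : (((α 0 0 : ℤ) : ℂ) * z + (α 0 1 : ℤ)) / (((α 1 0 : ℤ) : ℂ) * z + (α 1 1 : ℤ)) =
      ((α • τ : ℍ) : ℂ) := by
    rw [coe_specialLinearGroup_apply]
    simp [hτ]
  refine HasDerivAt.congr_of_eventuallyEq ?_ hloc
  have h1 : HasDerivAt (fun w : ℂ => (((α 0 0 : ℤ) : ℂ) * w + (α 0 1 : ℤ)) /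
      (((α 1 0 : ℤ) : ℂ) * w + (α 1 1 : ℤ))) ((((α 1 0 : ℤ) : ℂ) * z + (α 1 1 : ℤ)) ^ (-2 : ℤ)) z := by
    have h2 := (((hasDerivAt_id z).const_mul ((α 0 0 : ℤ) : ℂ)).add_const ((α 0 1 : ℤ) : ℂ)).div
      (((hasDerivAt_id z).const_mul ((α 1 0 : ℤ) : ℂ)).add_const ((α 1 1 : ℤ) : ℂ)) hden
    refine h2.congr_deriv ?_
    rw [zpow_neg, ← one_div, id]
    congr 1
    linear_combination hdet
  have h3 := hG (α • τ : ℍ) (α • τ : ℍ).im_pos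
  rw [← hcoe] at h3
  refine (h3.comp z h1).congr_deriv ?_
  rw [hcoe, ofComplex_apply, SL_slash_apply, ofComplex_apply_of_im_pos hz]
  rfl

/-- A primitive of a cusp form. -/
theorem exists_primitive (f : S2Gamma0 p) :
    ∃ G : ℂ → ℂ, ∀ z : ℂ, 0 < z.im → HasDerivAt G (f (ofComplex z)) z :=
  exists_primitive_upperHalfPlane (UpperHalfPlane.mdifferentiable_iff.1 f.holo')

theorem exists_cusp_limit {f : S2Gamma0 p} {G : ℂ → ℂ}
    (hG : ∀ z : ℂ, 0 < z.im → HasDerivAt G (f (ofComplex z)) z) (α : SL(2, ℤ)) :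
    ∃ L, Tendsto (fun τ : ℍ => G (α • τ : ℍ)) atImInfty (𝓝 L) := by
  obtain ⟨c, hc, hdecay⟩ := slash_exp_decay f α
  obtain ⟨L, hL⟩ := exists_tendsto_atImInfty (g := fun w : ℂ => G (α • ofComplex w : ℍ))
    (h := fun z => (⇑f ∣[(2 : ℤ)] α) (ofComplex z)) (hasDerivAt_comp_smul hG α) hc
    (by simpa using hdecay)
  exact ⟨L, by simpa using hL⟩

/-- `G ∘ γ` and `G` are both primitives of `f|γ = f` on a convex set. -/
theorem primitive_smul_sub_const {f : S2Gamma0 p} {G : ℂ → ℂ}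
    (hG : ∀ z : ℂ, 0 < z.im → HasDerivAt G (f (ofComplex z)) z) {γ : SL(2, ℤ)}
    (hγ : γ ∈ CongruenceSubgroup.Gamma0 p) :
    ∃ κ : ℂ, ∀ τ : ℍ, G (γ • τ : ℍ) = G τ + κ := by
  have hslash : ⇑f ∣[(2 : ℤ)] γ = f :=
    f.slash_action_eq' _ (Subgroup.mem_map_of_mem _ hγ)
  have hd : ∀ z : ℂ, 0 < z.im →
      HasDerivAt (fun w : ℂ => G (γ • ofComplex w : ℍ) - G w) 0 z := by
    intro z hz
    refine ((hasDerivAt_comp_smul hG γ z hz).sub (hG z hz)).congr_deriv ?_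
    rw [hslash, sub_self]
  have hconv : Convex ℝ {z : ℂ | 0 < z.im} := convex_halfSpace_im_gt 0
  refine ⟨G (γ • I : ℍ) - G I, fun τ => ?_⟩
  have h := Convex.norm_image_sub_le_of_norm_hasDerivWithin_le (s := {z : ℂ | 0 < z.im})
    (f := fun w : ℂ => G (γ • ofComplex w : ℍ) - G w) (f' := fun _ => 0) (C := 0)
    (x := (I : ℍ)) (y := (τ : ℂ)) (fun z hz => (hd z hz).hasDerivWithinAt) (fun _ _ => by simp)
    hconv I.im_pos τ.im_pos
  rw [zero_mul, norm_le_zero_iff, sub_eq_zero, ofComplex_apply, ofComplex_apply] at h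
  linear_combination h

end CuspForms

end MockHilbert


namespace MockHilbert

open Filter Topology UpperHalfPlane MatrixGroups ModularForm

/-! ### Integrals between cusps and the `Γ₀(p)`-invariance of periods. -/

section CuspIntegrals

set_option linter.unusedSectionVars false

variable {p : ℕ} [hp : Fact p.Prime]

/-- The point `x + iy` of the upper half plane. -/
noncomputable def verticalPoint (x : ℝ) (y : ℝ) : ℍ := ofComplex ((x : ℂ) + (y : ℂ) * Complex.I)

theorem coe_verticalPoint (x : ℝ) {y : ℝ} (hy : 0 < y) :
    (verticalPoint x y : ℂ) = (x : ℂ) + (y : ℂ) * Complex.I := by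
  rw [verticalPoint, ofComplex_apply_of_im_pos (by simpa using hy)]

theorem im_verticalPoint (x : ℝ) {y : ℝ} (hy : 0 < y) : (verticalPoint x y).im = y := by
  rw [← coe_im, coe_verticalPoint x hy]
  simp

theorem tendsto_verticalPoint_atTop (x : ℝ) : Tendsto (verticalPoint x) atTop atImInfty := by
  refine tendsto_comap_iff.2 (tendsto_id.congr' ?_)
  filter_upwards [eventually_gt_atTop 0] with y hy
  exact (im_verticalPoint x hy).symm

/-- Descending vertically to the cusp `a / c = α ∞` is, after applying `α⁻¹`, an ascent to `i∞`. -/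
theorem im_inv_smul_verticalPoint (α : SL(2, ℤ)) (hc : (α 1 0 : ℤ) ≠ 0) {y : ℝ} (hy : 0 < y) :
    (α⁻¹ • verticalPoint ((α 0 0 : ℤ) / (α 1 0 : ℤ)) y).im = (((α 1 0 : ℤ) : ℝ) ^ 2 * y)⁻¹ := by
  have hc' : ((α 1 0 : ℤ) : ℝ) ≠ 0 := Int.cast_ne_zero.2 hc
  have hc'' : ((α 1 0 : ℤ) : ℂ) ≠ 0 := Int.cast_ne_zero.2 hc
  rw [ModularGroup.im_smul_eq_div_normSq, im_verticalPoint _ hy]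
  have h1 : denom ((α⁻¹ : SL(2, ℤ)) : GL (Fin 2) ℝ) (verticalPoint ((α 0 0 : ℤ) / (α 1 0 : ℤ)) y) =
      -((α 1 0 : ℤ) : ℂ) * (y * Complex.I) := by
    rw [ModularGroup.denom_apply, coe_verticalPoint _ hy, Matrix.SpecialLinearGroup.coe_inv,
      Matrix.adjugate_fin_two]
    simp
    field_simp
    ring
  rw [h1, map_mul, map_mul, Complex.normSq_neg, Complex.normSq_I, Complex.normSq_ofReal,
    Complex.normSq_intCast]
  field_simp

theorem tendsto_inv_smul_verticalPoint (α : SL(2, ℤ)) (hc : (α 1 0 : ℤ) ≠ 0) :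
    Tendsto (fun y => α⁻¹ • verticalPoint ((α 0 0 : ℤ) / (α 1 0 : ℤ)) y) (𝓝[>] 0) atImInfty := by
  have hc' : (0 : ℝ) < ((α 1 0 : ℤ) : ℝ) ^ 2 := by
    have : ((α 1 0 : ℤ) : ℝ) ≠ 0 := Int.cast_ne_zero.2 hc
    positivity
  have h1 : Tendsto (fun y : ℝ => (((α 1 0 : ℤ) : ℝ) ^ 2)⁻¹ * y⁻¹) (𝓝[>] 0) atTop :=
    tendsto_inv_nhdsGT_zero.const_mul_atTop (inv_pos.2 hc')
  refine tendsto_comap_iff.2 (h1.congr' ?_)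
  filter_upwards [self_mem_nhdsWithin] with y hy
  rw [Function.comp_apply, im_inv_smul_verticalPoint α hc hy, mul_inv]

/-- With `τ = α w` one has `|f(τ)| = c² (im w)² |(f|α)(w)|`. As `y → 0`, `im w → ∞` and the
exponential decay of `f|α` beats the square. -/
theorem isBigO_cusp_vertical (f : S2Gamma0 p) (α : SL(2, ℤ)) (hc : (α 1 0 : ℤ) ≠ 0) :
    (fun y : ℝ => f (verticalPoint ((α 0 0 : ℤ) / (α 1 0 : ℤ)) y)) =O[𝓝[>] 0]
      fun _ => (1 : ℝ) := by
  obtain ⟨κ, hκ, hdecay⟩ := slash_exp_decay f α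
  have hc' : ((α 1 0 : ℤ) : ℝ) ≠ 0 := Int.cast_ne_zero.2 hc
  have him : Tendsto (fun τ : ℍ => τ.im) atImInfty atTop := tendsto_comap
  have h1 : (fun τ : ℍ => Real.exp (-κ * τ.im) * τ.im ^ 2) =O[atImInfty] fun _ => (1 : ℝ) := by
    have h2 := (isLittleO_pow_exp_pos_mul_atTop 2 hκ).isBigO.comp_tendsto him
    have h3 := (Asymptotics.isBigO_refl (fun τ : ℍ => Real.exp (-κ * τ.im)) atImInfty).mul h2
    refine h3.congr_right fun τ => ?_
    simp [← Real.exp_add]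
  have h4 := (hdecay.mul (Asymptotics.isBigO_refl
    (fun τ : ℍ => ((τ.im ^ 2 : ℝ) : ℂ)) atImInfty).norm_right).trans (by
      refine Asymptotics.IsBigO.trans (Asymptotics.isBigO_of_le _ fun τ => ?_) h1
      rw [Complex.norm_real, Real.norm_of_nonneg (sq_nonneg _)])
  have h5 := h4.comp_tendsto (tendsto_inv_smul_verticalPoint α hc)
  have h6 := (h5.const_mul_left ((((α 1 0 : ℤ) : ℝ) ^ 2 : ℝ) : ℂ)).norm_left
  refine Asymptotics.IsBigO.of_norm_left (h6.congr' ?_ (Eventually.of_forall fun _ => rfl))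
  filter_upwards [self_mem_nhdsWithin] with y hy
  have hy' : 0 < y := hy
  set τ := verticalPoint ((α 0 0 : ℤ) / (α 1 0 : ℤ)) y with hτ
  set w := α⁻¹ • τ with hw
  have hαw : α • w = τ := smul_inv_smul α τ
  have hwim : w.im = (((α 1 0 : ℤ) : ℝ) ^ 2 * y)⁻¹ := im_inv_smul_verticalPoint α hc hy
  have h7 := ModularGroup.im_smul_eq_div_normSq α w
  rw [hαw, hτ, im_verticalPoint _ hy, Complex.normSq_eq_norm_sq] at h7
  have hd : (0 : ℝ) < ‖denom α w‖ := norm_pos_iff.2 (denom_ne_zero _ _)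
  have h8 : ‖denom α w‖ ^ 2 * y = w.im := by
    rw [h7]
    field_simp
  rw [Function.comp_apply, SL_slash_apply, ← hw, hαw, norm_mul, norm_mul, norm_mul,
    Complex.norm_real, Complex.norm_real, norm_zpow, Real.norm_of_nonneg (sq_nonneg _),
    Real.norm_of_nonneg (sq_nonneg _), zpow_neg]
  have h9 : ((α 1 0 : ℤ) : ℝ) ^ 2 * w.im ^ 2 = ‖denom α w‖ ^ (2 : ℤ) := by
    have h10 : ‖denom α w‖ ^ (2 : ℤ) = w.im / y := by
      rw [← h8]
      field_simp
    rw [h10, hwim]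
    field_simp
  calc _ = ‖f τ‖ * (((α 1 0 : ℤ) : ℝ) ^ 2 * w.im ^ 2) * (‖denom α w‖ ^ (2 : ℤ))⁻¹ := by ring
    _ = ‖f τ‖ := by rw [h9, mul_assoc, mul_inv_cancel₀ (zpow_ne_zero _ hd.ne'), mul_one]

theorem differentiableAt_ofComplex (f : S2Gamma0 p) {z : ℂ} (hz : 0 < z.im) :
    DifferentiableAt ℂ (fun w => f (ofComplex w)) z :=
  (UpperHalfPlane.mdifferentiable_iff.1 f.holo').differentiableAt
    ((isOpen_lt continuous_const Complex.continuous_im).mem_nhds hz)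

theorem continuousOn_vertical (f : S2Gamma0 p) (x : ℝ) :
    ContinuousOn (fun y : ℝ => f (verticalPoint x y)) (Set.Ioi 0) := by
  intro y hy
  have hy' : 0 < y := hy
  have h1 := (differentiableAt_ofComplex f (z := (x : ℂ) + (y : ℂ) * Complex.I)
    (by simpa using hy')).continuousAt
  have h2 : ContinuousAt (fun y : ℝ => (x : ℂ) + (y : ℂ) * Complex.I) y := by fun_prop
  exact (ContinuousAt.comp (f := fun y : ℝ => (x : ℂ) + (y : ℂ) * Complex.I) h1 h2).continuousWithinAt

/-- Near `0` the integrand is bounded; near infinity it decays exponentially, by the case `α = 1` of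
`slash_exp_decay`. -/
theorem integrableOn_cusp_vertical (f : S2Gamma0 p) (α : SL(2, ℤ)) (hc : (α 1 0 : ℤ) ≠ 0) :
    MeasureTheory.IntegrableOn
      (fun y : ℝ => f (verticalPoint ((α 0 0 : ℤ) / (α 1 0 : ℤ)) y)) (Set.Ioi 0) := by
  set x : ℝ := (α 0 0 : ℤ) / (α 1 0 : ℤ) with hx
  have hcont := continuousOn_vertical f x
  obtain ⟨C, hC⟩ := (isBigO_cusp_vertical f α hc).bound
  obtain ⟨δ, hδ, hball⟩ := (mem_nhdsGT_iff_exists_Ioc_subset).1 hC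
  have hδ' : 0 < δ := hδ
  rw [← Set.Ioc_union_Ioi_eq_Ioi hδ'.le]
  refine MeasureTheory.IntegrableOn.union ?_ ?_
  · refine ⟨(hcont.mono Set.Ioc_subset_Ioi_self).aestronglyMeasurable measurableSet_Ioc,
      MeasureTheory.HasFiniteIntegral.of_bounded (C := C) ?_⟩
    refine (MeasureTheory.ae_restrict_iff' measurableSet_Ioc).2 (Eventually.of_forall fun y hy => ?_)
    simpa using hball hy
  · obtain ⟨κ, hκ, hdecay⟩ := slash_exp_decay f 1
    rw [SlashAction.slash_one] at hdecay
    have h1 := hdecay.comp_tendsto (tendsto_verticalPoint_atTop x)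
    have h2 := MeasureTheory.IntegrableOn.integrable (integrable_of_isBigO_exp_neg (a := δ) hκ
      (f := fun y => ‖f (verticalPoint x y)‖)
      (hcont.mono fun y hy => hδ'.trans_le hy).norm (by
        refine (h1.norm_left).congr' (Eventually.of_forall fun _ => rfl) ?_
        filter_upwards [eventually_gt_atTop 0] with y hy
        rw [Function.comp_apply, im_verticalPoint x hy]))
    exact (MeasureTheory.integrable_norm_iff ((hcont.mono fun y hy =>
      hδ'.trans hy).aestronglyMeasurable measurableSet_Ioi)).1 h2

theorem hasDerivAt_vertical {f : S2Gamma0 p} {G : ℂ → ℂ}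
    (hG : ∀ z : ℂ, 0 < z.im → HasDerivAt G (f (ofComplex z)) z) (x : ℝ) {y : ℝ} (hy : 0 < y) :
    HasDerivAt (fun y : ℝ => G ((x : ℂ) + (y : ℂ) * Complex.I))
      (f (verticalPoint x y) * Complex.I) y := by
  have h1 : HasDerivAt (fun s : ℝ => (x : ℂ) + s * Complex.I) Complex.I y := by
    have := ((Complex.ofRealCLM.hasDerivAt (x := y)).mul_const Complex.I).const_add (x : ℂ)
    simpa using this
  exact (hG _ (by simpa using hy)).comp y h1

theorem cuspIntegral_smul_infty {f : S2Gamma0 p} {G : ℂ → ℂ}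
    (hG : ∀ z : ℂ, 0 < z.im → HasDerivAt G (f (ofComplex z)) z) {α : SL(2, ℤ)} {L₁ L : ℂ}
    (hL₁ : Tendsto (fun τ : ℍ => G τ) atImInfty (𝓝 L₁))
    (hL : Tendsto (fun τ : ℍ => G (α • τ : ℍ)) atImInfty (𝓝 L)) :
    cuspIntegral f (Matrix.SpecialLinearGroup.mapGL ℚ α • OnePoint.infty) = L₁ - L := by
  rw [OnePoint.smul_infty_eq_ite]
  have h10 : (Matrix.SpecialLinearGroup.mapGL ℚ α) 1 0 = ((α 1 0 : ℤ) : ℚ) := rfl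
  have h00 : (Matrix.SpecialLinearGroup.mapGL ℚ α) 0 0 = ((α 0 0 : ℤ) : ℚ) := rfl
  rw [h10, h00]
  -- If `c = 0`, then `α` fixes `i∞`: both limits agree and the integral is `0` by convention.
  by_cases hc : (α 1 0 : ℤ) = 0
  · rw [if_pos (by rw [hc, Int.cast_zero])]
    have h1 : Tendsto (fun τ : ℍ => α • τ) atImInfty atImInfty :=
      tendsto_smul_atImInfty (g := (α : GL (Fin 2) ℝ)) (by
        change ((α 1 0 : ℤ) : ℝ) = 0
        rw [hc, Int.cast_zero])
    rw [tendsto_nhds_unique hL (hL₁.comp h1), sub_self]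
    rfl
  · rw [if_neg (Int.cast_ne_zero.2 hc)]
    set x : ℝ := (α 0 0 : ℤ) / (α 1 0 : ℤ) with hx
    have hcast : (((((α 0 0 : ℤ) : ℚ) / ((α 1 0 : ℤ) : ℚ) : ℚ)) : ℂ) = (x : ℂ) := by
      rw [hx]; push_cast; rfl
    change (∫ y in Set.Ioi (0 : ℝ), f (ofComplex ((((((α 0 0 : ℤ) : ℚ) / ((α 1 0 : ℤ) : ℚ) : ℚ)) : ℂ)
      + (y : ℂ) * Complex.I)) * Complex.I) = _
    rw [hcast]
    -- The primitive is extended to `y = 0` by its limit `L` at the cusp, so that the fundamental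
    -- theorem of calculus applies on `[0, ∞)`.
    set g : ℝ → ℂ := Function.update (fun y : ℝ => G ((x : ℂ) + (y : ℂ) * Complex.I)) 0 L with hg
    have hg0 : g 0 = L := Function.update_self _ _ _
    have hgpos : ∀ y : ℝ, 0 < y → g y = G ((x : ℂ) + (y : ℂ) * Complex.I) := fun y hy =>
      Function.update_of_ne hy.ne' _ _
    have hlim0 : Tendsto (fun y : ℝ => G ((x : ℂ) + (y : ℂ) * Complex.I)) (𝓝[>] 0) (𝓝 L) := by
      refine (hL.comp (tendsto_inv_smul_verticalPoint α hc)).congr' ?_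
      filter_upwards [self_mem_nhdsWithin] with y hy
      rw [Function.comp_apply, smul_inv_smul, coe_verticalPoint _ hy]
    have hint := MeasureTheory.integral_Ioi_of_hasDerivAt_of_tendsto (a := (0 : ℝ)) (f := g)
      (f' := fun y => f (verticalPoint x y) * Complex.I) (m := L₁) ?_ ?_ ?_ ?_
    · rw [hg0] at hint
      exact hint
    · rw [← continuousWithinAt_Ioi_iff_Ici]
      refine Tendsto.congr' ?_ (by rw [hg0]; exact hlim0)
      filter_upwards [self_mem_nhdsWithin] with y hy
      exact (hgpos y hy).symm
    · intro y hy
      refine (hasDerivAt_vertical hG x hy).congr_of_eventuallyEq ?_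
      filter_upwards [lt_mem_nhds (show (0 : ℝ) < y from hy)] with t ht
      exact hgpos t ht
    · exact (integrableOn_cusp_vertical f α hc).mul_const _
    · refine (hL₁.comp (tendsto_verticalPoint_atTop x)).congr' ?_
      filter_upwards [eventually_gt_atTop 0] with y hy
      rw [Function.comp_apply, coe_verticalPoint _ hy, hgpos y hy]

/-- The periods of a cusp form on `Γ₀(p)` are invariant under `Γ₀(p)`. -/
theorem period_smul (f : S2Gamma0 p) {γ : SL(2, ℤ)} (hγ : γ ∈ CongruenceSubgroup.Gamma0 p)
    (r s : OnePoint ℚ) :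
    period f (Matrix.SpecialLinearGroup.mapGL ℚ γ • r) (Matrix.SpecialLinearGroup.mapGL ℚ γ • s) =
      period f r s := by
  obtain ⟨G, hG⟩ := exists_primitive f
  obtain ⟨κ, hκ⟩ := primitive_smul_sub_const hG hγ
  obtain ⟨L₁, hL₁⟩ := exists_cusp_limit hG 1
  simp only [one_smul] at hL₁
  -- The shift by `κ` does not depend on the cusp, so it cancels in a period.
  have key : ∀ r : OnePoint ℚ, cuspIntegral f (Matrix.SpecialLinearGroup.mapGL ℚ γ • r) =
      cuspIntegral f r - κ := by
    intro r
    obtain ⟨α, rfl⟩ := OnePoint.exists_mem_SL2 ℤ r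
    obtain ⟨L, hL⟩ := exists_cusp_limit hG α
    have hL' : Tendsto (fun τ : ℍ => G ((γ * α) • τ : ℍ)) atImInfty (𝓝 (L + κ)) := by
      simp only [mul_smul, hκ]
      exact hL.add_const κ
    rw [smul_smul, ← map_mul, cuspIntegral_smul_infty hG hL₁ hL', cuspIntegral_smul_infty hG hL₁ hL]
    ring
  rw [period, period, key, key]
  ring

end CuspIntegrals

end MockHilbert


namespace MockHilbert

open Filter Topology UpperHalfPlane MatrixGroups ModularForm ModularGroup

/-! ### The trace of a modular symbol from `Γ₀(p)` to `SL₂(ℤ)` vanishes. -/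

section Trace

set_option linter.unusedSectionVars false

variable {p : ℕ} [hp : Fact p.Prime] {V : Type*} [AddCommGroup V]

/-- The sum of a function on `SL₂(ℤ)` over the standard representatives of `Γ₀(p) \ SL₂(ℤ)`. -/
def cosetSum (p : ℕ) (E : SL(2, ℤ) → V) : V :=
  E 1 + ∑ i ∈ Finset.range p, E (S * T ^ (-(i : ℤ)))

theorem bottom_row_S_mul_T_zpow (n : ℤ) (i : Fin 2) :
    (S * T ^ n : SL(2, ℤ)) 1 i = (![1, n] : Fin 2 → ℤ) i := by
  rw [Matrix.SpecialLinearGroup.coe_mul, coe_S, coe_T_zpow, Matrix.mul_apply, Fin.sum_univ_two]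
  fin_cases i <;> simp

/-- The lower left entry of `σ τ⁻¹` is the determinant of the two bottom rows. Cosets of `Γ₀(p)` are
thus points of `ℙ₁(𝔽_p)`, read off from bottom rows. -/
theorem mul_inv_mem_Gamma0 {σ τ : SL(2, ℤ)}
    (h : ((σ 1 0 : ℤ) : ZMod p) * ((τ 1 1 : ℤ) : ZMod p) =
      ((σ 1 1 : ℤ) : ZMod p) * ((τ 1 0 : ℤ) : ZMod p)) :
    σ * τ⁻¹ ∈ CongruenceSubgroup.Gamma0 p := by
  rw [CongruenceSubgroup.Gamma0_mem, Matrix.SpecialLinearGroup.coe_mul,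
    Matrix.SpecialLinearGroup.coe_inv, Matrix.adjugate_fin_two, Matrix.mul_apply,
    Fin.sum_univ_two]
  simp only [Matrix.of_apply, Matrix.cons_val_zero, Matrix.cons_val_one]
  simp
  rw [h]
  ring

theorem eq_of_bottom_row {E : SL(2, ℤ) → V}
    (hE : ∀ g ∈ CongruenceSubgroup.Gamma0 p, ∀ σ, E (g * σ) = E σ) {σ τ : SL(2, ℤ)}
    (h : ((σ 1 0 : ℤ) : ZMod p) * ((τ 1 1 : ℤ) : ZMod p) =
      ((σ 1 1 : ℤ) : ZMod p) * ((τ 1 0 : ℤ) : ZMod p)) : E σ = E τ := by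
  have := hE _ (mul_inv_mem_Gamma0 h) τ
  rwa [inv_mul_cancel_right] at this

/-- Every element of `SL₂(ℤ)` lies in one of the standard cosets of `Γ₀(p)`. -/
theorem exists_coset_representative (σ : SL(2, ℤ)) :
    ∃ g ∈ CongruenceSubgroup.Gamma0 p, σ = g ∨ ∃ i : ℤ, σ = g * (S * T ^ i) := by
  by_cases h : ((σ 1 0 : ℤ) : ZMod p) = 0
  · exact ⟨σ, CongruenceSubgroup.Gamma0_mem.2 h, Or.inl rfl⟩
  · obtain ⟨i, hi⟩ := ZMod.intCast_surjective (((σ 1 1 : ℤ) : ZMod p) / ((σ 1 0 : ℤ) : ZMod p))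
    refine ⟨_, mul_inv_mem_Gamma0 (τ := S * T ^ i) ?_, Or.inr ⟨i, by rw [inv_mul_cancel_right]⟩⟩
    rw [bottom_row_S_mul_T_zpow, bottom_row_S_mul_T_zpow]
    simp [hi]
    field_simp

/-- The bottom row of `S T^(-x)` is `(1, -x)`, so a row `(c, d)` with `c ≠ 0` belongs to `x = -d /
c`. -/
theorem eq_coset_representative {E : SL(2, ℤ) → V}
    (hE : ∀ g ∈ CongruenceSubgroup.Gamma0 p, ∀ σ, E (g * σ) = E σ) (σ : SL(2, ℤ)) :
    E σ = if ((σ 1 0 : ℤ) : ZMod p) = 0 then E 1 else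
      E (S * T ^ (-((-((σ 1 1 : ℤ) : ZMod p) / ((σ 1 0 : ℤ) : ZMod p)).val : ℤ))) := by
  split_ifs with h
  · refine eq_of_bottom_row hE ?_
    rw [h]
    simp
  · refine eq_of_bottom_row hE ?_
    rw [bottom_row_S_mul_T_zpow, bottom_row_S_mul_T_zpow]
    simp
    field_simp

theorem cosetSum_eq_sum_zmod (E : SL(2, ℤ) → V) :
    cosetSum p E = E 1 + ∑ x : ZMod p, E (S * T ^ (-(x.val : ℤ))) := by
  rw [cosetSum]
  congr 1
  refine Finset.sum_bij' (fun i _ => (i : ZMod p)) (fun x _ => x.val) ?_ ?_ ?_ ?_ ?_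
  · simp
  · intro x _
    exact Finset.mem_range.2 (ZMod.val_lt x)
  · intro i hi
    exact ZMod.val_cast_of_lt (Finset.mem_range.1 hi)
  · intro x _
    simp
  · intro i hi
    rw [ZMod.val_cast_of_lt (Finset.mem_range.1 hi)]

theorem cosetSum_mul_T {E : SL(2, ℤ) → V}
    (hE : ∀ g ∈ CongruenceSubgroup.Gamma0 p, ∀ σ, E (g * σ) = E σ) :
    cosetSum p (fun σ => E (σ * T)) = cosetSum p E := by
  rw [cosetSum_eq_sum_zmod, cosetSum_eq_sum_zmod]
  congr 1
  · refine eq_of_bottom_row hE ?_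
    rw [one_mul, coe_T]
    simp
  · refine Fintype.sum_equiv (Equiv.subRight (1 : ZMod p)) _ _ fun x => ?_
    refine eq_of_bottom_row hE ?_
    rw [mul_assoc, ← zpow_add_one]
    simp only [bottom_row_S_mul_T_zpow]
    simp
    ring

/-- The bottom row of `S T^(-x) S` is `(-x, -1)`: right multiplication by `S` acts on cosets as `x ↦
-1/x`, with `x = 0` going to the trivial coset. -/
theorem apply_S_mul_T_zpow_mul_S {E : SL(2, ℤ) → V}
    (hE : ∀ g ∈ CongruenceSubgroup.Gamma0 p, ∀ σ, E (g * σ) = E σ) (x : ZMod p) :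
    E (S * T ^ (-(x.val : ℤ)) * S) =
      if x = 0 then E 1 else E (S * T ^ (-((-x⁻¹).val : ℤ))) := by
  have h10 : ((S * T ^ (-(x.val : ℤ)) * S : SL(2, ℤ)) 1 0 : ℤ) = -(x.val : ℤ) := by
    rw [Matrix.SpecialLinearGroup.coe_mul, Matrix.mul_apply, Fin.sum_univ_two,
      bottom_row_S_mul_T_zpow, bottom_row_S_mul_T_zpow, coe_S]
    simp
  have h11 : ((S * T ^ (-(x.val : ℤ)) * S : SL(2, ℤ)) 1 1 : ℤ) = -1 := by
    rw [Matrix.SpecialLinearGroup.coe_mul, Matrix.mul_apply, Fin.sum_univ_two,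
      bottom_row_S_mul_T_zpow, bottom_row_S_mul_T_zpow, coe_S]
    simp
  rw [eq_coset_representative hE, h10, h11]
  have h : (((-(x.val : ℤ) : ℤ)) : ZMod p) = -x := by
    rw [Int.cast_neg, Int.cast_natCast, ZMod.natCast_zmod_val]
  rw [h, Int.cast_neg, Int.cast_one, neg_neg, div_neg, one_div]
  simp only [neg_eq_zero]

theorem sum_neg_inv (e : ZMod p → V) : ∑ x : ZMod p, e (-x⁻¹) = ∑ x : ZMod p, e x :=
  Fintype.sum_bijective (fun x : ZMod p => -x⁻¹) (neg_involutive.bijective.comp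
    inv_involutive.bijective) _ _ fun _ => rfl

theorem sum_ite_zero_add (e : ZMod p → V) (a : V) :
    a + ∑ x : ZMod p, e x = e 0 + ∑ x : ZMod p, (if x = 0 then a else e x) := by
  have h : ∀ x : ZMod p, (if x = 0 then a else e x) = e x + if x = 0 then a - e 0 else 0 := by
    intro x
    split_ifs with hx
    · rw [hx]
      abel
    · rw [add_zero]
  simp only [h, Finset.sum_add_distrib, Finset.sum_ite_eq', Finset.mem_univ, if_true]
  abel

/-- The involution `x ↦ -1/x` of `ℙ₁(𝔽_p)` permutes the cosets. On `𝔽_p` the convention `0⁻¹ = 0`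
fixes `0`, so the exchange of `x = 0` with the trivial coset is done separately by
`sum_ite_zero_add`. -/
theorem cosetSum_mul_S {E : SL(2, ℤ) → V}
    (hE : ∀ g ∈ CongruenceSubgroup.Gamma0 p, ∀ σ, E (g * σ) = E σ) :
    cosetSum p (fun σ => E (σ * S)) = cosetSum p E := by
  rw [cosetSum_eq_sum_zmod, cosetSum_eq_sum_zmod, one_mul,
    ← sum_neg_inv fun x : ZMod p => E (S * T ^ (-(x.val : ℤ))),
    sum_ite_zero_add (fun x : ZMod p => E (S * T ^ (-((-x⁻¹).val : ℤ))))]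
  congr 1
  · simp only [inv_zero, neg_zero, ZMod.val_zero, Nat.cast_zero, zpow_zero, mul_one]
  · exact Finset.sum_congr rfl fun x _ => apply_S_mul_T_zpow_mul_S hE x

/-- It suffices to treat the generators `S` and `T`. The function `E` varies in the induction, since
its right translates remain left invariant under `Γ₀(p)`. -/
theorem cosetSum_mul_right {E : SL(2, ℤ) → V}
    (hE : ∀ g ∈ CongruenceSubgroup.Gamma0 p, ∀ σ, E (g * σ) = E σ) (τ : SL(2, ℤ)) :
    cosetSum p (fun σ => E (σ * τ)) = cosetSum p E := by
  have hτ : τ ∈ Subgroup.closure {S, T} := by simp [SpecialLinearGroup.SL2Z_generators]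
  induction hτ using Subgroup.closure_induction generalizing E with
  | mem g hg =>
    rcases hg with rfl | rfl
    · exact cosetSum_mul_S hE
    · exact cosetSum_mul_T hE
  | one => simp
  | mul a b _ _ ha hb =>
    have h1 := ha (E := fun σ => E (σ * b)) fun g hg σ => by rw [mul_assoc, hE g hg]
    rw [← hb hE, ← h1]
    simp only [mul_assoc]
  | inv a _ ha =>
    have h1 := ha (E := fun σ => E (σ * a⁻¹)) fun g hg σ => by rw [mul_assoc, hE g hg]
    rw [← h1]
    simp

/-- A modular symbol for `Γ₀(p)` has trace zero: there are no nonzero modular symbols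
for `SL₂(ℤ)`. -/
theorem modularSymbol_trace_eq_zero [IsAddTorsionFree V] {P : OnePoint ℚ → OnePoint ℚ → V}
    (hadd : ∀ r s t, P r s + P s t = P r t)
    (hinv : ∀ g ∈ CongruenceSubgroup.Gamma0 p, ∀ r s,
      P (Matrix.SpecialLinearGroup.mapGL ℚ g • r) (Matrix.SpecialLinearGroup.mapGL ℚ g • s) = P r s)
    (r s : OnePoint ℚ) :
    P r s + ∑ i ∈ Finset.range p,
      P (Matrix.SpecialLinearGroup.mapGL ℚ (S * T ^ (-(i : ℤ))) • r)
        (Matrix.SpecialLinearGroup.mapGL ℚ (S * T ^ (-(i : ℤ))) • s) = 0 := by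
  set Ψ : OnePoint ℚ → OnePoint ℚ → V := fun r s => cosetSum p fun σ =>
    P (Matrix.SpecialLinearGroup.mapGL ℚ σ • r) (Matrix.SpecialLinearGroup.mapGL ℚ σ • s) with hΨ
  suffices h : Ψ r s = 0 by simpa [hΨ, cosetSum] using h
  have hΨadd : ∀ r s t, Ψ r s + Ψ s t = Ψ r t := by
    intro r s t
    simp only [hΨ, cosetSum]
    rw [add_add_add_comm, ← Finset.sum_add_distrib]
    simp only [hadd]
  have hΨinv : ∀ (τ : SL(2, ℤ)) (r s), Ψ (Matrix.SpecialLinearGroup.mapGL ℚ τ • r)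
      (Matrix.SpecialLinearGroup.mapGL ℚ τ • s) = Ψ r s := by
    intro τ r s
    have := cosetSum_mul_right (p := p) (E := fun σ => P (Matrix.SpecialLinearGroup.mapGL ℚ σ • r)
      (Matrix.SpecialLinearGroup.mapGL ℚ σ • s)) (fun g hg σ => by
        simp only [map_mul, mul_smul]
        exact hinv g hg _ _) τ
    simp only [map_mul, mul_smul] at this
    exact this
  have hself : ∀ r, Ψ r r = 0 := fun r => by simpa using hΨadd r r r
  have hanti : ∀ r s, Ψ s r = -Ψ r s := fun r s => by
    rw [eq_neg_iff_add_eq_zero, hΨadd, hself]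
  have hcusp : ∀ τ : SL(2, ℤ),
      Ψ OnePoint.infty (Matrix.SpecialLinearGroup.mapGL ℚ τ • OnePoint.infty) = 0 := by
    intro τ
    have hτ : τ ∈ Subgroup.closure {S, T} := by simp [SpecialLinearGroup.SL2Z_generators]
    induction hτ using Subgroup.closure_induction with
    | mem g hg =>
      rcases hg with rfl | rfl
      -- `S` exchanges `∞` and `0`, so invariance and antisymmetry give `Ψ(∞, 0) = -Ψ(∞, 0)`, which
      -- is zero as `V` has no torsion.
      · have hSS : Matrix.SpecialLinearGroup.mapGL ℚ S •
            Matrix.SpecialLinearGroup.mapGL ℚ S • (OnePoint.infty : OnePoint ℚ) =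
              OnePoint.infty := by
          rw [smul_smul, ← map_mul, OnePoint.smul_infty_eq_self_iff]
          change ((((S * S : SL(2, ℤ)) 1 0 : ℤ)) : ℚ) = 0
          rw [Matrix.SpecialLinearGroup.coe_mul, coe_S]
          simp
        have h1 := hΨinv S OnePoint.infty (Matrix.SpecialLinearGroup.mapGL ℚ S • OnePoint.infty)
        rw [hSS, hanti] at h1
        exact self_eq_neg.1 h1.symm
      · have hT : Matrix.SpecialLinearGroup.mapGL ℚ T • (OnePoint.infty : OnePoint ℚ) =
            OnePoint.infty := by
          rw [OnePoint.smul_infty_eq_self_iff]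
          change (((T : SL(2, ℤ)) 1 0 : ℤ) : ℚ) = 0
          rw [coe_T]
          simp
        rw [hT, hself]
    | one => simp [hself]
    -- The path from `∞` to `ab∞` is cut at `a∞`; its second piece is the translate by `a` of the
    -- path from `∞` to `b∞`.
    | mul a b _ _ ha hb =>
      rw [map_mul, mul_smul, ← hΨadd _ (Matrix.SpecialLinearGroup.mapGL ℚ a • OnePoint.infty), ha,
        hΨinv, hb, add_zero]
    | inv a _ ha =>
      rw [← hΨinv a, map_inv, smul_inv_smul, hanti, ha, neg_zero]
  obtain ⟨α, rfl⟩ := OnePoint.exists_mem_SL2 ℤ r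
  obtain ⟨β, rfl⟩ := OnePoint.exists_mem_SL2 ℤ s
  rw [← hΨadd _ OnePoint.infty, hanti, hcusp, hcusp, neg_zero, add_zero]

end Trace

end MockHilbert


namespace MockHilbert

open Filter Topology UpperHalfPlane MatrixGroups ModularForm ModularGroup Matrix

/-! ### Matrices up to scalars: balls and the Atkin-Lehner involution. -/

section Moebius

set_option linter.unusedSectionVars false

/-- The action of `2 × 2` matrices on the projective line, without the requirement of
invertibility. -/
noncomputable def mob (M : Matrix (Fin 2) (Fin 2) ℚ) : OnePoint ℚ → OnePoint ℚ
  | OnePoint.infty => if M 1 0 = 0 then OnePoint.infty else ((M 0 0 / M 1 0 : ℚ) : OnePoint ℚ)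
  | OnePoint.some t => if M 1 0 * t + M 1 1 = 0 then OnePoint.infty else
      (((M 0 0 * t + M 0 1) / (M 1 0 * t + M 1 1) : ℚ) : OnePoint ℚ)

theorem mob_coe (g : GL (Fin 2) ℚ) (x : OnePoint ℚ) : mob g x = g • x := by
  induction x using OnePoint.rec with
  | infty => exact (OnePoint.smul_infty_eq_ite g).symm
  | coe t => exact OnePoint.smul_some_eq_ite.symm

theorem mob_mul {M N : Matrix (Fin 2) (Fin 2) ℚ} (hM : M.det ≠ 0) (hN : N.det ≠ 0)
    (x : OnePoint ℚ) : mob (M * N) x = mob M (mob N x) := by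
  have h := mob_coe (GeneralLinearGroup.mkOfDetNeZero M hM * GeneralLinearGroup.mkOfDetNeZero N hN) x
  rw [mul_smul, ← mob_coe, ← mob_coe] at h
  exact h

theorem mob_smul {c : ℚ} (hc : c ≠ 0) (M : Matrix (Fin 2) (Fin 2) ℚ) (x : OnePoint ℚ) :
    mob (c • M) x = mob M x := by
  induction x using OnePoint.rec with
  | infty =>
    simp only [mob, Matrix.smul_apply, smul_eq_mul, mul_eq_zero, hc, false_or,
      mul_div_mul_left _ _ hc]
  | coe t =>
    change (if c * M 1 0 * t + c * M 1 1 = 0 then OnePoint.infty else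
      (((c * M 0 0 * t + c * M 0 1) / (c * M 1 0 * t + c * M 1 1) : ℚ) : OnePoint ℚ)) = _
    have h1 : c * M 1 0 * t + c * M 1 1 = c * (M 1 0 * t + M 1 1) := by ring
    have h2 : c * M 0 0 * t + c * M 0 1 = c * (M 0 0 * t + M 0 1) := by ring
    rw [h1, h2, mul_div_mul_left _ _ hc]
    simp only [mul_eq_zero, hc, false_or]
    rfl

/-- The rational matrix underlying an element of `SL₂(ℤ)`. -/
def ratMat (g : SL(2, ℤ)) : Matrix (Fin 2) (Fin 2) ℚ := (g : Matrix (Fin 2) (Fin 2) ℤ).map Int.cast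

theorem mob_ratMat (g : SL(2, ℤ)) (x : OnePoint ℚ) :
    mob (ratMat g) x = Matrix.SpecialLinearGroup.mapGL ℚ g • x :=
  mob_coe (Matrix.SpecialLinearGroup.mapGL ℚ g) x

theorem ratMat_mul (g h : SL(2, ℤ)) : ratMat (g * h) = ratMat g * ratMat h := by
  rw [ratMat, Matrix.SpecialLinearGroup.coe_mul]
  exact Matrix.map_mul_intCast _ _

theorem det_ratMat (g : SL(2, ℤ)) : (ratMat g).det = 1 := by
  have h := g.det_coe
  rw [Matrix.det_fin_two] at h ⊢
  simp only [ratMat, Matrix.map_apply]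
  exact_mod_cast h

theorem ratMat_S_mul_T_zpow (i : ℤ) : ratMat (S * T ^ i) = !![0, -1; 1, (i : ℚ)] := by
  rw [ratMat_mul, ratMat, ratMat, coe_S, coe_T_zpow]
  ext a b
  fin_cases a <;> fin_cases b <;> simp [Matrix.mul_apply, Fin.sum_univ_two]

variable (p : ℕ) [hp : Fact p.Prime]

/-- The matrix of the Atkin-Lehner involution. -/
def atkinLehner : Matrix (Fin 2) (Fin 2) ℚ := !![0, -1; (p : ℚ), 0]

/-- The matrix taking `a + p^k ℤ_p` to `ℤ_p` under the Moebius action. -/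
def ballMat (a : ℚ) (k : ℤ) : Matrix (Fin 2) (Fin 2) ℚ := !![1, -a; 0, (p : ℚ) ^ k]

theorem prime_cast_rat_ne_zero : (p : ℚ) ≠ 0 := Nat.cast_ne_zero.2 hp.out.ne_zero

theorem det_atkinLehner : (atkinLehner p).det ≠ 0 := by
  simp [atkinLehner, Matrix.det_fin_two, prime_cast_rat_ne_zero p]

theorem det_ballMat (a : ℚ) (k : ℤ) : (ballMat p a k).det ≠ 0 := by
  simp [ballMat, Matrix.det_fin_two, zpow_ne_zero k (prime_cast_rat_ne_zero p)]

theorem ballMat_add_mul_zpow (a : ℚ) (k : ℤ) (i : ℚ) :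
    ballMat p (a + i * (p : ℚ) ^ k) (k + 1) = !![1, -i; 0, (p : ℚ)] * ballMat p a k := by
  rw [ballMat, ballMat, zpow_add_one₀ (prime_cast_rat_ne_zero p)]
  ext a b
  fin_cases a <;> fin_cases b <;> simp [Matrix.mul_apply, Fin.sum_univ_two]
  · ring
  · exact mul_comm _ _

theorem ballMat_add_zpow (a : ℚ) (k : ℤ) :
    ballMat p (a + (p : ℚ) ^ k) k = ratMat (T ^ (-1 : ℤ)) * ballMat p a k := by
  rw [ballMat, ballMat, ratMat, coe_T_zpow]
  ext a b
  fin_cases a <;> fin_cases b <;> simp [Matrix.mul_apply, Fin.sum_univ_two]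
  ring_nf

/-- Together with `atkinLehner_mul_S_mul_T_zpow`, this matches the `p` subballs of a ball with the
nontrivial cosets of `Γ₀(p)`, up to scalars that act trivially. -/
theorem atkinLehner_mul_upper (i : ℤ) :
    atkinLehner p * !![1, (i : ℚ); 0, (p : ℚ)] = (p : ℚ) • ratMat (S * T ^ i) := by
  rw [ratMat_S_mul_T_zpow, atkinLehner]
  ext a b
  fin_cases a <;> fin_cases b <;> simp [Matrix.mul_apply, Fin.sum_univ_two]

theorem atkinLehner_mul_S_mul_T_zpow (i : ℤ) :
    atkinLehner p * ratMat (S * T ^ i) = (-1 : ℚ) • !![1, (i : ℚ); 0, (p : ℚ)] := by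
  rw [ratMat_S_mul_T_zpow, atkinLehner]
  ext a b
  fin_cases a <;> fin_cases b <;> simp [Matrix.mul_apply, Fin.sum_univ_two]

/-- The Atkin-Lehner matrix normalises `Γ₀(p)`; the witness `h` is the conjugate of `g`. -/
theorem exists_atkinLehner_mul {g : SL(2, ℤ)} (hg : g ∈ CongruenceSubgroup.Gamma0 p) :
    ∃ h ∈ CongruenceSubgroup.Gamma0 p, atkinLehner p * ratMat g = ratMat h * atkinLehner p := by
  rw [CongruenceSubgroup.Gamma0_mem, ZMod.intCast_zmod_eq_zero_iff_dvd] at hg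
  obtain ⟨c, hc⟩ := hg
  have hdet := g.det_coe
  rw [Matrix.det_fin_two, hc] at hdet
  have hdet' : (!![g 1 1, -c; -((p : ℤ) * g 0 1), g 0 0] : Matrix (Fin 2) (Fin 2) ℤ).det = 1 := by
    rw [Matrix.det_fin_two_of]
    linarith
  obtain ⟨h, hh⟩ : ∃ h : SL(2, ℤ), (h : Matrix (Fin 2) (Fin 2) ℤ) =
    !![g 1 1, -c; -((p : ℤ) * g 0 1), g 0 0] := ⟨⟨_, hdet'⟩, rfl⟩
  refine ⟨h, ?_, ?_⟩
  · rw [CongruenceSubgroup.Gamma0_mem, hh]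
    simp
  · have hc' : ((g 1 0 : ℤ) : ℚ) = p * c := by rw [hc]; push_cast; rfl
    rw [atkinLehner, ratMat, ratMat, hh]
    ext a b
    fin_cases a <;> fin_cases b <;> simp [Matrix.mul_apply, Fin.sum_univ_two, hc']
    all_goals ring

end Moebius

/-! ### The distribution of periods attached to the cusp form. -/

section Distribution

set_option linter.unusedSectionVars false

variable {p : ℕ} [hp : Fact p.Prime]

/-- The period of `f` along the path from `M r` to `M s`. -/
noncomputable def matPeriod (f : S2Gamma0 p) (r s : OnePoint ℚ) (M : Matrix (Fin 2) (Fin 2) ℚ) : ℂ :=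
  period f (mob M r) (mob M s)

variable (f : S2Gamma0 p) (r s : OnePoint ℚ)

theorem matPeriod_smul {c : ℚ} (hc : c ≠ 0) (M : Matrix (Fin 2) (Fin 2) ℚ) :
    matPeriod f r s (c • M) = matPeriod f r s M := by
  simp only [matPeriod, mob_smul hc]

theorem matPeriod_ratMat_mul {g : SL(2, ℤ)} (hg : g ∈ CongruenceSubgroup.Gamma0 p)
    {M : Matrix (Fin 2) (Fin 2) ℚ} (hM : M.det ≠ 0) :
    matPeriod f r s (ratMat g * M) = matPeriod f r s M := by
  have hg' : (ratMat g).det ≠ 0 := by simp [det_ratMat]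
  simp only [matPeriod, mob_mul hg' hM, mob_ratMat, period_smul f hg]

theorem matPeriod_trace {M : Matrix (Fin 2) (Fin 2) ℚ} (hM : M.det ≠ 0) :
    matPeriod f r s M + ∑ i ∈ Finset.range p,
      matPeriod f r s (ratMat (S * T ^ (-(i : ℤ))) * M) = 0 := by
  have h := modularSymbol_trace_eq_zero (p := p) (P := period f)
    (fun r s t => by simp only [period]; ring) (fun g hg r s => period_smul f hg r s)
    (mob M r) (mob M s)
  have hdet : ∀ g : SL(2, ℤ), (ratMat g).det ≠ 0 := fun g => by simp [det_ratMat]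
  simpa only [matPeriod, mob_mul (hdet _) hM, mob_ratMat] using h

/-- This is the vanishing of the trace for the symbol `P ∘ W`, which is again `Γ₀(p)`-invariant
because `W` normalises `Γ₀(p)`. -/
theorem matPeriod_atkinLehner_trace {M : Matrix (Fin 2) (Fin 2) ℚ} (hM : M.det ≠ 0) :
    matPeriod f r s (atkinLehner p * M) + ∑ i ∈ Finset.range p,
      matPeriod f r s (!![1, -(i : ℚ); 0, (p : ℚ)] * M) = 0 := by
  have hdet : ∀ g : SL(2, ℤ), (ratMat g).det ≠ 0 := fun g => by simp [det_ratMat]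
  have hW := det_atkinLehner p
  have h := modularSymbol_trace_eq_zero (p := p)
    (P := fun r s => matPeriod f r s (atkinLehner p))
    (fun r s t => by simp only [matPeriod, period]; ring) (fun g hg r s => by
      obtain ⟨g', hg', h⟩ := exists_atkinLehner_mul p hg
      have h1 : ∀ r, mob (atkinLehner p) (Matrix.SpecialLinearGroup.mapGL ℚ g • r) =
          Matrix.SpecialLinearGroup.mapGL ℚ g' • mob (atkinLehner p) r := by
        intro r
        rw [← mob_ratMat, ← mob_ratMat, ← mob_mul hW (hdet g), h, mob_mul (hdet g') hW]
      simp only [matPeriod, h1, period_smul f hg'])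
    (mob M r) (mob M s)
  rw [← h]
  simp only [matPeriod, ← mob_ratMat]
  congr 1
  · rw [mob_mul hW hM, mob_mul hW hM]
  · refine Finset.sum_congr rfl fun i _ => ?_
    have h1 : ∀ x, mob (!![1, -(i : ℚ); 0, (p : ℚ)] * M) x =
        mob (atkinLehner p) (mob (ratMat (S * T ^ (-(i : ℤ)))) (mob M x)) := by
      intro x
      rw [← mob_mul (hdet _) hM, ← mob_mul hW (by rw [Matrix.det_mul]; exact mul_ne_zero (hdet _) hM),
        ← mul_assoc, atkinLehner_mul_S_mul_T_zpow, Matrix.smul_mul, mob_smul (by norm_num)]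
      push_cast
      rfl
    rw [h1, h1]

/-- The values on balls of the measure attached to a cusp form. -/
noncomputable def ballPeriod (a : ℚ) (k : ℤ) : ℂ :=
  if Even k then -matPeriod f r s (ballMat p a k)
  else matPeriod f r s (atkinLehner p * ballMat p a k)

theorem ballPeriod_periodic (a : ℚ) (k : ℤ) :
    ballPeriod f r s (a + (p : ℚ) ^ k) k = ballPeriod f r s a k := by
  have hT : (T ^ (-1 : ℤ) : SL(2, ℤ)) ∈ CongruenceSubgroup.Gamma0 p := by
    rw [CongruenceSubgroup.Gamma0_mem, coe_T_zpow]
    simp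
  rw [ballPeriod, ballPeriod, ballMat_add_zpow]
  congr 1
  · rw [matPeriod_ratMat_mul f r s hT (det_ballMat p a k)]
  · obtain ⟨g, hg, h⟩ := exists_atkinLehner_mul p hT
    rw [← mul_assoc, h, mul_assoc, matPeriod_ratMat_mul f r s hg]
    rw [Matrix.det_mul]
    exact mul_ne_zero (det_atkinLehner p) (det_ballMat p a k)

/-- For even `k` it is the complement of the ball that `ballMat` carries to `U_∞`, hence the minus
sign in `ballPeriod`; for odd `k` the matrix `W` carries the ball itself there. Passing to subballs
changes the parity, so each case is one trace relation: for `P` if `k` is even, for `P ∘ W` if `k`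
is odd. -/
theorem ballPeriod_additive (a : ℚ) (k : ℤ) :
    ballPeriod f r s a k =
      ∑ i ∈ Finset.range p, ballPeriod f r s (a + i * (p : ℚ) ^ k) (k + 1) := by
  have hp0 := prime_cast_rat_ne_zero p
  simp only [ballPeriod, ballMat_add_mul_zpow, Int.even_add_one]
  by_cases hk : Even k
  · simp only [hk, if_true, not_true, if_false]
    rw [neg_eq_iff_add_eq_zero, ← matPeriod_trace f r s (det_ballMat p a k)]
    congr 1
    refine Finset.sum_congr rfl fun i _ => ?_
    have h := atkinLehner_mul_upper p (-(i : ℤ))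
    push_cast at h
    rw [← mul_assoc, h, Matrix.smul_mul, matPeriod_smul f r s hp0]
  · simp only [hk, if_false, not_false_iff, if_true]
    rw [Finset.sum_neg_distrib, eq_neg_iff_add_eq_zero]
    exact matPeriod_atkinLehner_trace f r s (det_ballMat p a k)

theorem ballPeriod_mem {Λ : AddSubgroup ℂ} (hΛ : ∀ r s : OnePoint ℚ, period f r s ∈ Λ) (a : ℚ)
    (k : ℤ) : ballPeriod f r s a k ∈ Λ := by
  rw [ballPeriod]
  split_ifs
  · exact neg_mem (hΛ _ _)
  · exact hΛ _ _

theorem ballPeriod_isDistribution {Λ : AddSubgroup ℂ}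
    (hΛ : ∀ r s : OnePoint ℚ, period f r s ∈ Λ) :
    IsDistribution p fun a k => (⟨ballPeriod f r s a k, ballPeriod_mem f r s hΛ a k⟩ : Λ) where
  periodic a k := Subtype.ext (ballPeriod_periodic f r s a k)
  additive a k := Subtype.ext (by
    rw [AddSubgroup.val_finsetSum]
    exact ballPeriod_additive f r s a k)

end Distribution

end MockHilbert


namespace MockHilbert

open Filter Topology UpperHalfPlane MatrixGroups ModularForm ModularGroup Matrix

/-! ### Which points a matrix sends into `U_∞`. -/

section Ball

set_option linter.unusedSectionVars false

variable {p : ℕ} [hp : Fact p.Prime]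

/-- The condition that `M x` lies in the ball `U_∞`. -/
def MapsToBallInfty (M : Matrix (Fin 2) (Fin 2) ℚ) : P1Qp p → Prop
  | OnePoint.infty => ‖(M 1 0 : ℚ_[p])‖ < ‖(M 0 0 : ℚ_[p])‖
  | OnePoint.some t => ‖(M 1 0 * t + M 1 1 : ℚ_[p])‖ < ‖(M 0 0 * t + M 0 1 : ℚ_[p])‖

theorem infty_mem_ballInfty : (OnePoint.infty : P1Qp p) ∈ ballInfty p := fun a h =>
  OnePoint.infty_ne_coe (a : ℚ_[p]) h

theorem coe_mem_ballInfty {t : ℚ_[p]} : ((t : ℚ_[p]) : P1Qp p) ∈ ballInfty p ↔ 1 < ‖t‖ := by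
  rw [← not_le]
  refine ⟨fun h hle => h ⟨t, hle⟩ rfl, fun h a ha => h ?_⟩
  rw [OnePoint.coe_injective ha]
  exact a.2

theorem ite_mem_ballInfty {a b : ℚ_[p]} [Decidable (b = 0)] (hab : a ≠ 0 ∨ b ≠ 0) :
    (if b = 0 then OnePoint.infty else ((a / b : ℚ_[p]) : P1Qp p)) ∈ ballInfty p ↔ ‖b‖ < ‖a‖ := by
  split_ifs with hb
  · rw [hb, norm_zero, norm_pos_iff]
    exact iff_of_true infty_mem_ballInfty (hab.resolve_right fun h => h hb)
  · rw [coe_mem_ballInfty, norm_div, one_lt_div (norm_pos_iff.2 hb)]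

/-- The rational matrix underlying an element of the Ihara group. -/
def iharaMat (γ : Ihara p) : Matrix (Fin 2) (Fin 2) ℚ := (γ : Matrix (Fin 2) (Fin 2) (ZInv p)).map
  Subtype.val

theorem det_iharaMat (γ : Ihara p) : (iharaMat γ).det = 1 := by
  have h := congrArg (Subtype.val) γ.det_coe
  rw [Matrix.det_fin_two] at h ⊢
  exact h

theorem moebiusRat_eq_mob (γ : Ihara p) (r : OnePoint ℚ) : moebiusRat γ r = mob (iharaMat γ) r :=
  (mob_coe (iharaRat p γ) r).symm

theorem det_cast_iharaMat (γ : Ihara p) : (iharaMat γ 0 0 * iharaMat γ 1 1 -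
    iharaMat γ 0 1 * iharaMat γ 1 0 : ℚ_[p]) = 1 := by
  have h := det_iharaMat γ
  rw [Matrix.det_fin_two] at h
  exact_mod_cast congrArg (fun q : ℚ => (q : ℚ_[p])) h

theorem moebiusPadic_mem_ballInfty (γ : Ihara p) (x : P1Qp p) :
    moebiusPadic γ x ∈ ballInfty p ↔ MapsToBallInfty (iharaMat γ) x := by
  classical
  have hdet := det_cast_iharaMat γ
  have hentry : ∀ i j, (iharaPadic p γ) i j = ((iharaMat γ i j : ℚ) : ℚ_[p]) := fun i j => by
    change algebraMap ℚ ℚ_[p] _ = _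
    rw [eq_ratCast]
    rfl
  induction x using OnePoint.rec with
  | infty =>
    rw [moebiusPadic, OnePoint.smul_infty_eq_ite, hentry, hentry]
    refine ite_mem_ballInfty ?_
    · by_contra! h
      rw [h.1, h.2] at hdet
      simp at hdet
  | coe t =>
    rw [moebiusPadic, OnePoint.smul_some_eq_ite, hentry, hentry, hentry, hentry]
    refine ite_mem_ballInfty ?_
    · by_contra! h
      refine zero_ne_one (α := ℚ_[p]) ?_
      rw [← hdet]
      linear_combination (iharaMat γ 1 0 : ℚ_[p]) * h.1 - (iharaMat γ 0 0 : ℚ_[p]) * h.2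

theorem mapsToBallInfty_smul {c : ℚ} (hc : c ≠ 0) (M : Matrix (Fin 2) (Fin 2) ℚ) (x : P1Qp p) :
    MapsToBallInfty (c • M) x ↔ MapsToBallInfty M x := by
  have hc' : 0 < ‖(c : ℚ_[p])‖ := norm_pos_iff.2 (Rat.cast_ne_zero.2 hc)
  induction x using OnePoint.rec with
  | infty =>
    simp only [MapsToBallInfty, Matrix.smul_apply, smul_eq_mul, Rat.cast_mul, norm_mul]
    exact mul_lt_mul_iff_right₀ hc'
  | coe t =>
    change ‖(((c * M 1 0 : ℚ) : ℚ_[p]) * t + ((c * M 1 1 : ℚ) : ℚ_[p]))‖ <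
      ‖(((c * M 0 0 : ℚ) : ℚ_[p]) * t + ((c * M 0 1 : ℚ) : ℚ_[p]))‖ ↔
      ‖(M 1 0 * t + M 1 1 : ℚ_[p])‖ < ‖(M 0 0 * t + M 0 1 : ℚ_[p])‖
    simp only [Rat.cast_mul, mul_assoc, ← mul_add, norm_mul]
    exact mul_lt_mul_iff_right₀ hc'

/-- In homogeneous coordinates `U_∞` is the set `‖v‖ < ‖u‖`. It is stable under `Γ₀(p)`, whose
elements have diagonal entries that are `p`-adic units and a lower left entry divisible by `p`. -/
theorem norm_lt_norm_iff_of_mem_Gamma0 {g : SL(2, ℤ)} (hg : g ∈ CongruenceSubgroup.Gamma0 p)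
    (u v : ℚ_[p]) :
    ‖((g 1 0 : ℤ) : ℚ_[p]) * u + ((g 1 1 : ℤ) : ℚ_[p]) * v‖ <
      ‖((g 0 0 : ℤ) : ℚ_[p]) * u + ((g 0 1 : ℤ) : ℚ_[p]) * v‖ ↔ ‖v‖ < ‖u‖ := by
  have hpd : (p : ℤ) ∣ g 1 0 := by
    rwa [CongruenceSubgroup.Gamma0_mem, ZMod.intCast_zmod_eq_zero_iff_dvd] at hg
  have hc : ‖((g 1 0 : ℤ) : ℚ_[p])‖ < 1 := (Padic.norm_intCast_lt_one_iff).2 hpd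
  have hint : ∀ z : ℤ, ‖(z : ℚ_[p])‖ ≤ 1 := Padic.norm_int_le_one
  have hdet := g.det_coe
  rw [Matrix.det_fin_two] at hdet
  have hunit : ∀ z w : ℤ, z * w - g 0 1 * g 1 0 = 1 → ‖(z : ℚ_[p])‖ = 1 := by
    intro z w h
    refine le_antisymm (hint z) (not_lt.1 fun hlt => ?_)
    have h1 : (p : ℤ) ∣ 1 := by
      rw [← h]
      exact dvd_sub ((Padic.norm_intCast_lt_one_iff.1 hlt).mul_right _) (hpd.mul_left _)
    exact (Nat.prime_iff_prime_int.1 hp.out).not_dvd_one h1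
  have ha := hunit _ _ hdet
  have hd := hunit (g 1 1) (g 0 0) (by linarith)
  constructor
  · intro h
    by_contra! hle
    refine absurd h (not_lt.2 ?_)
    have h1 : ‖((g 0 0 : ℤ) : ℚ_[p]) * u + ((g 0 1 : ℤ) : ℚ_[p]) * v‖ ≤ ‖v‖ := by
      refine (IsUltrametricDist.norm_add_le_max _ _).trans (max_le ?_ ?_)
      · rw [norm_mul, ha, one_mul]
        exact hle
      · rw [norm_mul]
        exact mul_le_of_le_one_left (norm_nonneg _) (hint _)
    rcases eq_or_ne v 0 with rfl | hv
    · rw [norm_zero] at h1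
      exact h1.trans (norm_nonneg _)
    refine h1.trans (le_of_eq ?_)
    have h2 : ‖((g 1 0 : ℤ) : ℚ_[p]) * u‖ < ‖((g 1 1 : ℤ) : ℚ_[p]) * v‖ := by
      rw [norm_mul, norm_mul, hd, one_mul]
      refine lt_of_le_of_lt (mul_le_mul_of_nonneg_left hle (norm_nonneg _)) ?_
      exact mul_lt_of_lt_one_left (norm_pos_iff.2 hv) hc
    rw [IsUltrametricDist.norm_add_eq_max_of_norm_ne_norm h2.ne, max_eq_right h2.le, norm_mul, hd,
      one_mul]
  · intro h
    have hu : 0 < ‖u‖ := lt_of_le_of_lt (norm_nonneg _) h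
    have h1 : ‖((g 0 1 : ℤ) : ℚ_[p]) * v‖ < ‖((g 0 0 : ℤ) : ℚ_[p]) * u‖ := by
      rw [norm_mul, norm_mul, ha, one_mul]
      exact lt_of_le_of_lt (mul_le_of_le_one_left (norm_nonneg _) (hint _)) h
    rw [IsUltrametricDist.norm_add_eq_max_of_norm_ne_norm h1.ne', max_eq_left h1.le, norm_mul, ha,
      one_mul]
    refine lt_of_le_of_lt (IsUltrametricDist.norm_add_le_max _ _) (max_lt ?_ ?_)
    · rw [norm_mul]
      exact mul_lt_of_lt_one_left hu hc
    · rw [norm_mul, hd, one_mul]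
      exact h

theorem mapsToBallInfty_ratMat_mul {g : SL(2, ℤ)} (hg : g ∈ CongruenceSubgroup.Gamma0 p)
    (M : Matrix (Fin 2) (Fin 2) ℚ) (x : P1Qp p) :
    MapsToBallInfty (ratMat g * M) x ↔ MapsToBallInfty M x := by
  have hentry : ∀ i j, (((ratMat g * M) i j : ℚ) : ℚ_[p]) =
      ((g i 0 : ℤ) : ℚ_[p]) * M 0 j + ((g i 1 : ℤ) : ℚ_[p]) * M 1 j := fun i j => by
    rw [Matrix.mul_apply, Fin.sum_univ_two]
    simp [ratMat]
  induction x using OnePoint.rec with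
  | infty =>
    simp only [MapsToBallInfty, hentry]
    exact norm_lt_norm_iff_of_mem_Gamma0 hg _ _
  | coe t =>
    refine Iff.trans ?_ (norm_lt_norm_iff_of_mem_Gamma0 hg (M 0 0 * t + M 0 1 : ℚ_[p])
      (M 1 0 * t + M 1 1 : ℚ_[p]))
    change ‖(((ratMat g * M) 1 0 : ℚ) : ℚ_[p]) * t + (((ratMat g * M) 1 1 : ℚ) : ℚ_[p])‖ <
      ‖(((ratMat g * M) 0 0 : ℚ) : ℚ_[p]) * t + (((ratMat g * M) 0 1 : ℚ) : ℚ_[p])‖ ↔ _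
    simp only [hentry]
    refine iff_of_eq (congrArg₂ (· < ·) (congrArg norm ?_) (congrArg norm ?_)) <;> ring

theorem mapsToBallInfty_ballMat (a : ℚ) (k : ℤ) (x : P1Qp p) :
    MapsToBallInfty (ballMat p a k) x ↔ x ∉ padicBall (a : ℚ_[p]) k := by
  induction x using OnePoint.rec with
  | infty => exact iff_of_true (by simp [MapsToBallInfty, ballMat]) infty_notMem_padicBall
  | coe t =>
    rw [coe_mem_padicBall, not_le]
    change ‖(((0 : ℚ) : ℚ_[p])) * t + (((p : ℚ) ^ k : ℚ) : ℚ_[p])‖ <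
      ‖((1 : ℚ) : ℚ_[p]) * t + ((-a : ℚ) : ℚ_[p])‖ ↔ _
    push_cast
    rw [zero_mul, zero_add, one_mul, norm_zpow, Padic.norm_p, _root_.inv_zpow,
      ← _root_.zpow_neg, sub_eq_add_neg]

/-- The condition reads `‖t - a‖ < p ^ (-k + 1)`. As the norm takes only powers of `p` as nonzero
values, this is the closed condition `‖t - a‖ ≤ p ^ (-k)`. -/
theorem mapsToBallInfty_atkinLehner_mul_ballMat (a : ℚ) (k : ℤ) (x : P1Qp p) :
    MapsToBallInfty (atkinLehner p * ballMat p a k) x ↔ x ∈ padicBall (a : ℚ_[p]) k := by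
  have hM : atkinLehner p * ballMat p a k = !![0, -(p : ℚ) ^ k; (p : ℚ), -(p * a)] := by
    rw [atkinLehner, ballMat]
    ext i j
    fin_cases i <;> fin_cases j <;> simp [Matrix.mul_apply, Fin.sum_univ_two]
  rw [hM]
  induction x using OnePoint.rec with
  | infty => exact iff_of_false (by simp [MapsToBallInfty]) infty_notMem_padicBall
  | coe t =>
    rw [coe_mem_padicBall]
    change ‖((p : ℚ) : ℚ_[p]) * t + ((-(p * a) : ℚ) : ℚ_[p])‖ <
      ‖((0 : ℚ) : ℚ_[p]) * t + ((-(p : ℚ) ^ k : ℚ) : ℚ_[p])‖ ↔ _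
    push_cast
    have h1 : (p : ℚ_[p]) * t + -((p : ℚ_[p]) * a) = p * (t - a) := by ring
    have hp1 := prime_cast_pos p
    rw [h1, zero_mul, zero_add, norm_neg, norm_zpow, norm_mul, Padic.norm_p, _root_.inv_zpow,
      ← _root_.zpow_neg, Padic.norm_le_pow_iff_norm_lt_pow_add_one, zpow_add_one₀ hp1.ne',
      inv_mul_lt_iff₀ hp1, mul_comm]

end Ball

end MockHilbert


namespace MockHilbert

open Filter Topology UpperHalfPlane MatrixGroups ModularForm ModularGroup Matrix

/-! ### Decomposing `SL₂(ℤ[1/p])` along balls. -/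

section Decomposition

set_option linter.unusedSectionVars false

variable {p : ℕ} [hp : Fact p.Prime]

theorem prime_zpow_mem (k : ℤ) : (p : ℚ) ^ k ∈ Algebra.adjoin ℤ {((p : ℚ)⁻¹)} := by
  obtain ⟨n, rfl | rfl⟩ := k.eq_nat_or_neg
  · rw [zpow_natCast]
    exact Subalgebra.pow_mem _ (natCast_mem _ p) n
  · rw [_root_.zpow_neg, zpow_natCast, ← inv_pow]
    exact Subalgebra.pow_mem _ (Algebra.subset_adjoin (Set.mem_singleton _)) n

theorem exists_eq_div_prime_pow {x : ℚ} (hx : x ∈ Algebra.adjoin ℤ {((p : ℚ)⁻¹)}) :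
    ∃ (z : ℤ) (N : ℕ), x = (z : ℚ) / (p : ℚ) ^ N := by
  have hp0 := prime_cast_rat_ne_zero p
  induction hx using Algebra.adjoin_induction with
  | mem x hx =>
    rw [Set.mem_singleton_iff] at hx
    exact ⟨1, 1, by rw [hx]; simp⟩
  | algebraMap z => exact ⟨z, 0, by simp⟩
  | add x y _ _ hx hy =>
    obtain ⟨z, N, rfl⟩ := hx
    obtain ⟨w, M, rfl⟩ := hy
    refine ⟨z * p ^ M + w * p ^ N, N + M, ?_⟩
    push_cast
    rw [pow_add]
    field_simp
  | mul x y _ _ hx hy =>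
    obtain ⟨z, N, rfl⟩ := hx
    obtain ⟨w, M, rfl⟩ := hy
    refine ⟨z * w, N + M, ?_⟩
    push_cast
    rw [pow_add]
    field_simp

theorem div_prime_pow_mem (z : ℤ) (N : ℕ) :
    (z : ℚ) / (p : ℚ) ^ N ∈ Algebra.adjoin ℤ {((p : ℚ)⁻¹)} := by
  rw [div_eq_mul_inv, ← zpow_natCast, ← _root_.zpow_neg]
  exact mul_mem (intCast_mem _ z) (prime_zpow_mem _)

/-- After clearing denominators, the determinant relation shows that the gcd of the first column
divides a power of `p`, so it can be extracted as a power of `p`. -/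
theorem exists_prime_zpow_mul_coprime {A B C D : ℚ} (hA : A ∈ Algebra.adjoin ℤ {((p : ℚ)⁻¹)})
    (hB : B ∈ Algebra.adjoin ℤ {((p : ℚ)⁻¹)}) (hC : C ∈ Algebra.adjoin ℤ {((p : ℚ)⁻¹)})
    (hD : D ∈ Algebra.adjoin ℤ {((p : ℚ)⁻¹)}) (hdet : A * D - B * C = 1) :
    ∃ (α κ : ℤ) (e : ℤ), IsCoprime α κ ∧ A = α * (p : ℚ) ^ e ∧ C = κ * (p : ℚ) ^ e := by
  have hp0 := prime_cast_rat_ne_zero p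
  obtain ⟨α, N₁, rfl⟩ := exists_eq_div_prime_pow hA
  obtain ⟨β, N₂, rfl⟩ := exists_eq_div_prime_pow hB
  obtain ⟨κ, N₃, rfl⟩ := exists_eq_div_prime_pow hC
  obtain ⟨δ, N₄, rfl⟩ := exists_eq_div_prime_pow hD
  set a : ℤ := α * p ^ N₃ with ha
  set c : ℤ := κ * p ^ N₁ with hc
  have hint : a * (δ * p ^ N₂) - c * (β * p ^ N₄) = p ^ (N₁ + N₂ + N₃ + N₄) := by
    have : ((a * (δ * p ^ N₂) - c * (β * p ^ N₄) : ℤ) : ℚ) = p ^ (N₁ + N₂ + N₃ + N₄) := by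
      rw [ha, hc]
      push_cast
      have h2 : (α * δ : ℚ) * (p ^ N₂ * p ^ N₃) - β * κ * (p ^ N₁ * p ^ N₄) =
          p ^ N₁ * p ^ N₂ * p ^ N₃ * p ^ N₄ := by
        field_simp at hdet
        linear_combination hdet
      rw [pow_add, pow_add, pow_add]
      linear_combination h2
    exact_mod_cast this
  have hg0 : (Int.gcd a c) ∣ p ^ (N₁ + N₂ + N₃ + N₄) := by
    have h1 : ((Int.gcd a c : ℕ) : ℤ) ∣ ((p ^ (N₁ + N₂ + N₃ + N₄) : ℕ) : ℤ) := by
      push_cast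
      rw [← hint]
      exact dvd_sub ((Int.gcd_dvd_left ..).mul_right _) ((Int.gcd_dvd_right ..).mul_right _)
    exact Int.natCast_dvd_natCast.1 h1
  obtain ⟨m, -, hm⟩ := (Nat.dvd_prime_pow hp.out).1 hg0
  have hpos : 0 < Int.gcd a c := by rw [hm]; exact pow_pos hp.out.pos m
  obtain ⟨a', c', hcop, ha', hc'⟩ := Int.exists_gcd_one hpos
  rw [hm] at ha' hc'
  refine ⟨a', c', (m : ℤ) - (N₁ + N₃ : ℕ), Int.isCoprime_iff_gcd_eq_one.2 hcop, ?_, ?_⟩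
  · have h1 : (α : ℚ) * p ^ N₃ = a' * p ^ m := by exact_mod_cast ha ▸ ha'
    rw [zpow_sub₀ hp0, zpow_natCast, zpow_natCast, pow_add, ← mul_div_assoc, ← h1]
    field_simp
  · have h1 : (κ : ℚ) * p ^ N₁ = c' * p ^ m := by exact_mod_cast hc ▸ hc'
    rw [zpow_sub₀ hp0, zpow_natCast, zpow_natCast, pow_add, ← mul_div_assoc, ← h1]
    field_simp

/-- The Iwasawa decomposition of `SL₂(ℤ[1/p])`. -/
theorem exists_iwasawa (γ : Ihara p) : ∃ (g : SL(2, ℤ)) (e : ℤ),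
    ∃ a ∈ Algebra.adjoin ℤ {((p : ℚ)⁻¹)},
      iharaMat γ = (p : ℚ) ^ e • (ratMat g * ballMat p a (-2 * e)) := by
  have hp0 := prime_cast_rat_ne_zero p
  have hmem : ∀ i j, iharaMat γ i j ∈ Algebra.adjoin ℤ {((p : ℚ)⁻¹)} := fun i j =>
    (γ i j).2
  have hdet := det_iharaMat γ
  rw [Matrix.det_fin_two] at hdet
  obtain ⟨α, κ, e, ⟨y, x, hxy⟩, hA, hC⟩ := exists_prime_zpow_mul_coprime (hmem 0 0) (hmem 0 1)
    (hmem 1 0) (hmem 1 1) hdet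
  have hdet' : (!![α, -x; κ, y] : Matrix (Fin 2) (Fin 2) ℤ).det = 1 := by
    rw [Matrix.det_fin_two_of]
    linarith
  obtain ⟨g, hg⟩ : ∃ g : SL(2, ℤ), (g : Matrix (Fin 2) (Fin 2) ℤ) = !![α, -x; κ, y] :=
    ⟨⟨_, hdet'⟩, rfl⟩
  -- Since `g` has first column `(α, κ)`, the matrix `g⁻¹γ` is upper triangular with diagonal `p ^
  -- e`, `p ^ (-e)`. Its upper right entry, divided by `p ^ e`, is `-a`.
  refine ⟨g, e, -((y * iharaMat γ 0 1 + x * iharaMat γ 1 1) * (p : ℚ) ^ (-e)),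
    neg_mem (mul_mem (add_mem (mul_mem (intCast_mem _ _) (hmem _ _))
      (mul_mem (intCast_mem _ _) (hmem _ _))) (prime_zpow_mem _)), ?_⟩
  have hxy' : (y * α + x * κ : ℚ) = 1 := by exact_mod_cast hxy
  have he : (p : ℚ) ^ e ≠ 0 := zpow_ne_zero _ hp0
  have h2e : (p : ℚ) ^ (-2 * e) = ((p : ℚ) ^ e)⁻¹ * ((p : ℚ) ^ e)⁻¹ := by
    rw [← _root_.zpow_neg, ← zpow_add₀ hp0]
    ring_nf
  rw [hA, hC] at hdet
  have hE : (α * iharaMat γ 1 1 - κ * iharaMat γ 0 1) = ((p : ℚ) ^ e)⁻¹ := by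
    refine eq_inv_of_mul_eq_one_left ?_
    linear_combination hdet
  rw [ballMat, ratMat, hg, h2e, _root_.zpow_neg]
  set q := (p : ℚ) ^ e with hq
  have hqq : q * q⁻¹ = 1 := mul_inv_cancel₀ he
  ext i j
  fin_cases i <;> fin_cases j
  · simp [Matrix.mul_apply, Fin.sum_univ_two, hA, mul_comm]
  · simp [Matrix.mul_apply, Fin.sum_univ_two]
    linear_combination (-(iharaMat γ 0 1)) * hxy' + (-x) * hE -
      (α * (y * iharaMat γ 0 1 + x * iharaMat γ 1 1) - x * q⁻¹) * hqq
  · simp [Matrix.mul_apply, Fin.sum_univ_two, hC, mul_comm]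
  · simp [Matrix.mul_apply, Fin.sum_univ_two]
    linear_combination (-(iharaMat γ 1 1)) * hxy' + y * hE -
      (κ * (y * iharaMat γ 0 1 + x * iharaMat γ 1 1) + y * q⁻¹) * hqq

/-- The decomposition of `SL₂(ℤ[1/p])` into cosets of `Γ₀(p)`. -/
theorem exists_ball_decomposition (γ : Ihara p) : ∃ g ∈ CongruenceSubgroup.Gamma0 p,
    ∃ a ∈ Algebra.adjoin ℤ {((p : ℚ)⁻¹)}, ∃ (k : ℤ) (c : ℚ), c ≠ 0 ∧
      iharaMat γ = c • (ratMat g *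
        if Even k then ballMat p a k else atkinLehner p * ballMat p a k) := by
  have hp0 := prime_cast_rat_ne_zero p
  obtain ⟨σ, e, a, ha, h⟩ := exists_iwasawa γ
  have he : (p : ℚ) ^ e ≠ 0 := zpow_ne_zero _ hp0
  have heven : Even (-2 * e) := ⟨-e, by ring⟩
  obtain ⟨g, hg, rfl | ⟨i, rfl⟩⟩ := exists_coset_representative (p := p) σ
  · exact ⟨σ, hg, a, ha, -2 * e, _, he, by rw [if_pos heven, h]⟩
  -- Here `S T^i` is `p⁻¹ W` times the matrix with rows `(1, i)` and `(0, p)`. The latter merges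
  -- with `ballMat`, moving the center by `-i p ^ (-2e)` and raising the level to the odd number
  -- `-2e + 1`.
  · refine ⟨g, hg, a + (-i : ℤ) * (p : ℚ) ^ (-2 * e),
      add_mem ha (mul_mem (intCast_mem _ _) (prime_zpow_mem _)), -2 * e + 1, (p : ℚ) ^ e * (p : ℚ)⁻¹,
      mul_ne_zero he (inv_ne_zero hp0), ?_⟩
    have h1 : !![1, -((-i : ℤ) : ℚ); 0, (p : ℚ)] = !![1, (i : ℚ); 0, (p : ℚ)] := by
      push_cast
      rw [neg_neg]
    rw [if_neg (by rw [Int.even_add_one, not_not]; exact heven), h, ballMat_add_mul_zpow, h1,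
      ← mul_assoc (atkinLehner p), atkinLehner_mul_upper, Matrix.smul_mul, Matrix.mul_smul,
      smul_smul, mul_assoc, inv_mul_cancel₀ hp0, mul_one, ratMat_mul, mul_assoc]

/-- Balls of odd radius are translates of `U_∞`. -/
theorem exists_ihara_odd_ball {a : ℚ} (ha : a ∈ Algebra.adjoin ℤ {((p : ℚ)⁻¹)}) {k : ℤ}
    (hk : Odd k) : ∃ γ : Ihara p, ∀ x : P1Qp p,
      x ∈ padicBall (a : ℚ_[p]) k ↔ moebiusPadic γ x ∈ ballInfty p := by
  have hp0 := prime_cast_rat_ne_zero p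
  obtain ⟨j, rfl⟩ := hk
  -- The product `W * ballMat` has determinant `p ^ (2j + 2)`, a square because the level is odd;
  -- this scalar makes the determinant `1`.
  set c : ℚ := (p : ℚ) ^ (-(j + 1)) with hc
  have hc0 : c ≠ 0 := zpow_ne_zero _ hp0
  set M : Matrix (Fin 2) (Fin 2) ℚ := c • (atkinLehner p * ballMat p a (2 * j + 1)) with hM
  have hdet : M.det = 1 := by
    rw [hM, Matrix.det_smul, Matrix.det_mul, atkinLehner, ballMat, Matrix.det_fin_two_of,
      Matrix.det_fin_two_of, Fintype.card_fin, hc, ← zpow_natCast, ← _root_.zpow_mul]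
    have h1 : (0 : ℚ) * 0 - -1 * p = (p : ℚ) ^ (1 : ℤ) := by rw [zpow_one]; ring
    rw [h1, one_mul, mul_zero, sub_zero, ← zpow_add₀ hp0, ← zpow_add₀ hp0, ← zpow_zero (p : ℚ)]
    congr 1
    push_cast
    ring
  have hmem : ∀ i j, M i j ∈ Algebra.adjoin ℤ {((p : ℚ)⁻¹)} := by
    intro i j
    rw [hM, Matrix.smul_apply, smul_eq_mul, Matrix.mul_apply, Fin.sum_univ_two, atkinLehner,
      ballMat]
    have hp' : (p : ℚ) ∈ Algebra.adjoin ℤ {((p : ℚ)⁻¹)} := natCast_mem _ p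
    refine mul_mem (prime_zpow_mem _) (add_mem (mul_mem ?_ ?_) (mul_mem ?_ ?_)) <;>
      fin_cases i <;> fin_cases j <;>
      simp [hp', ha, prime_zpow_mem, zero_mem, one_mem]
  set N : Matrix (Fin 2) (Fin 2) (ZInv p) := fun i j => ⟨M i j, hmem i j⟩ with hN
  have hNdet : N.det = 1 := by
    refine Subtype.ext ?_
    rw [Matrix.det_fin_two]
    rw [Matrix.det_fin_two] at hdet
    exact hdet
  obtain ⟨γ, h⟩ : ∃ γ : Ihara p, iharaMat γ = M := ⟨⟨N, hNdet⟩, rfl⟩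
  refine ⟨γ, fun x => ?_⟩
  rw [moebiusPadic_mem_ballInfty, h, hM, mapsToBallInfty_smul hc0,
    mapsToBallInfty_atkinLehner_mul_ballMat]

end Decomposition

/-! ### Existence and uniqueness of the modular symbol measure. -/

section ModularSymbolMeasure

variable {p : ℕ} [hp : Fact p.Prime]

/-- The decomposition of `γ` identifies `γ⁻¹U_∞` as a ball of odd level or the complement of one of
even level. The scalar and the factor in `Γ₀(p)` affect neither the set nor the period. -/
theorem isModularSymbolMeasure_measure (f : S2Gamma0 p) {Λ : AddSubgroup ℂ}
    (hΛ : ∀ r s : OnePoint ℚ, period f r s ∈ Λ) (r s : OnePoint ℚ) :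
    IsModularSymbolMeasure f r s (ballPeriod_isDistribution f r s hΛ).measure := by
  set hφ := ballPeriod_isDistribution f r s hΛ
  refine ⟨hφ.measure_top, fun γ U hU => ?_⟩
  obtain ⟨g, hg, a, ha, k, c, hc, h⟩ := exists_ball_decomposition γ
  have hval := congrArg Subtype.val (hφ.measure_padicBall a (exists_eq_div_prime_pow ha) k)
  change (hφ.measure.toFun (padicBall (a : ℚ_[p]) k) : ℂ) = ballPeriod f r s a k at hval
  have hper : period f (moebiusRat γ r) (moebiusRat γ s) = matPeriod f r s (iharaMat γ) := by
    rw [moebiusRat_eq_mob, moebiusRat_eq_mob, matPeriod]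
  rw [hper]
  by_cases hk : Even k
  · rw [if_pos hk] at h
    rw [ballPeriod, if_pos hk] at hval
    have hUball : U = (padicBall (a : ℚ_[p]) k)ᶜ := by
      ext x
      rw [SetLike.mem_coe, hU, moebiusPadic_mem_ballInfty, h, mapsToBallInfty_smul hc,
        mapsToBallInfty_ratMat_mul hg, mapsToBallInfty_ballMat]
      rfl
    rw [hUball, BoundaryMeasure.toFun_compl _ hφ.measure_top, h, matPeriod_smul f r s hc,
      matPeriod_ratMat_mul f r s hg (det_ballMat p a k), AddSubgroup.coe_neg, hval, neg_neg]
  · rw [if_neg hk] at h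
    rw [ballPeriod, if_neg hk] at hval
    have hUball : U = padicBall (a : ℚ_[p]) k := by
      ext x
      rw [SetLike.mem_coe, hU, moebiusPadic_mem_ballInfty, h, mapsToBallInfty_smul hc,
        mapsToBallInfty_ratMat_mul hg, mapsToBallInfty_atkinLehner_mul_ballMat]
      rfl
    rw [hUball, hval, h, matPeriod_smul f r s hc, matPeriod_ratMat_mul f r s hg]
    rw [Matrix.det_mul]
    exact mul_ne_zero (det_atkinLehner p) (det_ballMat p a k)

theorem IsModularSymbolMeasure.unique {f : S2Gamma0 p} {Λ : AddSubgroup ℂ} {r s : OnePoint ℚ}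
    {μ ν : BoundaryMeasure p Λ} (hμ : IsModularSymbolMeasure f r s μ)
    (hν : IsModularSymbolMeasure f r s ν) : μ = ν := by
  refine BoundaryMeasure.eq_of_odd hμ.total hν.total fun n i hn => Subtype.ext ?_
  obtain ⟨γ, hγ⟩ := exists_ihara_odd_ball (div_prime_pow_mem (p := p) (i : ℤ) n)
    (k := (n : ℤ)) (by exact_mod_cast hn)
  have hc : (((((i : ℤ) : ℚ) / (p : ℚ) ^ n : ℚ)) : ℚ_[p]) = center p n i := by
    rw [center]
    push_cast
    rfl
  rw [hc] at hγ
  rw [hμ.ball γ _ hγ, hν.ball γ _ hγ]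

end ModularSymbolMeasure

end MockHilbert

open MockHilbert in
theorem lemma1 (p : ℕ) [Fact p.Prime] (f : S2Gamma0 p) (Λ : AddSubgroup ℂ) (hfg : Λ.FG)
    (hΛ : ∀ r s : OnePoint ℚ, period f r s ∈ Λ) (r s : OnePoint ℚ) :
    (∃! μ : BoundaryMeasure p Λ, IsModularSymbolMeasure f r s μ) ∧
    ∀ μ : BoundaryMeasure p Λ, IsModularSymbolMeasure f r s μ →
      (∃! ω : TensorProduct ℤ (RigidDiff p) Λ, IsPoissonTransform μ ω) ∧
      ∀ ω : TensorProduct ℤ (RigidDiff p) Λ, IsPoissonTransform μ ω →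
        ∃ F : TensorProduct ℤ (Additive (UnitsModConst p)) Λ, dlogTensor Λ F = ω := by
  exact ⟨⟨_, isModularSymbolMeasure_measure f hΛ r s, fun _ hν =>
    hν.unique (isModularSymbolMeasure_measure f hΛ r s)⟩,
    fun μ _ => poissonTransform_existsUnique hfg μ⟩
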